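/- Let $n\ge 1$, $p\ge 0$ be integers and let $T\subset\mathbb R^n$ be an open nondegenerate simplex with diameter $h_T$, vertices $\mathcal V_T$, faces $\mathcal F_T$, and barycentric coordinates $\eta_z$ ($z\in\mathcal V_T$). Write $(\cdot,\cdot)_T$, $\|\cdot\|_T$ for the $L^2(T)$ inner product and norm, $\langle v,w\rangle_{\partial T}=\int_{\partial T}vw$, $P^q(T)$ for the polynomials of degree at most $q$, $\boldsymbol P^q(T)=P^q(T)^n$, $\Pi^q_T:L^2(T)\to P^q(T)$ for the $L^2(T)$-orthogonal projection, and $P^q_c(\mathcal F_T)$ for the continuous functions on $\partial T$ that are polynomials of degree at most $q$ on every face. Let $H(\mathrm{div};T)$ be the space of $\tau\in L^2(T)^n$ with weak divergence $\operatorname{div}\tau\in L^2(T)$; its normal trace is defined by $\langle\tau\cdot n_T,v\rangle_{\partial T}=(\operatorname{div}\tau,v)_T+(\tau,\nabla v)_T$ for $v\in H^1(T)$ (this depends only on the trace of $v$ on $\partial T$). For $\alpha>0$ set $\|\tau\|_{T,\alpha}^2=\|\tau\|_T^2+\alpha^2\|\operatorname{div}\tau\|_T^2$. Let $\widetilde P^{p+1}(T)$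 be the $L^2(T)$-orthogonal complement, in $P^{p+1}(T)$, of $\{v\in P^{p+1}(T): v|_{\partial T}=0\}$. Let $(\widetilde\nu_j)_j$ be a basis of $\widetilde P^{p+1}(T)$, and $(\nu_j)_j$ the basis of $\widetilde P^{p+1}(T)$ with $\langle\nu_j,\widetilde\nu_k\rangle_{\partial T}=|\partial T|\,\delta_{jk}$. For the face $F$ opposite to the vertex $z_F$ let $\psi_F(x)=\frac{|F|}{n|T|}(x-z_F)$, and set $\psi_{\partial T,j}=\widetilde\nu_j\sum_{F\in\mathcal F_T}\psi_F$. Fix a vertex $z_*$. For each of the $n$ edges $E=\operatorname{conv}\{z_*,z'\}$ at $z_*$ (their set is $\mathcal E_*$) let $t_E=z'-z_*$ and $\eta_E=\eta_{z_*}\eta_{z'}$, and let $\sigma_E\in\mathbb R^n$ be the vectors with $\sigma_E\cdot t_{E'}=\delta_{E,E'}$. Let $(\widetilde\chi_j)_j$ be a basis of $P^p(T)$ and, for $E\in\mathcal E_*$, let $(\chi_{E,j})_j$ be the basis of $P^p(T)$ with $(\chi_{E,j},\widetilde\chi_k\eta_E)_T=|T|\,\delta_{jk}$. Put $\boldsymbol\eta_{E,j}=\eta_E\widetilde\chi_j\,t_E$,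 $\sigma_{E,j}=\chi_{E,j}\sigma_E$, and for $\tau\in H(\mathrm{div};T)$ $$\widetilde\Pi\tau=\sum_j\frac{\langle\tau\cdot n_T,\nu_j\rangle_{\partial T}}{\langle\psi_{\partial T,j}\cdot n_T,\nu_j\rangle_{\partial T}}\,\psi_{\partial T,j},\qquad \Pi^{\mathrm{div}}_{F,hp}\tau=\widetilde\Pi\tau+\sum_{E\in\mathcal E_*}\sum_j\frac{(\sigma_{E,j},\tau-\widetilde\Pi\tau)_T}{(\sigma_{E,j},\boldsymbol\eta_{E,j})_T}\,\boldsymbol\eta_{E,j}.$$ Theorem. Bases $(\widetilde\nu_j)$ and $(\widetilde\chi_j)$ exist, and for any such bases and any $z_*$ the dual families $(\nu_j)$, $(\sigma_E)$, $(\chi_{E,j})$ exist. For any such choices, with $\Pi=\Pi^{\mathrm{div}}_{F,hp}$ and for all $\tau\in H(\mathrm{div};T)$: 1. $\Pi\tau\in V:=\operatorname{span}\{\psi_{\partial T,j}\}_j+\operatorname{span}\{\boldsymbol\eta_{E,j}\}_{E,j}\subseteq\boldsymbol P^{p+2}(T)\subset H(\mathrm{div};T)$. 2. $\langle(\tau-\Pi\tau)\cdot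 n_T,u\rangle_{\partial T}=0$ for all $u\in P_c^{p+1}(\mathcal F_T)$ (each such $u$ being the trace of an $H^1(T)$ function), and $(\sigma,\tau-\Pi\tau)_T=0$ for all $\sigma\in\boldsymbol P^p(T)$. 3. $\operatorname{div}\Pi\tau=\Pi_T^{p+1}\operatorname{div}\tau$. 4. $\|\Pi\tau\|_T\le C\,(\|\tau\|_T+h_T\|\operatorname{div}\tau\|_T)$, where $C$ depends only on $n$, $p$ and the shape of $T$, i.e. on an upper bound $\gamma$ for $h_T/r$, where $r$ is the radius of some ball contained in $T$. 5. If $\alpha>0$ and $h_T\le K\alpha$, then $\|\Pi\tau\|_{T,\alpha}\le C_F\|\tau\|_{T,\alpha}$, where $C_F$ depends only on $n$, $p$, $\gamma$ and $K$. -/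

import Mathlib

open MeasureTheory Filter Topology
open scoped ContDiff

noncomputable section

namespace FortinDiv

/-- The Euclidean space `ℝⁿ`. -/
abbrev E (n : ℕ) : Type := EuclideanSpace ℝ (Fin n)

/-- The vertices of a nondegenerate simplex in `ℝⁿ`: `n + 1` affinely independent points. The
function `b.coord i` is the affine function `η_z` for the vertex `z = b i`. -/
abbrev Simplex (n : ℕ) : Type := AffineBasis (Fin (n + 1)) ℝ (E n)

variable {n : ℕ}

/-! ### Sobolev spaces and traces on an open set -/

/-- The `L²(T)` norm (of scalar or vector valued functions). -/
def l2norm {F : Type*} [NormedAddCommGroup F] (T : Set (E n)) (f : E n → F) : ℝ :=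
  (eLpNorm f 2 (volume.restrict T)).toReal

/-- `φ ∈ C_c^∞(T)`. -/
def IsTestFunction (T : Set (E n)) (φ : E n → ℝ) : Prop :=
  ContDiff ℝ ∞ φ ∧ HasCompactSupport φ ∧ tsupport φ ⊆ T

/-- `g` is a distributional gradient of `v` on `T`. -/
def HasWeakGrad (T : Set (E n)) (v : E n → ℝ) (g : E n → E n) : Prop :=
  ∀ φ, IsTestFunction T φ → ∫ x in T, v x • gradient φ x = -∫ x in T, φ x • g x

/-- `d` is a distributional divergence of `τ` on `T`. -/
def HasWeakDiv (T : Set (E n)) (τ : E n → E n) (d : E n → ℝ) : Prop :=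
  ∀ φ, IsTestFunction T φ → ∫ x in T, inner ℝ (τ x) (gradient φ x) = -∫ x in T, d x * φ x

/-- `v ∈ H¹(T)`. -/
def MemH1 (T : Set (E n)) (v : E n → ℝ) : Prop :=
  MemLp v 2 (volume.restrict T) ∧ ∃ g, MemLp g 2 (volume.restrict T) ∧ HasWeakGrad T v g

/-- `τ ∈ H(div; T)`. -/
def MemHdiv (T : Set (E n)) (τ : E n → E n) : Prop :=
  MemLp τ 2 (volume.restrict T) ∧ ∃ d, MemLp d 2 (volume.restrict T) ∧ HasWeakDiv T τ d

open Classical in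
/-- The weak gradient of `v ∈ H¹(T)` (unique up to null sets). -/
def weakGrad (T : Set (E n)) (v : E n → ℝ) : E n → E n :=
  if h : ∃ g, MemLp g 2 (volume.restrict T) ∧ HasWeakGrad T v g then h.choose else 0

open Classical in
/-- The weak divergence of `τ ∈ H(div; T)` (unique up to null sets). -/
def weakDiv (T : Set (E n)) (τ : E n → E n) : E n → ℝ :=
  if h : ∃ d, MemLp d 2 (volume.restrict T) ∧ HasWeakDiv T τ d then h.choose else 0

/-- The surface measure on `∂T`. -/
def surface (T : Set (E n)) : Measure (E n) :=
  (Measure.euclideanHausdorffMeasure (n - 1)).restrict (frontier T)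

/-- `u` is the trace on `∂T` of `v ∈ H¹(T)`: there are smooth functions converging to `v` in
`H¹(T)` whose restrictions to `∂T` converge to `u` in `L²(∂T)`. -/
def HasTrace (T : Set (E n)) (v u : E n → ℝ) : Prop :=
  ∃ φ : ℕ → E n → ℝ, (∀ k, ContDiff ℝ ∞ (φ k)) ∧
    Tendsto (fun k => eLpNorm (φ k - v) 2 (volume.restrict T)) atTop (𝓝 0) ∧
    Tendsto (fun k => eLpNorm (gradient (φ k) - weakGrad T v) 2 (volume.restrict T))
      atTop (𝓝 0) ∧
    Tendsto (fun k => eLpNorm (φ k - u) 2 (surface T)) atTop (𝓝 0)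

/-- The duality `⟨τ·n, v⟩_{∂T} = (div τ, v)_T + (τ, ∇v)_T` of the normal trace of
`τ ∈ H(div; T)` and the trace of `v ∈ H¹(T)`. -/
def pairing (T : Set (E n)) (τ : E n → E n) (v : E n → ℝ) : ℝ :=
  (∫ x in T, weakDiv T τ x * v x) + ∫ x in T, inner ℝ (τ x) (weakGrad T v x)

/-- `⟨τ·n, u⟩_{∂T} = c` for a function `u` on `∂T`: it is the trace of some `v ∈ H¹(T)`, and
every `v ∈ H¹(T)` with trace `u` gives the value `c`. -/
def PairingEq (T : Set (E n)) (τ : E n → E n) (u : E n → ℝ) (c : ℝ) : Prop :=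
  (∃ v, MemH1 T v ∧ HasTrace T v u) ∧
    ∀ v, MemH1 T v → HasTrace T v u → pairing T τ v = c

/-- The norm `(‖τ‖_T² + α² ‖div τ‖_T²)^{1/2}`. -/
def alphaNorm (T : Set (E n)) (α : ℝ) (τ : E n → E n) : ℝ :=
  Real.sqrt (l2norm T τ ^ 2 + α ^ 2 * l2norm T (weakDiv T τ) ^ 2)

/-! ### The simplex and polynomial spaces -/

/-- The open simplex. -/
def elt (b : Simplex n) : Set (E n) := interior (convexHull ℝ (Set.range b))

/-- The closed face opposite to the vertex `b i`. -/
def face (b : Simplex n) (i : Fin (n + 1)) : Set (E n) := convexHull ℝ (b '' {i}ᶜ)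

/-- The diameter of the simplex. -/
def diam (b : Simplex n) : ℝ := Metric.diam (elt b)

/-- Shape regularity: the simplex contains a ball of radius `r` with `h_T ≤ γ r`. -/
def ShapeRegular (γ : ℝ) (b : Simplex n) : Prop :=
  ∃ (c : E n) (r : ℝ), 0 < r ∧ Metric.ball c r ⊆ elt b ∧ diam b ≤ γ * r

/-- The linear map sending a polynomial to its function on `ℝⁿ`. -/
def evalFun (n : ℕ) : MvPolynomial (Fin n) ℝ →ₗ[ℝ] (E n → ℝ) where
  toFun f := fun x => MvPolynomial.eval (fun i => x i) f
  map_add' f g := by ext x; simp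
  map_smul' c f := by ext x; simp [MvPolynomial.smul_eval]

/-- `P^q`: polynomial functions of total degree at most `q`. As nondegenerate simplices have
interior points, such a function is identified with its restriction to a simplex. -/
def polySpace (n q : ℕ) : Submodule ℝ (E n → ℝ) :=
  (MvPolynomial.restrictTotalDegree (Fin n) ℝ q).map (evalFun n)

/-- Vector fields with all components in `P^q`. -/
def vecPoly (n q : ℕ) : Submodule ℝ (E n → E n) where
  carrier := {σ | ∀ i, (fun x => σ x i) ∈ polySpace n q}
  add_mem' h h' i := (polySpace n q).add_mem (h i) (h' i)
  zero_mem' _ := (polySpace n q).zero_mem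
  smul_mem' c _ h i := (polySpace n q).smul_mem c (h i)

theorem continuous_of_mem {q : ℕ} {v : E n → ℝ} (hv : v ∈ polySpace n q) : Continuous v := by
  obtain ⟨f, -, rfl⟩ := hv
  exact (MvPolynomial.continuous_eval f).comp (by fun_prop)

theorem integrable_of_continuous (b : Simplex n) {v : E n → ℝ} (hv : Continuous v) :
    Integrable v (volume.restrict (elt b)) :=
  (hv.continuousOn.integrableOn_compact
    ((Set.finite_range b).isCompact_convexHull ℝ)).mono_set interior_subset

/-- The polynomials in `P^q` that vanish on the boundary of the simplex. -/
def bubbleSpace (b : Simplex n) (q : ℕ) : Submodule ℝ (E n → ℝ) where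
  carrier := {v | v ∈ polySpace n q ∧ ∀ x ∈ frontier (elt b), v x = 0}
  add_mem' {v w} hv hw :=
    ⟨(polySpace n q).add_mem hv.1 hw.1, fun x hx => by simp [hv.2 x hx, hw.2 x hx]⟩
  zero_mem' := ⟨(polySpace n q).zero_mem, fun _ _ => rfl⟩
  smul_mem' c v hv := ⟨(polySpace n q).smul_mem c hv.1, fun x hx => by simp [hv.2 x hx]⟩

/-- The `L²(T)`-orthogonal complement of the bubble space in `P^q`. -/
def tildeSpace (b : Simplex n) (q : ℕ) : Submodule ℝ (E n → ℝ) where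
  carrier := {v | v ∈ polySpace n q ∧ ∀ w ∈ bubbleSpace b q, ∫ x in elt b, v x * w x = 0}
  add_mem' {v v'} hv hv' := by
    refine ⟨(polySpace n q).add_mem hv.1 hv'.1, fun w hw => ?_⟩
    have cw := continuous_of_mem hw.1
    have h := integral_add (integrable_of_continuous b ((continuous_of_mem hv.1).mul cw))
      (integrable_of_continuous b ((continuous_of_mem hv'.1).mul cw))
    simp only [Pi.add_apply, Pi.mul_apply, add_mul] at h ⊢
    rw [h, hv.2 w hw, hv'.2 w hw, add_zero]
  zero_mem' := ⟨(polySpace n q).zero_mem, fun w _ => by simp⟩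
  smul_mem' c v hv := by
    refine ⟨(polySpace n q).smul_mem c hv.1, fun w hw => ?_⟩
    simp only [Pi.smul_apply, smul_eq_mul, mul_assoc]
    rw [integral_const_mul, hv.2 w hw, mul_zero]

/-- `u ∈ P_c^q(𝓕_T)`: a continuous function on `∂T` which on every face is a polynomial of
degree at most `q`. Only the values of `u` on `∂T` matter. -/
def IsContFacePoly (b : Simplex n) (q : ℕ) (u : E n → ℝ) : Prop :=
  ContinuousOn u (frontier (elt b)) ∧ ∀ i, ∃ f ∈ polySpace n q, Set.EqOn u f (face b i)

/-- `w` is the `L²(T)`-orthogonal projection of `v` onto `P^q`. -/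
def IsL2Proj (b : Simplex n) (q : ℕ) (v w : E n → ℝ) : Prop :=
  w ∈ polySpace n q ∧ ∀ u ∈ polySpace n q, ∫ x in elt b, (v x - w x) * u x = 0

/-- A finite family is a basis of a subspace. -/
def IsBasisOf {ι : Type*} (f : ι → E n → ℝ) (V : Submodule ℝ (E n → ℝ)) : Prop :=
  LinearIndependent ℝ f ∧ Submodule.span ℝ (Set.range f) = V

/-! ### Basis functions -/

/-- `|T|`. -/
def vol (b : Simplex n) : ℝ := (volume (elt b)).toReal

/-- `|F|` for the face opposite to the vertex `b i`. -/
def faceArea (b : Simplex n) (i : Fin (n + 1)) : ℝ :=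
  (Measure.euclideanHausdorffMeasure (n - 1) (face b i)).toReal

/-- `|∂T|`. -/
def bdryArea (b : Simplex n) : ℝ := (surface (elt b) Set.univ).toReal

/-- The Raviart--Thomas function `ψ_F(x) = |F| / (n |T|) (x - z_F)`, whose normal component is
`1` on `F` and `0` on the other faces. -/
def psiFace (b : Simplex n) (i : Fin (n + 1)) (x : E n) : E n :=
  (faceArea b i / (n * vol b)) • (x - b i)

/-- `ψ_{∂T} = ∑_F ψ_F`. -/
def psiBdry (b : Simplex n) (x : E n) : E n := ∑ i, psiFace b i x

/-- The edges `E ∈ 𝓔_*` that meet in the vertex `z_* = b z`, indexed by their other vertex. -/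
abbrev Edge (z : Fin (n + 1)) : Type := {i : Fin (n + 1) // i ≠ z}

/-- The tangential vector `t_E`. -/
def tangent (b : Simplex n) (z : Fin (n + 1)) (e : Edge z) : E n := b e.1 - b z

/-- The edge function `η_E`, product of the two barycentric coordinates of the edge. -/
def edgeFun (b : Simplex n) (z : Fin (n + 1)) (e : Edge z) (x : E n) : ℝ :=
  b.coord z x * b.coord e.1 x

/-- A choice of bases `ν̃_{∂T,j}` of `P̃^{p+1}(T)` and `χ̃_{T,j}` of `P^p(T)`. -/
structure PrimalBases (b : Simplex n) (p : ℕ) where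
  /-- `dim P̃^{p+1}(T)` -/
  J : ℕ
  /-- `dim P^p(T)` -/
  K : ℕ
  /-- the functions `ν̃_{∂T,j}` -/
  nuT : Fin J → E n → ℝ
  /-- the functions `χ̃_{T,j}` -/
  chiT : Fin K → E n → ℝ
  nuT_basis : IsBasisOf nuT (tildeSpace b (p + 1))
  chiT_basis : IsBasisOf chiT (polySpace n p)

/-- The dual bases `ν_{∂T,j}` (with respect to `⟨·,·⟩_{∂T}`), `σ_E` (with respect to the
tangential vectors), and `χ_{E,j}` (with respect to `(·, η_E ·)_T`). -/
structure DualBases {b : Simplex n} {p : ℕ} (B : PrimalBases b p) (z : Fin (n + 1)) where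
  /-- the functions `ν_{∂T,j}` -/
  nu : Fin B.J → E n → ℝ
  /-- the (constant) values of the fields `σ_E` -/
  sigma : Edge z → E n
  /-- the functions `χ_{E,j}` -/
  chi : Edge z → Fin B.K → E n → ℝ
  nu_basis : IsBasisOf nu (tildeSpace b (p + 1))
  nu_dual : ∀ j k, ∫ x, nu j x * B.nuT k x ∂(surface (elt b)) = if j = k then bdryArea b else 0
  sigma_dual : ∀ e e', inner ℝ (sigma e) (tangent b z e') = if e = e' then (1 : ℝ) else 0
  chi_basis : ∀ e, IsBasisOf (chi e) (polySpace n p)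
  chi_dual : ∀ e j k, ∫ x in elt b, chi e j x * (B.chiT k x * edgeFun b z e x) =
    if j = k then vol b else 0

variable {b : Simplex n} {p : ℕ}

/-- `ψ_{∂T,j} = ψ_{∂T} ν̃_{∂T,j}`. -/
def PrimalBases.psi (B : PrimalBases b p) (j : Fin B.J) (x : E n) : E n :=
  B.nuT j x • psiBdry b x

/-- `𝛈_{E,j} = η_E t_E χ̃_{T,j}`. -/
def PrimalBases.eta (B : PrimalBases b p) (z : Fin (n + 1)) (e : Edge z) (j : Fin B.K)
    (x : E n) : E n :=
  (edgeFun b z e x * B.chiT j x) • tangent b z e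

/-- `V_hp^div = span {ψ_{∂T,j}} + span {𝛈_{E,j}}`. -/
def PrimalBases.V (B : PrimalBases b p) (z : Fin (n + 1)) : Submodule ℝ (E n → E n) :=
  Submodule.span ℝ (Set.range B.psi) ⊔
    Submodule.span ℝ (Set.range fun ej : Edge z × Fin B.K => B.eta z ej.1 ej.2)

variable {B : PrimalBases b p} {z : Fin (n + 1)}

/-- `σ_{E,j} = σ_E χ_{E,j}`. -/
def DualBases.sig (D : DualBases B z) (e : Edge z) (j : Fin B.K) (x : E n) : E n :=
  D.chi e j x • D.sigma e

/-- The operator `Π̃_{F,hp}^div`. -/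
def DualBases.fortinTilde (D : DualBases B z) (τ : E n → E n) (x : E n) : E n :=
  ∑ j, (pairing (elt b) τ (D.nu j) / pairing (elt b) (B.psi j) (D.nu j)) • B.psi j x

/-- The operator `Π_{F,hp}^div`. -/
def DualBases.fortin (D : DualBases B z) (τ : E n → E n) (x : E n) : E n :=
  D.fortinTilde τ x + ∑ e : Edge z, ∑ j,
    ((∫ y in elt b, inner ℝ (D.sig e j y) (τ y - D.fortinTilde τ y)) /
      ∫ y in elt b, inner ℝ (D.sig e j y) (B.eta z e j y)) • B.eta z e j x

end FortinDiv

end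

noncomputable section

namespace FortinDiv

variable {n : ℕ}

/-! ### Geometry of a simplex -/

/-! The field `ψ_F` has normal component `1` on `F` and `0` on the other faces, so `w ψ_{∂T}` has
normal trace `w` (`pairing_smul_psiBdry`). Hence `Π̃ τ = w ψ_{∂T}`, where `w ∈ P̃^{p+1}(T)`
represents the functional `v ↦ ⟨τ·n, v⟩` in the inner product of `L²(∂T)`. This product is definite
on `P̃^{p+1}(T)`, since an element that vanishes on `∂T` is a bubble orthogonal to itself. Every
polynomial of degree `p + 1` is an element of `P̃^{p+1}(T)` plus a bubble, and bubbles pair to zero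
with every field in `H(div; T)`, so `Π̃` preserves all boundary moments of degree `p + 1`. Every `u
∈ P_c^{p+1}(𝓕_T)` is the trace of such a polynomial (`IsContFacePoly.exists_extension`).

The fields `η_E q t_E` have zero normal trace (`pairing_edge`): `η_E` vanishes on the faces opposite
to the two ends of `E`, and `t_E` is tangent to all others. The second correction therefore leaves
the boundary moments alone. As the `σ_E` are dual to the `t_E`, it decouples into one problem per
edge, with weight `η_E > 0`, and enforces orthogonality to `P^p(T)^n`. The commuting property is
Green's formula: for `u ∈ P^{p+1}(T)` the boundary term and the term with `∇u ∈ P^p(T)^n` both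
vanish, and `div Π τ` has degree at most `p + 1`.

Testing `w` with itself gives `‖w‖²_{∂T} ≤ ‖div τ‖ ‖w‖ + ‖τ‖ ‖∇w‖`. Together with `‖w‖²_T ≤ C h_T
‖w‖²_{∂T}` on `P̃^{p+1}(T)` and the inverse estimate for `∇w`, this bounds `w`; an analogous test
with `q_E ∇η_{z'}` bounds the edge coefficients. These arguments use only the defining moments, so
the constants do not depend on the bases. The polynomial inequalities follow by compactness on one
fixed simplex and transfer by affine maps, which multiply all volume integrals by the same factor.
Surface integrals take part because `integral_div_cone` turns them into volume integrals; the only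
metric quantities left are the numbers `‖∇η_z‖`, with `1 ≤ h_T ‖∇η_z‖ ≤ γ`.

The analytic point is that the pairing depends on the trace only, where traces are limits of smooth
functions (`pairing_eq_of_hasTrace`). If `ψ_k` is bounded in `H¹(T)` and tends to zero in `L²(∂T)`,
the weak divergence is tested with `ψ_k` times a cutoff of width `ε`. The error lives on the
boundary strip, where `‖ψ_k‖² ≤ C (ε ‖ψ_k‖²_{∂T} + ε² ‖∇ψ_k‖²)`. This compensates the factor `1/ε`
from the cutoff, while the norms of `τ` and `div τ` on the strip tend to zero. -/

/-- The gradient of the barycentric coordinate `b.coord i`. -/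
def baryGrad (b : Simplex n) (i : Fin (n + 1)) : E n :=
  (InnerProductSpace.toDual ℝ (E n)).symm (LinearMap.toContinuousLinearMap (b.coord i).linear)

theorem inner_baryGrad (b : Simplex n) (i : Fin (n + 1)) (v : E n) :
    inner ℝ (baryGrad b i) v = (b.coord i).linear v := by
  simp [baryGrad]

theorem coord_add (b : Simplex n) (i : Fin (n + 1)) (x v : E n) :
    b.coord i (x + v) = b.coord i x + inner ℝ (baryGrad b i) v := by
  have := (b.coord i).map_vadd x v
  rw [vadd_eq_add, vadd_eq_add, add_comm v x] at this
  rw [inner_baryGrad, this, add_comm]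

theorem coord_sub (b : Simplex n) (i : Fin (n + 1)) (x y : E n) :
    inner ℝ (baryGrad b i) (x - y) = b.coord i x - b.coord i y := by
  have := coord_add b i y (x - y)
  rw [add_sub_cancel] at this
  linarith

theorem continuous_coord (b : Simplex n) (i : Fin (n + 1)) : Continuous (b.coord i) :=
  (b.coord i).continuous_of_finiteDimensional

theorem contDiff_coord (b : Simplex n) (i : Fin (n + 1)) {k : WithTop ℕ∞} :
    ContDiff ℝ k (b.coord i) := by
  have : (b.coord i : E n → ℝ) = fun x => b.coord i 0 + inner ℝ (baryGrad b i) x := by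
    ext x; simpa using coord_add b i 0 x
  rw [this]
  exact contDiff_const.add (innerSL ℝ (baryGrad b i)).contDiff

theorem hasFDerivAt_coord (b : Simplex n) (i : Fin (n + 1)) (x : E n) :
    HasFDerivAt (b.coord i) (innerSL ℝ (baryGrad b i)) x := by
  have : (b.coord i : E n → ℝ) = fun x => b.coord i 0 + innerSL ℝ (baryGrad b i) x := by
    ext x; simpa using coord_add b i 0 x
  rw [this]
  exact (innerSL ℝ (baryGrad b i)).hasFDerivAt.const_add _

theorem baryGrad_ne_zero [NeZero n] (b : Simplex n) (i : Fin (n + 1)) : baryGrad b i ≠ 0 := by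
  intro h
  obtain ⟨j, hj⟩ := exists_ne i
  have := coord_sub b i (b i) (b j)
  simp [h, hj.symm] at this

/-- The closed simplex. -/
def closedElt (b : Simplex n) : Set (E n) := convexHull ℝ (Set.range b)

theorem mem_closedElt {b : Simplex n} {x : E n} : x ∈ closedElt b ↔ ∀ i, 0 ≤ b.coord i x := by
  rw [closedElt, b.convexHull_eq_nonneg_coord]; rfl

theorem mem_elt {b : Simplex n} {x : E n} : x ∈ elt b ↔ ∀ i, 0 < b.coord i x := by
  rw [elt, b.interior_convexHull]; rfl

theorem isOpen_elt (b : Simplex n) : IsOpen (elt b) := isOpen_interior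

theorem elt_subset (b : Simplex n) : elt b ⊆ closedElt b := interior_subset

theorem isCompact_closedElt (b : Simplex n) : IsCompact (closedElt b) :=
  (Set.finite_range b).isCompact_convexHull ℝ

theorem elt_ae_eq (b : Simplex n) : elt b =ᵐ[volume] closedElt b :=
  interior_ae_eq_of_null_frontier ((convex_convexHull ℝ _).addHaar_frontier volume)

theorem restrict_elt (b : Simplex n) :
    (volume.restrict (elt b) : Measure (E n)) = volume.restrict (closedElt b) :=
  Measure.restrict_congr_set (elt_ae_eq b)

theorem sum_coord (b : Simplex n) (x : E n) : ∑ i, b.coord i x = 1 :=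
  b.sum_coord_apply_eq_one x

theorem coord_le_one {b : Simplex n} {x : E n} (hx : x ∈ closedElt b) (i : Fin (n + 1)) :
    b.coord i x ≤ 1 := by
  rw [← sum_coord b x]
  exact Finset.single_le_sum (f := fun i => b.coord i x) (fun j _ => mem_closedElt.1 hx j)
    (Finset.mem_univ i)

theorem elt_nonempty (b : Simplex n) : (elt b).Nonempty :=
  ⟨_, b.centroid_mem_interior_convexHull⟩

theorem vertex_mem (b : Simplex n) (i : Fin (n + 1)) : b i ∈ closedElt b :=
  subset_convexHull ℝ _ ⟨i, rfl⟩

theorem closure_elt (b : Simplex n) : closure (elt b) = closedElt b := by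
  rw [elt, (convex_convexHull ℝ _).closure_interior_eq_closure_of_nonempty_interior
    (elt_nonempty b)]
  exact (isCompact_closedElt b).isClosed.closure_eq

theorem mem_face {b : Simplex n} {i : Fin (n + 1)} {x : E n} :
    x ∈ face b i ↔ x ∈ closedElt b ∧ b.coord i x = 0 := by
  constructor
  · intro hx
    refine ⟨convexHull_mono (Set.image_subset_range _ _) hx, ?_⟩
    have : b '' {i}ᶜ ⊆ {x | b.coord i x = 0} := by
      rintro _ ⟨j, hj, rfl⟩
      have hj : j ≠ i := hj
      simp [hj.symm]
    refine convexHull_min this ?_ hx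
    exact (convex_singleton (0 : ℝ)).affine_preimage (b.coord i)
  · rintro ⟨hx, hi⟩
    rw [mem_closedElt] at hx
    have h2 : ∑ j ∈ Finset.univ.erase i, b.coord j x = 1 := by
      rw [Finset.sum_erase (f := fun j => b.coord j x) Finset.univ hi, sum_coord]
    have h3 := Finset.centerMass_mem_convexHull (s := b '' {i}ᶜ) (Finset.univ.erase i)
      (w := fun j => b.coord j x) (z := b) (fun j _ => hx j) (by rw [h2]; exact one_pos)
      (fun j hj => ⟨j, by simpa using hj, rfl⟩)
    rw [Finset.centerMass_eq_of_sum_1 _ _ h2, Finset.sum_erase _ (by simp [hi])] at h3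
    rwa [b.linear_combination_coord_eq_self x] at h3

theorem frontier_elt (b : Simplex n) : frontier (elt b) = ⋃ i, face b i := by
  rw [frontier, closure_elt, (isOpen_elt b).interior_eq]
  ext x
  simp only [Set.mem_sdiff, Set.mem_iUnion, mem_face, mem_elt, not_forall, not_lt]
  constructor
  · rintro ⟨hx, i, hi⟩
    exact ⟨i, hx, le_antisymm hi (mem_closedElt.1 hx i)⟩
  · rintro ⟨i, hx, hi⟩
    exact ⟨hx, i, hi.le⟩

theorem isCompact_face (b : Simplex n) (i : Fin (n + 1)) : IsCompact (face b i) :=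
  (((Set.finite_range b).subset (Set.image_subset_range _ _))).isCompact_convexHull ℝ

/-! ### Integration over cones -/

/-- The vector from the vertex `b i` to its projection to the opposite face. -/
def heightVec (b : Simplex n) (i : Fin (n + 1)) : E n :=
  -(‖baryGrad b i‖ ^ 2)⁻¹ • baryGrad b i

section height
variable [NeZero n] (b : Simplex n) (i : Fin (n + 1))

theorem inner_heightVec : inner ℝ (baryGrad b i) (heightVec b i) = -1 := by
  have := norm_ne_zero_iff.2 (baryGrad_ne_zero b i)
  rw [heightVec, inner_smul_right, real_inner_self_eq_norm_sq]
  field_simp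

theorem norm_heightVec : ‖heightVec b i‖ = ‖baryGrad b i‖⁻¹ := by
  have := norm_ne_zero_iff.2 (baryGrad_ne_zero b i)
  rw [heightVec, norm_smul, norm_neg, norm_inv, norm_pow, norm_norm]
  field_simp

theorem heightVec_ne_zero : heightVec b i ≠ 0 := by
  intro h
  simpa [h] using inner_heightVec b i

/-- The directions parallel to the face opposite to `b i`. -/
abbrev faceDir {n : ℕ} (b : Simplex n) (i : Fin (n + 1)) : Submodule ℝ (E n) := (ℝ ∙ heightVec b i)ᗮ

theorem finrank_faceDir : Module.finrank ℝ (faceDir b i) = n - 1 := by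
  have h := (ℝ ∙ heightVec b i).finrank_add_finrank_orthogonal
  rw [finrank_span_singleton (heightVec_ne_zero b i)] at h
  simp only [finrank_euclideanSpace, Fintype.card_fin] at h
  have h2 : Module.finrank ℝ (faceDir b i) = Module.finrank ℝ ((ℝ ∙ heightVec b i)ᗮ : Submodule ℝ (E n)) := rfl
  omega

theorem inner_faceDir (w : faceDir b i) : inner ℝ (baryGrad b i) (w : E n) = 0 := by
  have h := Submodule.mem_orthogonal_singleton_iff_inner_right.1 w.2
  rw [heightVec, inner_smul_left] at h
  have := norm_ne_zero_iff.2 (baryGrad_ne_zero b i)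
  simpa [this] using h

/-- The isometric parametrization of the hyperplane of the face opposite to `b i`. -/
def faceParam {n : ℕ} (b : Simplex n) (i : Fin (n + 1)) (w : faceDir b i) : E n :=
  b i + (heightVec b i + w)

theorem coord_faceParam (w : faceDir b i) : b.coord i (faceParam b i w) = 0 := by
  rw [faceParam, coord_add, inner_add_right, inner_heightVec, inner_faceDir]
  simp

omit [NeZero n] in
theorem isometry_faceParam : Isometry (faceParam b i) := by
  refine Isometry.of_dist_eq fun x y => ?_
  simp [faceParam, Subtype.dist_eq]

theorem exists_faceParam {x : E n} (hx : b.coord i x = 0) : ∃ w, faceParam b i w = x := by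
  refine ⟨⟨x - b i - heightVec b i, ?_⟩, ?_⟩
  · rw [Submodule.mem_orthogonal_singleton_iff_inner_right, heightVec, inner_smul_left,
      ← heightVec, inner_sub_right, coord_sub, inner_heightVec, hx]
    simp
  · simp [faceParam]

omit [NeZero n] in
theorem measurableEmbedding_faceParam : MeasurableEmbedding (faceParam b i) :=
  (isometry_faceParam b i).isClosedEmbedding.measurableEmbedding

theorem face_subset_range : face b i ⊆ Set.range (faceParam b i) :=
  fun _ hx => exists_faceParam b i (mem_face.1 hx).2

/-- Hausdorff measure is invariant under the isometry `faceParam`, and on the Euclidean space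
`faceDir b i` of dimension `n - 1` it is Lebesgue measure. Surface integrals over a face thus become
Lebesgue integrals. -/
theorem restrict_face :
    (Measure.euclideanHausdorffMeasure (n - 1)).restrict (face b i) =
      (volume.restrict (faceParam b i ⁻¹' face b i)).map (faceParam b i) := by
  rw [← (measurableEmbedding_faceParam b i).restrict_map,
    ← InnerProductSpace.euclideanHausdorffMeasure_eq_volume,
    (isometry_faceParam b i).map_euclideanHausdorffMeasure, finrank_faceDir,
    Measure.restrict_restrict (isCompact_face b i).measurableSet,
    Set.inter_eq_left.2 (face_subset_range b i)]

omit [NeZero n] in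
theorem isCompact_preimage_face : IsCompact (faceParam b i ⁻¹' face b i) :=
  (isometry_faceParam b i).isClosedEmbedding.isCompact_preimage (isCompact_face b i)

theorem integral_face (f : E n → ℝ) :
    ∫ x in face b i, f x ∂(Measure.euclideanHausdorffMeasure (n - 1)) =
      ∫ w in faceParam b i ⁻¹' face b i, f (faceParam b i w) := by
  rw [restrict_face, (measurableEmbedding_faceParam b i).integral_map]

instance isFiniteMeasure_face : IsFiniteMeasure
    ((Measure.euclideanHausdorffMeasure (n - 1) : Measure (E n)).restrict (face b i)) := by
  have : IsFiniteMeasure ((volume : Measure (faceDir b i)).restrict (faceParam b i ⁻¹' face b i)) :=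
    ⟨by simpa using (isCompact_preimage_face b i).measure_lt_top⟩
  rw [restrict_face]
  infer_instance

/-- Fubini for the orthogonal splitting into the line of `heightVec b i` and its complement. The
factor `‖heightVec b i‖` appears because the line is parametrized by multiples of that vector and
not by arc length. -/
theorem integral_eq_slices {f : E n → ℝ} (hf : Integrable f) :
    ∫ x, f x = ‖heightVec b i‖ * ∫ t : ℝ, ∫ w : faceDir b i, f (b i + (t • heightVec b i + w)) := by
  have h0 := heightVec_ne_zero b i
  set e := heightVec b i with he
  have h1 := ((ℝ ∙ e).measurePreserving_measurableEquivProd (b i)).symm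
  have h2 := InnerProductSpace.euclideanHausdorffMeasure_eq_volume (V := E n)
  rw [h2] at h1
  have hi := (h1.integrable_comp_emb (MeasurableEquiv.measurableEmbedding _)).2 hf
  rw [← h1.integral_comp (MeasurableEquiv.measurableEmbedding _), Measure.volume_eq_prod,
    integral_prod (fun z => f (((ℝ ∙ e).measurableEquivProd (b i)).symm z)) hi]
  let v : (ℝ ∙ e) := ⟨e, Submodule.mem_span_singleton_self e⟩
  have hv : v ≠ 0 := fun h => h0 (congrArg Subtype.val h)
  have h3 := volume_eq_of_finrank_eq_one (finrank_span_singleton h0) hv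
  have h4 : MeasurableEmbedding (fun x : ℝ => x • v) :=
    (ContinuousLinearEquiv.toSpanNonzeroSingleton ℝ e h0).toHomeomorph.measurableEmbedding
  rw [h3, integral_smul_measure, h4.integral_map]
  simp only [smul_eq_mul, toReal_enorm]
  simp only [v, Submodule.measurableEquivProd_symm_apply, Submodule.coe_smul, vadd_eq_add,
    add_comm (b i)]
  rfl


omit [NeZero n] in
theorem coord_cone {j : Fin (n + 1)} (hj : j ≠ i) (t : ℝ) (w : faceDir b i) :
    b.coord j (b i + t • (heightVec b i + (w : E n))) = t * b.coord j (faceParam b i w) := by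
  rw [coord_add, faceParam, coord_add, inner_smul_right, b.coord_apply_ne hj]
  ring

theorem coord_cone_self (t : ℝ) (w : E n) (hw : w ∈ faceDir b i) :
    b.coord i (b i + (t • heightVec b i + w)) = 1 - t := by
  rw [coord_add, inner_add_right, inner_smul_right, inner_heightVec,
    inner_faceDir b i ⟨w, hw⟩, b.coord_apply_eq]
  ring

theorem cone_mem_closedElt {t : ℝ} (ht : 0 < t) (w : faceDir b i) :
    b i + t • (heightVec b i + (w : E n)) ∈ closedElt b ↔
      t ≤ 1 ∧ w ∈ faceParam b i ⁻¹' face b i := by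
  have h0 : b.coord i (b i + t • (heightVec b i + (w : E n))) = 1 - t := by
    rw [smul_add]
    exact coord_cone_self b i t _ ((faceDir b i).smul_mem t w.2)
  rw [Set.mem_preimage, mem_face, mem_closedElt, mem_closedElt]
  constructor
  · intro h
    refine ⟨by linarith [h i, h0], fun j => ?_, coord_faceParam b i w⟩
    by_cases hj : j = i
    · rw [hj, coord_faceParam]
    · have := h j
      rw [coord_cone b i hj] at this
      exact nonneg_of_mul_nonneg_right this ht
  · rintro ⟨h1, h2, -⟩ j
    by_cases hj : j = i
    · rw [hj, h0]; linarith
    · rw [coord_cone b i hj]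
      exact mul_nonneg ht.le (h2 j)

/-- The slice of the simplex at height `t` is the opposite face dilated by `t` about the vertex.
Substituting `w ↦ t • w` in dimension `n - 1` produces the weight `t ^ (n - 1)`. -/
theorem integral_cone {f : E n → ℝ} (hf : Continuous f) :
    ∫ x in elt b, f x = ‖heightVec b i‖ * ∫ t in (0 : ℝ)..1, t ^ (n - 1) *
      ∫ w in faceParam b i ⁻¹' face b i, f (b i + t • (heightVec b i + (w : E n))) := by
  have hm := (isCompact_closedElt b).measurableSet
  have hK := (isCompact_preimage_face b i).measurableSet
  rw [restrict_elt, ← integral_indicator hm, integral_eq_slices b i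
    ((hf.continuousOn.integrableOn_compact (isCompact_closedElt b)).integrable_indicator hm),
    intervalIntegral.integral_of_le zero_le_one, ← integral_indicator measurableSet_Ioc]
  congr 1
  refine integral_congr_ae ?_
  -- The null set `t = 0` is discarded because the dilation degenerates there. For `t < 0` the slice
  -- is empty, as its points have `i`-th coordinate `1 - t > 1`.
  filter_upwards [compl_mem_ae_iff.2 (measure_singleton (μ := volume) (0 : ℝ))] with t ht
  have ht : t ≠ 0 := ht
  rcases lt_or_gt_of_ne ht with h | h
  · rw [Set.indicator_of_notMem (fun hh => not_lt.2 hh.1.le h)]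
    refine (integral_congr_ae (Eventually.of_forall fun w => ?_)).trans (integral_zero _ _)
    refine Set.indicator_of_notMem (fun hw => ?_) _
    have h1 := coord_le_one hw i
    rw [coord_cone_self b i t w w.2] at h1
    linarith
  · set F : faceDir b i → ℝ := fun w =>
      (closedElt b).indicator f (b i + (t • heightVec b i + (w : E n))) with hF
    have h1 := Measure.integral_comp_smul (volume : Measure (faceDir b i)) F t
    rw [finrank_faceDir, abs_of_pos (by positivity), smul_eq_mul, eq_inv_mul_iff_mul_eq₀
      (by positivity)] at h1
    rw [← h1]
    have h2 : (fun w => F (t • w)) = fun w => if t ≤ 1 then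
        (faceParam b i ⁻¹' face b i).indicator
          (fun w : faceDir b i => f (b i + t • (heightVec b i + (w : E n)))) w else 0 := by
      ext w
      have h3 := cone_mem_closedElt b i h w
      have h4 : b i + (t • heightVec b i + ((t • w : faceDir b i) : E n)) =
        b i + t • (heightVec b i + (w : E n)) := by simp
      simp only [hF, h4]
      by_cases h5 : b i + t • (heightVec b i + (w : E n)) ∈ closedElt b
      · rw [Set.indicator_of_mem h5, if_pos (h3.1 h5).1, Set.indicator_of_mem (h3.1 h5).2]
      · rw [Set.indicator_of_notMem h5]
        split_ifs with h6
        · rw [Set.indicator_of_notMem fun h7 => h5 (h3.2 ⟨h6, h7⟩)]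
        · rfl
    rw [h2]
    by_cases h6 : t ≤ 1
    · rw [Set.indicator_of_mem (show t ∈ Set.Ioc 0 1 from ⟨h, h6⟩)]
      simp only [if_pos h6]
      rw [integral_indicator hK]
    · rw [Set.indicator_of_notMem (fun hh => h6 hh.2)]
      simp [h6]

/-- The divergence theorem for the fields `f(x) (x - b i)`, whose normal component vanishes on
all faces but the one opposite to `b i`. -/
theorem integral_div_cone {f : E n → ℝ} (hf : ContDiff ℝ 1 f) :
    ∫ x in elt b, (n * f x + fderiv ℝ f x (x - b i)) =
      ‖heightVec b i‖ * ∫ x in face b i, f x ∂(Measure.euclideanHausdorffMeasure (n - 1)) := by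
  have hc := hf.continuous
  have hc' : Continuous (fderiv ℝ f) := hf.continuous_fderiv one_ne_zero
  have hg : Continuous fun x => n * f x + fderiv ℝ f x (x - b i) := by fun_prop
  rw [integral_cone b i hg, integral_face]
  congr 1
  simp only [← integral_const_mul]
  have hcont : Continuous (Function.uncurry fun (t : ℝ) (w : faceDir b i) => t ^ (n - 1) *
      (n * f (b i + t • (heightVec b i + (w : E n))) +
        fderiv ℝ f (b i + t • (heightVec b i + (w : E n)))
          (b i + t • (heightVec b i + (w : E n)) - b i))) := by
    simp only [Function.uncurry_def]
    fun_prop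
  rw [intervalIntegral_integral_swap]
  · refine integral_congr_ae (Eventually.of_forall fun w => ?_)
    -- On each ray from the vertex the integrand is the derivative of `t ^ n * f`, so after
    -- exchanging the integrals the fundamental theorem leaves the value of `f` on the face. The
    -- contribution of `t = 0` vanishes since `n ≠ 0`.
    have hd : ∀ t ∈ Set.uIcc (0 : ℝ) 1, HasDerivAt
        (fun t : ℝ => t ^ n * f (b i + t • (heightVec b i + (w : E n))))
        (t ^ (n - 1) * (n * f (b i + t • (heightVec b i + (w : E n))) +
        fderiv ℝ f (b i + t • (heightVec b i + (w : E n)))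
          (b i + t • (heightVec b i + (w : E n)) - b i))) t := by
      intro t _
      have h1 : HasDerivAt (fun t : ℝ => b i + t • (heightVec b i + (w : E n)))
          (heightVec b i + (w : E n)) t := by
        simpa using ((hasDerivAt_id t).smul_const (heightVec b i + (w : E n))).const_add (b i)
      have h2 := ((hf.differentiable one_ne_zero) _).hasFDerivAt.comp_hasDerivAt t h1
      refine ((hasDerivAt_pow n t).mul h2).congr_deriv ?_
      have hn : n = n - 1 + 1 := (Nat.succ_pred_eq_of_ne_zero (NeZero.ne n)).symm
      have h3 : t ^ n = t ^ (n - 1) * t := by rw [← pow_succ, ← hn]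
      simp only [add_sub_cancel_left, map_smul, smul_eq_mul, h3, Function.comp]
      ring
    have := intervalIntegral.integral_eq_sub_of_hasDerivAt hd
      ((hcont.comp (Continuous.prodMk_left w)).intervalIntegrable _ _)
    simp only [this, faceParam]
    simp [NeZero.ne n]
  · rw [Measure.prod_restrict, Set.uIoc_of_le zero_le_one]
    exact (hcont.continuousOn.integrableOn_compact
      (isCompact_Icc.prod (isCompact_preimage_face b i))).mono_set
      (Set.prod_mono Set.Ioc_subset_Icc_self subset_rfl)

end height

/-! ### The surface measure of a simplex -/

section surface
variable [NeZero n] (b : Simplex n)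

/-- The set is an affine subspace, and a proper one: the vertex `b j` lies in the hyperplane of the
face and has `j`-th coordinate `1`. This makes distinct faces almost disjoint. -/
theorem volume_coord_faceParam {i j : Fin (n + 1)} (hj : j ≠ i) :
    volume {w : faceDir b i | b.coord j (faceParam b i w) = 0} = 0 := by
  let φ : faceDir b i →ᵃ[ℝ] ℝ := (b.coord j).comp
    ((faceDir b i).subtype.toAffineMap + AffineMap.const ℝ _ (b i + heightVec b i))
  have hφ : ∀ w, φ w = b.coord j (faceParam b i w) := fun w => by
    simp only [φ, faceParam, ← add_assoc, add_comm _ (w : E n)]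
    simp [add_assoc]
  let s : AffineSubspace ℝ (faceDir b i) := (AffineSubspace.mk' (0 : ℝ) ⊥).comap φ
  have hs : ∀ w, w ∈ s ↔ b.coord j (faceParam b i w) = 0 := fun w => by
    rw [AffineSubspace.mem_comap, hφ, AffineSubspace.mem_mk']
    simp
  have : {w : faceDir b i | b.coord j (faceParam b i w) = 0} = s := by
    ext w; exact (hs w).symm
  rw [this]
  refine Measure.addHaar_affineSubspace _ _ fun h => ?_
  obtain ⟨w, hw⟩ := exists_faceParam b i (b.coord_apply_ne hj.symm)
  have h2 := (hs w).1 (h ▸ AffineSubspace.mem_top ℝ _ w)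
  rw [hw, b.coord_apply_eq] at h2
  exact one_ne_zero h2

theorem aedisjoint_face : Pairwise (Function.onFun
    (AEDisjoint (Measure.euclideanHausdorffMeasure (n - 1) : Measure (E n))) (face b)) := by
  intro i j hij
  have h1 : MeasurableSet (face b j) := (isCompact_face b j).measurableSet
  have h2 : (Measure.euclideanHausdorffMeasure (n - 1)).restrict (face b i) (face b j) = 0 := by
    rw [restrict_face, Measure.map_apply (measurableEmbedding_faceParam b i).measurable h1]
    refine Measure.restrict_le_self _ |>.trans ?_ |> le_antisymm <| zero_le
    refine (measure_mono ?_).trans (volume_coord_faceParam b hij.symm).le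
    intro w hw
    exact (mem_face.1 hw).2
  rw [Measure.restrict_apply h1] at h2
  rwa [Function.onFun, AEDisjoint, Set.inter_comm]

theorem surface_eq_sum : surface (elt b) = Measure.sum fun i =>
    (Measure.euclideanHausdorffMeasure (n - 1)).restrict (face b i) := by
  rw [surface, frontier_elt, Measure.restrict_iUnion_ae (aedisjoint_face b)
    fun i => (isCompact_face b i).measurableSet.nullMeasurableSet]

instance isFiniteMeasure_surface : IsFiniteMeasure (surface (elt b)) := by
  rw [surface_eq_sum, Measure.sum_fintype]
  infer_instance

omit [NeZero n] in
theorem isCompact_frontier_elt : IsCompact (frontier (elt b)) := by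
  rw [frontier_elt]
  exact isCompact_iUnion (isCompact_face b)

theorem memLp_surface {f : E n → ℝ} (hf : Continuous f) : MemLp f 2 (surface (elt b)) := by
  obtain ⟨C, hC⟩ := (isCompact_frontier_elt b).exists_bound_of_continuousOn hf.continuousOn
  refine MemLp.of_bound hf.aestronglyMeasurable C ?_
  rw [surface]
  exact ae_restrict_of_forall_mem (isCompact_frontier_elt b).measurableSet hC

theorem integrable_surface {f : E n → ℝ} (hf : Continuous f) : Integrable f (surface (elt b)) :=
  (memLp_surface b hf).integrable one_le_two

theorem integrable_face {f : E n → ℝ} (hf : Continuous f) (i : Fin (n + 1)) :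
    Integrable f ((Measure.euclideanHausdorffMeasure (n - 1)).restrict (face b i)) := by
  refine (integrable_surface b hf).mono_measure ?_
  rw [surface_eq_sum]
  exact Measure.le_sum _ i

theorem integral_surface {f : E n → ℝ} (hf : Continuous f) :
    ∫ x, f x ∂(surface (elt b)) =
      ∑ i, ∫ x in face b i, f x ∂(Measure.euclideanHausdorffMeasure (n - 1)) := by
  rw [surface_eq_sum, Measure.sum_fintype]
  exact integral_finsetSum_measure fun i _ => integrable_face b hf i

theorem integral_div_cone' {f : E n → ℝ} (hf : ContDiff ℝ 1 f) (i : Fin (n + 1)) :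
    ∫ x in face b i, f x ∂(Measure.euclideanHausdorffMeasure (n - 1)) =
      ‖baryGrad b i‖ * ∫ x in elt b, (n * f x + fderiv ℝ f x (x - b i)) := by
  rw [integral_div_cone b i hf, norm_heightVec, mul_inv_cancel_left₀
    (norm_ne_zero_iff.2 (baryGrad_ne_zero b i))]

omit [NeZero n] in
theorem volume_elt_lt_top : volume (elt b) < ⊤ :=
  (measure_mono (elt_subset b)).trans_lt (isCompact_closedElt b).measure_lt_top

omit [NeZero n] in
instance isFiniteMeasure_elt : IsFiniteMeasure (volume.restrict (elt b)) :=
  ⟨by simpa using volume_elt_lt_top b⟩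

omit [NeZero n] in
theorem vol_pos : 0 < vol b :=
  ENNReal.toReal_pos ((isOpen_elt b).measure_pos volume (elt_nonempty b)).ne'
    (volume_elt_lt_top b).ne

/-- The cone formula for `f = 1`, that is `n |T| = |F| · height` with height `1 / ‖∇η‖`. It removes
all measures from the coefficient of `ψ_F`. -/
theorem faceArea_eq (i : Fin (n + 1)) : faceArea b i = ‖baryGrad b i‖ * (n * vol b) := by
  have h := integral_div_cone' b (contDiff_const (c := (1 : ℝ))) i
  have h1 : ((Measure.euclideanHausdorffMeasure (n - 1)).real (face b i)) = faceArea b i := rfl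
  have h2 : volume.real (elt b) = vol b := rfl
  simpa [h1, h2, mul_comm] using h

theorem psiFace_eq (i : Fin (n + 1)) (x : E n) :
    psiFace b i x = ‖baryGrad b i‖ • (x - b i) := by
  have h1 := vol_pos b
  have h2 : (n : ℝ) ≠ 0 := NeZero.ne _
  rw [psiFace, faceArea_eq, mul_div_assoc, div_self (by positivity), mul_one]

theorem bdryArea_eq : bdryArea b = ∑ i, faceArea b i := by
  have h := integral_surface b (continuous_const (y := (1 : ℝ)))
  simpa [bdryArea, faceArea, Measure.real] using h

theorem bdryArea_pos : 0 < bdryArea b := by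
  rw [bdryArea_eq]
  refine Finset.sum_pos (fun i _ => ?_) ⟨0, Finset.mem_univ _⟩
  rw [faceArea_eq]
  have h1 := vol_pos b
  have h2 : (0 : ℝ) < n := by exact_mod_cast NeZero.pos n
  have h3 := norm_pos_iff.2 (baryGrad_ne_zero b i)
  positivity

/-- The divergence theorem for the fields `f ψ_{∂T}`. -/
theorem integral_surface_eq {f : E n → ℝ} (hf : ContDiff ℝ 1 f) :
    ∫ x, f x ∂(surface (elt b)) = ∑ i, ‖baryGrad b i‖ *
      ∫ x in elt b, (n * f x + fderiv ℝ f x (x - b i)) := by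
  rw [integral_surface b hf.continuous]
  exact Finset.sum_congr rfl fun i _ => integral_div_cone' b hf i

theorem exists_mem_face_forall_pos (i : Fin (n + 1)) :
    ∃ w : faceDir b i, ∀ j ≠ i, 0 < b.coord j (faceParam b i w) := by
  let c := (Finset.univ.erase i).affineCombination ℝ b (fun _ => (n : ℝ)⁻¹)
  have hn : (n : ℝ) ≠ 0 := NeZero.ne _
  have hs : ∑ j ∈ Finset.univ.erase i, (fun _ => (n : ℝ)⁻¹) j = 1 := by
    simp [hn]
  have h1 : b.coord i c = 0 := b.coord_apply_combination_of_notMem (by simp) hs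
  obtain ⟨w, hw⟩ := exists_faceParam b i h1
  refine ⟨w, fun j hj => ?_⟩
  rw [hw, b.coord_apply_combination_of_mem (by simpa using hj) hs]
  have : (0 : ℝ) < n := by exact_mod_cast NeZero.pos n
  positivity

/-- A continuous function whose square has a vanishing integral over a face vanishes there. -/
theorem eq_zero_on_face {f : E n → ℝ} (hf : Continuous f) (i : Fin (n + 1))
    (h : ∫ x in face b i, f x ^ 2 ∂(Measure.euclideanHausdorffMeasure (n - 1)) = 0) :
    ∀ x ∈ face b i, f x = 0 := by
  have hq := (isometry_faceParam b i).continuous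
  rw [integral_face] at h
  set K := faceParam b i ⁻¹' face b i with hK
  have hfK : IntegrableOn (fun w => f (faceParam b i w) ^ 2) K :=
    ((hf.comp hq).pow 2).continuousOn.integrableOn_compact (isCompact_preimage_face b i)
  rw [integral_eq_zero_iff_of_nonneg (fun _ => sq_nonneg _) hfK] at h
  set U : Set (faceDir b i) := {w | ∀ j ≠ i, 0 < b.coord j (faceParam b i w)} with hU
  have hUo : IsOpen U := by
    have : U = ⋂ j, {w : faceDir b i | j ≠ i → 0 < b.coord j (faceParam b i w)} := by
      ext w; simp [hU]
    rw [this]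
    refine isOpen_iInter_of_finite fun j => ?_
    by_cases hj : j = i
    · simp [hj]
    · simpa [hj] using isOpen_lt continuous_const ((continuous_coord b j).comp hq)
  have hUK : U ⊆ K := fun w hw => by
    rw [hK, Set.mem_preimage, mem_face, mem_closedElt]
    refine ⟨fun j => ?_, coord_faceParam b i w⟩
    by_cases hj : j = i
    · rw [hj, coord_faceParam]
    · exact (hw j hj).le
  have hzero : Set.EqOn (fun w => f (faceParam b i w) ^ 2) 0 U := by
    refine Measure.eqOn_open_of_ae_eq (μ := volume) (ae_restrict_of_ae_restrict_of_subset hUK h) hUo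
      ((hf.comp hq).pow 2).continuousOn continuousOn_const
  intro x hx
  obtain ⟨w, rfl⟩ := exists_faceParam b i (mem_face.1 hx).2
  obtain ⟨c, hc⟩ := exists_mem_face_forall_pos b i
  -- Almost everywhere vanishing gives vanishing on the relative interior `U`. A boundary point of
  -- the face is reached along the segment from a point `c` with all remaining coordinates positive.
  have hcl : w ∈ closure U := by
    have hcont : ContinuousAt (fun t : ℝ => w + t • (c - w)) 0 := by fun_prop
    have h0 : Tendsto (fun t : ℝ => w + t • (c - w)) (𝓝[>] 0) (𝓝 w) := by
      simpa [ContinuousAt] using hcont.tendsto.mono_left nhdsWithin_le_nhds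
    refine mem_closure_of_tendsto h0 ?_
    filter_upwards [Ioo_mem_nhdsGT (zero_lt_one (α := ℝ))] with t ht j hj
    have h1 : b.coord j (faceParam b i (w + t • (c - w))) =
        (1 - t) * b.coord j (faceParam b i w) + t * b.coord j (faceParam b i c) := by
      simp only [faceParam, coord_add, Submodule.coe_add, Submodule.coe_smul, Submodule.coe_sub,
        inner_add_right, inner_smul_right, inner_sub_right]
      ring
    rw [h1]
    have h2 := mem_closedElt.1 (mem_face.1 hx).1 j
    have h3 := hc j hj
    have h4 : 0 ≤ 1 - t := by linarith [ht.2]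
    have := mul_pos ht.1 h3
    positivity
  have hz := hzero.closure ((hf.comp hq).pow 2) continuous_const hcl
  simpa using hz

theorem eq_zero_on_frontier {f : E n → ℝ} (hf : Continuous f)
    (h : ∫ x, f x ^ 2 ∂(surface (elt b)) = 0) : ∀ x ∈ frontier (elt b), f x = 0 := by
  rw [integral_surface b (f := fun x => f x ^ 2) (hf.pow 2), Finset.sum_eq_zero_iff_of_nonneg
    fun i _ => integral_nonneg fun _ => sq_nonneg _] at h
  intro x hx
  rw [frontier_elt, Set.mem_iUnion] at hx
  obtain ⟨i, hi⟩ := hx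
  exact eq_zero_on_face b hf i (h i (Finset.mem_univ i)) x hi

/-! ### Shape regularity -/

omit [NeZero n] in
theorem dist_le_diam {x y : E n} (hx : x ∈ closedElt b) (hy : y ∈ closedElt b) :
    ‖x - y‖ ≤ diam b := by
  rw [diam, ← Metric.diam_closure, closure_elt, ← dist_eq_norm]
  exact Metric.dist_le_diam_of_mem (isCompact_closedElt b).isBounded hx hy

/-- Along an edge from `b i`, of length at most the diameter, the coordinate drops from `1` to `0`.
-/
theorem one_le_baryGrad_mul_diam (i : Fin (n + 1)) : 1 ≤ ‖baryGrad b i‖ * diam b := by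
  obtain ⟨j, hj⟩ := exists_ne i
  have h1 := coord_sub b i (b i) (b j)
  rw [b.coord_apply_eq, b.coord_apply_ne hj.symm, sub_zero] at h1
  calc (1 : ℝ) = inner ℝ (baryGrad b i) (b i - b j) := h1.symm
    _ ≤ ‖baryGrad b i‖ * ‖b i - b j‖ := real_inner_le_norm _ _
    _ ≤ _ := by
      gcongr
      exact dist_le_diam b (vertex_mem b i) (vertex_mem b j)

theorem diam_pos : 0 < diam b := by
  have h := one_le_baryGrad_mul_diam b 0
  by_contra hd
  have := mul_nonpos_of_nonneg_of_nonpos (norm_nonneg (baryGrad b 0)) (not_lt.1 hd)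
  linarith

-- Moving from the centre of the ball by `s < r` in the direction of `∇η` raises `η` by `s ‖∇η‖`,
-- and `0 < η ≤ 1` throughout, so `r ‖∇η‖ ≤ 1`. All norm bounds use shape regularity through this
-- inequality alone.
omit [NeZero n] in
theorem ShapeRegular.diam_mul_baryGrad_le {b : Simplex n} {γ : ℝ} (h : ShapeRegular γ b)
    (i : Fin (n + 1)) : diam b * ‖baryGrad b i‖ ≤ γ := by
  obtain ⟨c, r, hr, hball, hd⟩ := h
  have hd0 : 0 ≤ diam b := Metric.diam_nonneg
  have key : r * ‖baryGrad b i‖ ≤ 1 := by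
    by_cases h0 : baryGrad b i = 0
    · simp [h0]
    have h0' := norm_pos_iff.2 h0
    have : ∀ s ∈ Set.Ico 0 r, s * ‖baryGrad b i‖ ≤ 1 := by
      intro s hs
      have hx : c + (s / ‖baryGrad b i‖) • baryGrad b i ∈ elt b := by
        refine hball ?_
        rw [Metric.mem_ball, dist_eq_norm, add_sub_cancel_left, norm_smul, norm_div, norm_norm,
          div_mul_cancel₀ _ h0'.ne', Real.norm_of_nonneg hs.1]
        exact hs.2
      have hc : c ∈ elt b := hball (Metric.mem_ball_self hr)
      have h1 := coord_le_one (elt_subset b hx) i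
      rw [coord_add, inner_smul_right, real_inner_self_eq_norm_sq] at h1
      have h2 := mem_elt.1 hc i
      have h3 : s / ‖baryGrad b i‖ * ‖baryGrad b i‖ ^ 2 = s * ‖baryGrad b i‖ := by
        field_simp
      linarith
    have hcl : r ∈ closure (Set.Ico 0 r) := by
      rw [closure_Ico hr.ne]; exact ⟨hr.le, le_rfl⟩
    have hcs : IsClosed {s : ℝ | s * ‖baryGrad b i‖ ≤ 1} :=
      isClosed_le (by fun_prop) continuous_const
    exact closure_minimal this hcs hcl
  have hγ : 0 ≤ γ := by
    by_contra hneg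
    have := mul_neg_of_neg_of_pos (not_le.1 hneg) hr
    linarith
  calc diam b * ‖baryGrad b i‖ ≤ γ * r * ‖baryGrad b i‖ := by gcongr
    _ = γ * (r * ‖baryGrad b i‖) := by ring
    _ ≤ γ * 1 := by gcongr
    _ = γ := mul_one γ

end surface

/-! ### Polynomial functions -/

section poly

variable {q r : ℕ}

instance finiteDimensional_polySpace : FiniteDimensional ℝ (polySpace n q) := by
  unfold polySpace; infer_instance

theorem eval_mem_polySpace {f : MvPolynomial (Fin n) ℝ} (hf : f.totalDegree ≤ q) :
    (fun x : E n => MvPolynomial.eval (fun i => x i) f) ∈ polySpace n q :=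
  ⟨f, (MvPolynomial.mem_restrictTotalDegree _ _ _).2 hf, rfl⟩

theorem mem_polySpace {v : E n → ℝ} : v ∈ polySpace n q ↔
    ∃ f : MvPolynomial (Fin n) ℝ, f.totalDegree ≤ q ∧
      v = fun x : E n => MvPolynomial.eval (fun i => x i) f := by
  constructor
  · rintro ⟨f, hf, rfl⟩
    exact ⟨f, (MvPolynomial.mem_restrictTotalDegree _ _ _).1 hf, rfl⟩
  · rintro ⟨f, hf, rfl⟩
    exact eval_mem_polySpace hf

theorem contDiff_of_mem {v : E n → ℝ} (hv : v ∈ polySpace n q) {k : WithTop ℕ∞} :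
    ContDiff ℝ k v := by
  obtain ⟨f, -, rfl⟩ := mem_polySpace.1 hv
  simp only [MvPolynomial.eval_eq']
  refine ContDiff.sum fun d _ => contDiff_const.mul (contDiff_prod fun i _ => ContDiff.pow ?_ _)
  exact (EuclideanSpace.proj (𝕜 := ℝ) i).contDiff

theorem polySpace_mono (h : q ≤ r) : polySpace n q ≤ polySpace n r := by
  intro v hv
  obtain ⟨f, hf, rfl⟩ := mem_polySpace.1 hv
  exact eval_mem_polySpace (hf.trans h)

theorem mul_mem_polySpace {v w : E n → ℝ} (hv : v ∈ polySpace n q) (hw : w ∈ polySpace n r) :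
    (fun x => v x * w x) ∈ polySpace n (q + r) := by
  obtain ⟨f, hf, rfl⟩ := mem_polySpace.1 hv
  obtain ⟨g, hg, rfl⟩ := mem_polySpace.1 hw
  simpa using eval_mem_polySpace ((MvPolynomial.totalDegree_mul f g).trans (add_le_add hf hg))

theorem const_mem_polySpace (c : ℝ) : (fun _ => c) ∈ polySpace n q := by
  simpa using eval_mem_polySpace (n := n) (q := q) (f := MvPolynomial.C c) (by simp)

theorem apply_mem_polySpace (i : Fin n) : (fun x : E n => x i) ∈ polySpace n 1 := by
  simpa using eval_mem_polySpace (n := n) (q := 1) (f := MvPolynomial.X i) (by simp)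

theorem linear_mem_polySpace (f : E n →ₗ[ℝ] ℝ) : (f : E n → ℝ) ∈ polySpace n 1 := by
  have : (f : E n → ℝ) = ∑ i, f (EuclideanSpace.single i 1) • fun x : E n => x i := by
    ext x
    conv_lhs => rw [← (EuclideanSpace.basisFun (Fin n) ℝ).sum_repr x]
    simp [mul_comm]
  rw [this]
  exact Submodule.sum_mem _ fun i _ => Submodule.smul_mem _ _ (apply_mem_polySpace i)

theorem affine_mem_polySpace (f : E n →ᵃ[ℝ] ℝ) : (f : E n → ℝ) ∈ polySpace n 1 := by
  rw [f.decomp]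
  exact Submodule.add_mem _ (linear_mem_polySpace _) (const_mem_polySpace _)

theorem pow_mem_polySpace {v : E n → ℝ} (hv : v ∈ polySpace n q) (k : ℕ) :
    (fun x => v x ^ k) ∈ polySpace n (q * k) := by
  induction k with
  | zero => simpa using const_mem_polySpace (n := n) 1
  | succ k ih => simpa only [pow_succ, mul_add, mul_one] using mul_mem_polySpace ih hv

theorem prod_mem_polySpace {ι : Type*} (s : Finset ι) (v : ι → E n → ℝ) (d : ι → ℕ)
    (h : ∀ i ∈ s, v i ∈ polySpace n (d i)) :
    (fun x => ∏ i ∈ s, v i x) ∈ polySpace n (∑ i ∈ s, d i) := by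
  classical
  induction s using Finset.induction_on with
  | empty => simpa using const_mem_polySpace (n := n) 1
  | insert a s ha ih =>
    simp only [Finset.prod_insert ha, Finset.sum_insert ha]
    exact mul_mem_polySpace (h a (Finset.mem_insert_self _ _))
      (ih fun i hi => h i (Finset.mem_insert_of_mem hi))

/-- A polynomial of degree at most `q` in affine functions is a polynomial of degree at most
`q`. -/
theorem eval_affine_mem_polySpace {m : ℕ} {f : MvPolynomial (Fin m) ℝ} (hf : f.totalDegree ≤ q)
    (a : Fin m → E n → ℝ) (ha : ∀ i, a i ∈ polySpace n 1) :
    (fun x => MvPolynomial.eval (fun i => a i x) f) ∈ polySpace n q := by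
  have : (fun x => MvPolynomial.eval (fun i => a i x) f) =
      ∑ d ∈ f.support, f.coeff d • fun x => ∏ i, a i x ^ d i := by
    ext x
    simp [MvPolynomial.eval_eq']
  rw [this]
  refine Submodule.sum_mem _ fun d hd => Submodule.smul_mem _ _ ?_
  refine polySpace_mono (q := ∑ i, 1 * d i) ?_
    (prod_mem_polySpace _ _ _ fun i _ => pow_mem_polySpace (ha i) (d i))
  have h := MvPolynomial.le_totalDegree hd
  rw [Finsupp.sum_fintype _ _ fun _ => rfl] at h
  simpa using h.trans hf

theorem comp_affine_mem_polySpace {v : E n → ℝ} (hv : v ∈ polySpace n q) (φ : E n →ᵃ[ℝ] E n) :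
    (fun x => v (φ x)) ∈ polySpace n q := by
  obtain ⟨f, hf, rfl⟩ := mem_polySpace.1 hv
  refine eval_affine_mem_polySpace hf (fun i x => φ x i) fun i => ?_
  exact affine_mem_polySpace
    ((EuclideanSpace.proj (𝕜 := ℝ) i : E n →L[ℝ] ℝ).toLinearMap.toAffineMap.comp φ)

theorem hasFDerivAt_eval (f : MvPolynomial (Fin n) ℝ) (x : E n) :
    HasFDerivAt (fun x : E n => MvPolynomial.eval (fun i => x i) f)
      (∑ i, MvPolynomial.eval (fun i => x i) (MvPolynomial.pderiv i f) •
        (EuclideanSpace.proj i : E n →L[ℝ] ℝ)) x := by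
  induction f using MvPolynomial.induction_on with
  | C a => simpa using hasFDerivAt_const a x
  | add f g hf hg =>
    simp only [map_add, add_smul, Finset.sum_add_distrib]
    exact hf.add hg
  | mul_X f j hf =>
    have hX : HasFDerivAt (fun x : E n => x j) (EuclideanSpace.proj j : E n →L[ℝ] ℝ) x :=
      (EuclideanSpace.proj (𝕜 := ℝ) j : E n →L[ℝ] ℝ).hasFDerivAt
    have h := hf.mul hX
    simp only [map_mul, MvPolynomial.eval_X]
    refine h.congr_fderiv ?_
    ext v
    simp [MvPolynomial.pderiv_X, Pi.single_apply, add_mul,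
      Finset.sum_add_distrib, Finset.mul_sum, Finset.sum_ite_eq, apply_ite]
    exact Finset.sum_congr rfl fun i _ => by ring

theorem totalDegree_pderiv_le (f : MvPolynomial (Fin n) ℝ) (i : Fin n) :
    (MvPolynomial.pderiv i f).totalDegree ≤ f.totalDegree - 1 := by
  classical
  rw [← MvPolynomial.mem_restrictTotalDegree]
  have hsum : MvPolynomial.pderiv i f = ∑ d ∈ f.support,
      MvPolynomial.pderiv i (MvPolynomial.monomial d (f.coeff d)) := by
    rw [← map_sum, ← f.as_sum]
  rw [hsum]
  refine Submodule.sum_mem _ fun d hd => ?_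
  rw [MvPolynomial.pderiv_monomial]
  by_cases h0 : d i = 0
  · simp [h0]
  rw [MvPolynomial.mem_restrictTotalDegree]
  refine (MvPolynomial.totalDegree_monomial_le _ _).trans ?_
  have h := MvPolynomial.le_totalDegree hd
  have hle : Finsupp.single i 1 ≤ d := by
    rw [Finsupp.single_le_iff]; omega
  have h2 : (d - Finsupp.single i 1).degree + (Finsupp.single i 1 : Fin n →₀ ℕ).degree =
      d.degree := by
    rw [← map_add, tsub_add_cancel_of_le hle]
  rw [Finsupp.degree_single] at h2
  simp only [Finsupp.degree_apply, Finsupp.sum] at h h2 ⊢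
  simp only [id] at *
  omega

theorem fderiv_mem_polySpace {v : E n → ℝ} (hv : v ∈ polySpace n q) (t : E n) :
    (fun x => fderiv ℝ v x t) ∈ polySpace n (q - 1) := by
  obtain ⟨f, hf, rfl⟩ := mem_polySpace.1 hv
  have : (fun x => fderiv ℝ (fun x : E n => MvPolynomial.eval (fun i => x i) f) x t) =
      ∑ i, t i • fun x : E n => MvPolynomial.eval (fun i => x i) (MvPolynomial.pderiv i f) := by
    ext x
    rw [(hasFDerivAt_eval f x).fderiv]
    simp [mul_comm]
  rw [this]
  refine Submodule.sum_mem _ fun i _ => Submodule.smul_mem _ _ (eval_mem_polySpace ?_)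
  exact (totalDegree_pderiv_le f i).trans (Nat.sub_le_sub_right hf 1)

/-- Identity theorem for analytic functions. It is what allows polynomials on the simplex to be
treated as functions on the whole space. -/
theorem eq_zero_of_eqOn_elt {b : Simplex n} {v : E n → ℝ} (hv : v ∈ polySpace n q)
    (h : ∀ x ∈ elt b, v x = 0) : v = 0 := by
  obtain ⟨f, hf, rfl⟩ := mem_polySpace.1 hv
  obtain ⟨c, hc⟩ := elt_nonempty b
  have ha : AnalyticOnNhd ℝ (fun x : E n => MvPolynomial.eval (fun i => x i) f) Set.univ :=
    AnalyticOnNhd.aeval_mvPolynomial (f := fun (x : E n) i => x i)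
      (fun i => (EuclideanSpace.proj (𝕜 := ℝ) i : E n →L[ℝ] ℝ).analyticOnNhd _) f
  refine ha.eq_of_eventuallyEq (z₀ := c) analyticOnNhd_const ?_
  filter_upwards [(isOpen_elt b).mem_nhds hc] with x hx using h x hx

/-- Definiteness of the weighted inner products. It serves with weight `1` for the bubble and `P̃`
spaces, and with the weight `η_E`, which vanishes only on the boundary of the simplex, for the edge
corrections. -/
theorem eq_zero_of_integral_mul_sq {b : Simplex n} {v ρ : E n → ℝ} (hv : v ∈ polySpace n q)
    (hρ : Continuous ρ) (hpos : ∀ x ∈ elt b, 0 < ρ x)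
    (h : ∫ x in elt b, ρ x * v x ^ 2 = 0) : v = 0 := by
  have hc := continuous_of_mem hv
  have hcc : Continuous fun x => ρ x * v x ^ 2 := hρ.mul (hc.pow 2)
  have h0 : ∀ᵐ x ∂(volume.restrict (elt b)), 0 ≤ ρ x * v x ^ 2 :=
    ae_restrict_of_forall_mem (isOpen_elt b).measurableSet fun x hx =>
      mul_nonneg (hpos x hx).le (sq_nonneg _)
  rw [integral_eq_zero_iff_of_nonneg_ae h0 (integrable_of_continuous b hcc)] at h
  have h1 := Measure.eqOn_open_of_ae_eq h (isOpen_elt b) hcc.continuousOn continuousOn_const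
  refine eq_zero_of_eqOn_elt hv (b := b) fun x hx => ?_
  have h2 := h1 hx
  simpa [(hpos x hx).ne'] using h2

end poly

/-! ### Extension of boundary polynomials -/

section extension

variable {q : ℕ}

theorem eval_smul_of_isHomogeneous {m : ℕ} {F : MvPolynomial (Fin m) ℝ} (hF : F.IsHomogeneous q)
    (c : ℝ) (y : Fin m → ℝ) :
    MvPolynomial.eval (fun i => c * y i) F = c ^ q * MvPolynomial.eval y F := by
  simp only [MvPolynomial.eval_eq', mul_pow, Finset.prod_mul_distrib, Finset.prod_pow_eq_pow_sum,
    Finset.mul_sum]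
  refine Finset.sum_congr rfl fun d hd => ?_
  have h : ∑ i, d i = q := by
    have h1 : d.degree = q := (hF.degree_eq_sum_deg_support hd).symm
    rw [← h1, Finsupp.degree_eq_sum]
  rw [h]; ring

/-- Every polynomial of degree at most `q` is a homogeneous polynomial of degree `q` in the
barycentric coordinates. -/
theorem exists_isHomogeneous (b : Simplex n) {v : E n → ℝ} (hv : v ∈ polySpace n q) :
    ∃ F : MvPolynomial (Fin (n + 1)) ℝ, F.IsHomogeneous q ∧
      ∀ x, MvPolynomial.eval (fun i => b.coord i x) F = v x := by
  obtain ⟨f, hf, rfl⟩ := mem_polySpace.1 hv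
  -- Each variable `x_i` is replaced by the linear form `∑ j, (b j)_i λ_j`, and each monomial is
  -- padded by a power of `∑ j, λ_j`, which equals `1` in barycentric coordinates.
  refine ⟨∑ d ∈ f.support, MvPolynomial.C (f.coeff d) *
    ((∏ i, (∑ j, MvPolynomial.C (b j i) * MvPolynomial.X j) ^ d i) *
      (∑ j, MvPolynomial.X j) ^ (q - ∑ i, d i)), ?_, fun x => ?_⟩
  · refine MvPolynomial.IsHomogeneous.sum _ _ _ fun d hd => MvPolynomial.IsHomogeneous.C_mul ?_ _
    have h1 : ∑ i, d i ≤ q := by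
      have h := MvPolynomial.le_totalDegree hd
      rw [Finsupp.sum_fintype _ _ fun _ => rfl] at h
      exact h.trans hf
    have h2 : q = ∑ i, 1 * d i + 1 * (q - ∑ i, d i) := by simp; omega
    rw [h2]
    simp only [one_mul, Nat.add_sub_cancel_left]
    have h3 : ((∑ j, MvPolynomial.X j : MvPolynomial (Fin (n + 1)) ℝ)).IsHomogeneous 1 :=
      MvPolynomial.IsHomogeneous.sum _ _ _ fun j _ => MvPolynomial.isHomogeneous_X _ _
    refine MvPolynomial.IsHomogeneous.mul (MvPolynomial.IsHomogeneous.prod _ _ _ fun i _ => ?_)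
      (by simpa using h3.pow (q - ∑ i, d i))
    have h4 : ((∑ j, MvPolynomial.C (b j i) * MvPolynomial.X j :
        MvPolynomial (Fin (n + 1)) ℝ)).IsHomogeneous 1 :=
      MvPolynomial.IsHomogeneous.sum _ _ _ fun j _ => MvPolynomial.isHomogeneous_C_mul_X _ _
    simpa using h4.pow (d i)
  · rw [map_sum]
    simp only [MvPolynomial.eval_eq' _ f]
    refine Finset.sum_congr rfl fun d _ => ?_
    have h1 : ∀ i, ∑ j, b j i * b.coord j x = x i := fun i => by
      have h := congrArg (fun v : E n => v i) (b.linear_combination_coord_eq_self x)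
      simpa [-AffineBasis.linear_combination_coord_eq_self, mul_comm] using h
    simp [map_prod, h1]

/-- A continuous piecewise polynomial on the boundary extends to a polynomial. -/
theorem IsContFacePoly.exists_extension {b : Simplex n} {u : E n → ℝ} (hq : 1 ≤ q)
    (hu : IsContFacePoly b q u) : ∃ v ∈ polySpace n q, ∀ x ∈ frontier (elt b), v x = u x := by
  classical
  -- The extension of `u` to the boundary of the positive orthant that is homogeneous of degree `q`.
  -- Homogeneity is needed because setting one coordinate to zero, as below, leaves the hyperplane
  -- `∑ y = 1`.
  let U : (Fin (n + 1) → ℝ) → ℝ := fun y => (∑ i, y i) ^ q * u (∑ i, (y i / ∑ j, y j) • b i)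
  have hface : ∀ i, ∃ F : MvPolynomial (Fin (n + 1)) ℝ, F.IsHomogeneous q ∧
      ∀ y : Fin (n + 1) → ℝ, (∀ j, 0 ≤ y j) → y i = 0 → MvPolynomial.eval y F = U y := by
    intro i
    obtain ⟨f, hf, hfu⟩ := hu.2 i
    obtain ⟨F, hF, hFf⟩ := exists_isHomogeneous b hf
    refine ⟨F, hF, fun y hy hyi => ?_⟩
    rcases (Finset.sum_nonneg fun i (_ : i ∈ Finset.univ) => hy i).eq_or_lt' with hs | hs
    -- At the apex `y = 0` both sides vanish, since `q ≥ 1`.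
    · have h0 := eval_smul_of_isHomogeneous hF 0 y
      have h1 : ∀ j, y j = 0 := fun j =>
        (Finset.sum_eq_zero_iff_of_nonneg fun i _ => hy i).1 hs j (Finset.mem_univ j)
      simp only [zero_mul, zero_pow (by omega : q ≠ 0)] at h0
      have h2 : y = fun _ => 0 := funext h1
      simp only [U, hs, zero_pow (by omega : q ≠ 0), zero_mul]
      rw [h2]; exact h0
    · set s := ∑ j, y j with hsdef
      set x := ∑ j, (y j / s) • b j with hx
      have hsum : ∑ j, y j / s = 1 := by rw [← Finset.sum_div, div_self hs.ne']
      have hcoord : ∀ j, b.coord j x = y j / s := by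
        intro j
        have h1 := b.coord_apply_combination_of_mem (Finset.mem_univ j) hsum
        rwa [Finset.affineCombination_eq_linear_combination _ _ _ hsum] at h1
      have hxf : x ∈ face b i := by
        rw [mem_face, mem_closedElt]
        exact ⟨fun j => by rw [hcoord]; exact div_nonneg (hy j) hs.le, by rw [hcoord, hyi, zero_div]⟩
      have h2 := eval_smul_of_isHomogeneous hF s (fun j => y j / s)
      have h3 : (fun j => s * (y j / s)) = y := funext fun j => mul_div_cancel₀ _ hs.ne'
      rw [h3] at h2
      rw [h2]
      simp only [U]
      congr 1
      have h4 := hFf x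
      simp only [hcoord] at h4
      rw [h4, ← hfu hxf]
  choose F hF hFU using hface
  have key : ∀ S : Finset (Fin (n + 1)), ∃ G : MvPolynomial (Fin (n + 1)) ℝ, G.IsHomogeneous q ∧
      ∀ i ∈ S, ∀ y : Fin (n + 1) → ℝ, (∀ j, 0 ≤ y j) → y i = 0 → MvPolynomial.eval y G = U y := by
    intro S
    induction S using Finset.induction_on with
    | empty => exact ⟨0, MvPolynomial.isHomogeneous_zero _ _ _, by simp⟩
    | insert k S hk ih =>
      obtain ⟨G, hG, hGU⟩ := ih
      let Z : Fin (n + 1) → MvPolynomial (Fin (n + 1)) ℝ :=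
        fun j => if j = k then 0 else MvPolynomial.X j
      have hZ : ∀ j, (Z j).IsHomogeneous 1 := by
        intro j
        by_cases h : j = k
        · simpa [Z, h] using MvPolynomial.isHomogeneous_zero _ _ _
        · simpa [Z, h] using MvPolynomial.isHomogeneous_X _ _
      -- Add the defect `F k - G`, evaluated with `y k` set to zero. On the face `k` the result is
      -- `F k`. On an earlier face `i` the modified point lies on both faces, where `F k` and `G`
      -- agree with `U`, so the correction vanishes.
      refine ⟨G + MvPolynomial.aeval Z (F k - G), ?_, ?_⟩
      · have := ((hF k).sub hG).aeval (R := ℝ) Z hZ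
        rw [one_mul] at this
        exact hG.add this
      · intro i hi y hy hyi
        set y' : Fin (n + 1) → ℝ := fun j => if j = k then 0 else y j with hy'
        have h1 : MvPolynomial.eval y (MvPolynomial.aeval Z (F k - G)) =
            MvPolynomial.eval y' (F k - G) := by
          have h := MvPolynomial.eval₂Hom_bind₁ (RingHom.id ℝ) y Z (F k - G)
          have h' : (fun i => MvPolynomial.eval₂Hom (RingHom.id ℝ) y (Z i)) = y' := by
            ext j; by_cases hj : j = k <;> simp [Z, hy', hj]
          rw [h'] at h
          exact h
        have h2 : ∀ j, 0 ≤ y' j := fun j => by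
          simp only [hy']; split_ifs; exacts [le_rfl, hy j]
        have h3 : y' k = 0 := by simp [hy']
        rw [map_add, h1, map_sub, hFU k y' h2 h3]
        rcases Finset.mem_insert.1 hi with rfl | hi
        · have h4 : y' = y := by
            ext j; by_cases h : j = i <;> simp [hy', h, hyi]
          rw [h4]; ring
        · have h4 : y' i = 0 := by simp [hy', hyi]
          rw [hGU i hi y hy hyi, hGU i hi y' h2 h4]; ring
  obtain ⟨G, hG, hGU⟩ := key Finset.univ
  refine ⟨fun x => MvPolynomial.eval (fun i => b.coord i x) G,
    eval_affine_mem_polySpace hG.totalDegree_le _ fun i => affine_mem_polySpace _, ?_⟩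
  intro x hx
  rw [frontier_elt, Set.mem_iUnion] at hx
  obtain ⟨i, hi⟩ := hx
  have hi' := mem_face.1 hi
  simp only [hGU i (Finset.mem_univ i) _ (mem_closedElt.1 hi'.1) hi'.2, U, sum_coord, one_pow,
    one_mul, div_one]
  rw [b.linear_combination_coord_eq_self]

end extension

/-! ### The `L²` norm -/

section lnorm

variable {α F : Type*} [MeasurableSpace α] {μ : Measure α} [NormedAddCommGroup F]

/-- The `L²(μ)` norm as a real number. -/
def lnorm (μ : Measure α) (f : α → F) : ℝ := (eLpNorm f 2 μ).toReal

theorem lnorm_nonneg (f : α → F) : 0 ≤ lnorm μ f := ENNReal.toReal_nonneg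

theorem lnorm_congr {f g : α → F} (h : f =ᵐ[μ] g) : lnorm μ f = lnorm μ g := by
  rw [lnorm, lnorm, eLpNorm_congr_ae h]

theorem lnorm_add_le {f g : α → F} (hf : MemLp f 2 μ) (hg : MemLp g 2 μ) :
    lnorm μ (fun x => f x + g x) ≤ lnorm μ f + lnorm μ g := by
  rw [lnorm, lnorm, lnorm, ← ENNReal.toReal_add hf.2.ne hg.2.ne]
  exact ENNReal.toReal_mono (ENNReal.add_ne_top.2 ⟨hf.2.ne, hg.2.ne⟩)
    (eLpNorm_add_le hf.1 hg.1 one_le_two)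

theorem lnorm_sub_le {f g : α → F} (hf : MemLp f 2 μ) (hg : MemLp g 2 μ) :
    lnorm μ (fun x => f x - g x) ≤ lnorm μ f + lnorm μ g := by
  have := lnorm_add_le hf hg.neg
  simpa [lnorm, sub_eq_add_neg, eLpNorm_neg] using this

theorem lnorm_le_of_norm_le {G : Type*} [NormedAddCommGroup G] {f : α → F} {g : α → G} {c : ℝ}
    (hc : 0 ≤ c) (hg : MemLp g 2 μ) (h : ∀ᵐ x ∂μ, ‖f x‖ ≤ c * ‖g x‖) :
    lnorm μ f ≤ c * lnorm μ g := by
  have h1 := eLpNorm_le_mul_eLpNorm_of_ae_le_mul h 2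
  rw [lnorm, lnorm, ← ENNReal.toReal_ofReal hc, ← ENNReal.toReal_mul]
  exact ENNReal.toReal_mono (ENNReal.mul_ne_top ENNReal.ofReal_ne_top hg.2.ne) h1

theorem lnorm_sq {f : α → F} (hf : MemLp f 2 μ) : lnorm μ f ^ 2 = ∫ x, ‖f x‖ ^ 2 ∂μ := by
  rw [lnorm, hf.eLpNorm_eq_integral_rpow_norm two_ne_zero ENNReal.ofNat_ne_top]
  have h : 0 ≤ ∫ x, ‖f x‖ ^ 2 ∂μ := integral_nonneg fun _ => sq_nonneg _
  rw [ENNReal.toReal_ofReal (by positivity)]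
  simp only [ENNReal.toReal_ofNat, Real.rpow_two]
  rw [← one_div, ← Real.sqrt_eq_rpow, Real.sq_sqrt h]

theorem integral_norm_mul_norm_le {G : Type*} [NormedAddCommGroup G] {f : α → F} {g : α → G}
    (hf : MemLp f 2 μ) (hg : MemLp g 2 μ) :
    ∫ x, ‖f x‖ * ‖g x‖ ∂μ ≤ lnorm μ f * lnorm μ g := by
  have h := integral_mul_le_Lp_mul_Lq_of_nonneg (p := 2) (q := 2) (μ := μ)
    (f := fun x => ‖f x‖) (g := fun x => ‖g x‖)
    (by constructor <;> norm_num) (Eventually.of_forall fun _ => norm_nonneg _)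
    (Eventually.of_forall fun _ => norm_nonneg _) (by simpa using hf.norm) (by simpa using hg.norm)
  simp only [Real.rpow_two, ← Real.sqrt_eq_rpow, ← lnorm_sq hf, ← lnorm_sq hg,
    Real.sqrt_sq (lnorm_nonneg _)] at h
  exact h

theorem integrable_norm_mul_norm {G : Type*} [NormedAddCommGroup G] {f : α → F} {g : α → G}
    (hf : MemLp f 2 μ) (hg : MemLp g 2 μ) : Integrable (fun x => ‖f x‖ * ‖g x‖) μ :=
  hf.norm.integrable_mul hg.norm

theorem integrable_inner [InnerProductSpace ℝ F] {f g : α → F} (hf : MemLp f 2 μ)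
    (hg : MemLp g 2 μ) : Integrable (fun x => inner ℝ (f x) (g x)) μ :=
  (integrable_norm_mul_norm hf hg).mono' (hf.1.inner hg.1)
    (Eventually.of_forall fun x => norm_inner_le_norm (f x) (g x))

theorem integrable_mul {f g : α → ℝ} (hf : MemLp f 2 μ) (hg : MemLp g 2 μ) :
    Integrable (fun x => f x * g x) μ := hf.integrable_mul hg

theorem abs_integral_inner_le [InnerProductSpace ℝ F] {f g : α → F} (hf : MemLp f 2 μ)
    (hg : MemLp g 2 μ) : |∫ x, inner ℝ (f x) (g x) ∂μ| ≤ lnorm μ f * lnorm μ g := by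
  refine (norm_integral_le_integral_norm (fun x => inner ℝ (f x) (g x))).trans
    (le_trans ?_ (integral_norm_mul_norm_le hf hg))
  exact integral_mono (integrable_inner hf hg).norm (integrable_norm_mul_norm hf hg)
    fun x => norm_inner_le_norm (f x) (g x)

theorem abs_integral_mul_le {f g : α → ℝ} (hf : MemLp f 2 μ) (hg : MemLp g 2 μ) :
    |∫ x, f x * g x ∂μ| ≤ lnorm μ f * lnorm μ g := by
  simpa [mul_comm] using abs_integral_inner_le hf hg

theorem memLp_elt {F : Type*} [NormedAddCommGroup F] (b : Simplex n) {f : E n → F}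
    (hf : Continuous f) : MemLp f 2 (volume.restrict (elt b)) := by
  obtain ⟨C, hC⟩ := (isCompact_closedElt b).exists_bound_of_continuousOn hf.continuousOn
  refine MemLp.of_bound hf.aestronglyMeasurable C ?_
  exact ae_restrict_of_forall_mem (isOpen_elt b).measurableSet
    fun x hx => hC x (elt_subset b hx)

end lnorm

/-! ### Weak derivatives -/

section weak

variable {T : Set (E n)} {b : Simplex n}

theorem IsTestFunction.integral_eq {F : Type*} [NormedAddCommGroup F] [NormedSpace ℝ F]
    {φ : E n → ℝ} (hφ : IsTestFunction T φ) {f : E n → F} (hf : ∀ x ∉ tsupport φ, f x = 0) :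
    ∫ x in T, f x = ∫ x, f x :=
  setIntegral_eq_integral_of_forall_compl_eq_zero fun x hx => hf x fun h => hx (hφ.2.2 h)

theorem inner_gradient (f : E n → ℝ) (x v : E n) :
    inner ℝ (gradient f x) v = fderiv ℝ f x v := by
  simp [gradient]

theorem inner_gradient' (f : E n → ℝ) (x v : E n) :
    inner ℝ v (gradient f x) = fderiv ℝ f x v := by
  rw [real_inner_comm, inner_gradient]

theorem continuous_gradient {f : E n → ℝ} (hf : ContDiff ℝ 1 f) : Continuous (gradient f) :=
  (InnerProductSpace.toDual ℝ (E n)).symm.continuous.comp (hf.continuous_fderiv one_ne_zero)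

theorem gradient_eq_zero_of_notMem {φ : E n → ℝ} {x : E n} (hx : x ∉ tsupport φ) :
    fderiv ℝ φ x = 0 :=
  Function.notMem_support.1 fun h => hx (support_fderiv_subset ℝ h)

theorem integral_mul_fderiv_test {f φ : E n → ℝ} (hf : ContDiff ℝ 1 f) (hφ : IsTestFunction T φ)
    (v : E n) : ∫ x in T, f x * fderiv ℝ φ x v = -∫ x in T, fderiv ℝ f x v * φ x := by
  have hφ1 : ContDiff ℝ 1 φ := hφ.1.of_le (by exact_mod_cast le_top)
  have hcf := hf.continuous
  have hcf' : Continuous fun x => fderiv ℝ f x v :=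
    (hf.continuous_fderiv one_ne_zero).clm_apply continuous_const
  have hcφ := hφ1.continuous
  have hcφ' : Continuous fun x => fderiv ℝ φ x v :=
    (hφ1.continuous_fderiv one_ne_zero).clm_apply continuous_const
  have hs : HasCompactSupport fun x => fderiv ℝ φ x v := hφ.2.1.fderiv_apply (𝕜 := ℝ) v
  rw [hφ.integral_eq fun x hx => by rw [gradient_eq_zero_of_notMem hx]; simp,
    hφ.integral_eq fun x hx => by rw [image_eq_zero_of_notMem_tsupport hx]; simp]
  exact integral_mul_fderiv_eq_neg_fderiv_mul_of_integrable
    ((hcf'.mul hcφ).integrable_of_hasCompactSupport hφ.2.1.mul_left)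
    ((hcf.mul hcφ').integrable_of_hasCompactSupport hs.mul_left)
    ((hcf.mul hcφ).integrable_of_hasCompactSupport hφ.2.1.mul_left)
    (fun x _ => hf.differentiable one_ne_zero x) (fun x _ => hφ1.differentiable one_ne_zero x)

theorem IsTestFunction.integrable {φ : E n → ℝ} (hφ : IsTestFunction T φ) {F : Type*}
    [NormedAddCommGroup F] {f : E n → F} (hf : Continuous f) (h : ∀ x ∉ tsupport φ, f x = 0) :
    Integrable f (volume.restrict T) :=
  (hf.integrable_of_hasCompactSupport (HasCompactSupport.intro hφ.2.1 h)).restrict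

theorem IsTestFunction.contDiff_one {φ : E n → ℝ} (hφ : IsTestFunction T φ) : ContDiff ℝ 1 φ :=
  hφ.1.of_le (by exact_mod_cast le_top)

theorem hasWeakGrad_gradient {f : E n → ℝ} (hf : ContDiff ℝ 1 f) :
    HasWeakGrad T f (gradient f) := by
  intro φ hφ
  have hcφ := hφ.contDiff_one.continuous
  refine ext_inner_left ℝ fun v => ?_
  have hi1 : Integrable (fun x => f x • gradient φ x) (volume.restrict T) :=
    hφ.integrable (hf.continuous.smul (continuous_gradient hφ.contDiff_one))
      fun x hx => by simp [gradient, gradient_eq_zero_of_notMem hx]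
  have hi2 : Integrable (fun x => φ x • gradient f x) (volume.restrict T) :=
    hφ.integrable (hcφ.smul (continuous_gradient hf))
      fun x hx => by simp [image_eq_zero_of_notMem_tsupport hx]
  rw [inner_neg_right, ← integral_inner hi1, ← integral_inner hi2]
  simp only [inner_smul_right, inner_gradient']
  rw [integral_mul_fderiv_test hf hφ v]
  simp only [mul_comm]

/-- The classical divergence of a vector field. -/
def cdiv (τ : E n → E n) (x : E n) : ℝ :=
  ∑ k, fderiv ℝ (fun y => τ y k) x (EuclideanSpace.single k 1)

theorem contDiff_apply_coord {τ : E n → E n} {k : WithTop ℕ∞} (hτ : ContDiff ℝ k τ) (i : Fin n) :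
    ContDiff ℝ k fun x => τ x i :=
  (EuclideanSpace.proj (𝕜 := ℝ) i : E n →L[ℝ] ℝ).contDiff.comp hτ

theorem continuous_cdiv {τ : E n → E n} (hτ : ContDiff ℝ 1 τ) : Continuous (cdiv τ) :=
  continuous_finsetSum _ fun k _ =>
    ((contDiff_apply_coord hτ k).continuous_fderiv one_ne_zero).clm_apply continuous_const

theorem sum_mul_single (g : E n →L[ℝ] ℝ) (v : E n) :
    ∑ k, v k * g (EuclideanSpace.single k 1) = g v := by
  have h := (EuclideanSpace.basisFun (Fin n) ℝ).sum_repr v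
  conv_rhs => rw [← h, map_sum]
  simp

theorem hasWeakDiv_cdiv {τ : E n → E n} (hτ : ContDiff ℝ 1 τ) : HasWeakDiv T τ (cdiv τ) := by
  intro φ hφ
  have hcφ := hφ.contDiff_one.continuous
  have hcφ' := hφ.contDiff_one.continuous_fderiv one_ne_zero
  have h1 : ∀ x, inner ℝ (τ x) (gradient φ x) =
      ∑ k, τ x k * fderiv ℝ φ x (EuclideanSpace.single k 1) := fun x => by
    rw [inner_gradient', sum_mul_single]
  simp only [h1, cdiv, Finset.sum_mul]
  rw [integral_finsetSum, integral_finsetSum, ← Finset.sum_neg_distrib]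
  · exact Finset.sum_congr rfl fun k _ =>
      integral_mul_fderiv_test (contDiff_apply_coord hτ k) hφ _
  · exact fun k _ => hφ.integrable ((((contDiff_apply_coord hτ k).continuous_fderiv
      one_ne_zero).clm_apply continuous_const).mul hcφ)
      fun x hx => by simp [image_eq_zero_of_notMem_tsupport hx]
  · exact fun k _ => hφ.integrable ((contDiff_apply_coord hτ k).continuous.mul
      (hcφ'.clm_apply continuous_const)) fun x hx => by simp [gradient_eq_zero_of_notMem hx]

theorem cdiv_smul_sub {f : E n → ℝ} (hf : ContDiff ℝ 1 f) (p x : E n) :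
    cdiv (fun y => f y • (y - p)) x = n * f x + fderiv ℝ f x (x - p) := by
  have h : ∀ k : Fin n, fderiv ℝ (fun y : E n => (f y • (y - p)) k) x (EuclideanSpace.single k 1) =
      f x + (x - p) k * fderiv ℝ f x (EuclideanSpace.single k 1) := by
    intro k
    have h1 : HasFDerivAt (fun y : E n => (y - p) k) (EuclideanSpace.proj k : E n →L[ℝ] ℝ) x :=
      (EuclideanSpace.proj (𝕜 := ℝ) k : E n →L[ℝ] ℝ).hasFDerivAt.comp x
        ((hasFDerivAt_id x).sub_const p)
    have h2 := ((hf.differentiable one_ne_zero x).hasFDerivAt.mul h1).fderiv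
    have h3 : (fun y : E n => (f y • (y - p)) k) = f * fun y : E n => (y - p) k := rfl
    rw [h3, h2]
    simp
  simp only [cdiv, h, Finset.sum_add_distrib, sum_mul_single]
  simp

theorem cdiv_smul_const {f : E n → ℝ} (hf : ContDiff ℝ 1 f) (t x : E n) :
    cdiv (fun y => f y • t) x = fderiv ℝ f x t := by
  have h : ∀ k : Fin n, fderiv ℝ (fun y : E n => (f y • t) k) x (EuclideanSpace.single k 1) =
      t k * fderiv ℝ f x (EuclideanSpace.single k 1) := by
    intro k
    have h2 := ((hf.differentiable one_ne_zero x).hasFDerivAt.mul_const (t k)).fderiv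
    have h3 : (fun y : E n => (f y • t) k) = fun y => f y * t k := rfl
    rw [h3, h2]
    simp
  simp only [cdiv, h, sum_mul_single]

theorem cdiv_sum {ι : Type*} (s : Finset ι) (c : ι → ℝ) {τ : ι → E n → E n}
    (hτ : ∀ i, ContDiff ℝ 1 (τ i)) (x : E n) :
    cdiv (fun y => ∑ i ∈ s, c i • τ i y) x = ∑ i ∈ s, c i * cdiv (τ i) x := by
  have h : ∀ k : Fin n, fderiv ℝ (fun y : E n => (∑ i ∈ s, c i • τ i y) k) x
      (EuclideanSpace.single k 1) =
      ∑ i ∈ s, c i * fderiv ℝ (fun y => τ i y k) x (EuclideanSpace.single k 1) := by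
    intro k
    have h1 : (fun y : E n => (∑ i ∈ s, c i • τ i y) k) = fun y => ∑ i ∈ s, c i • τ i y k := by
      ext y; simp
    have h2 := (HasFDerivAt.fun_sum (u := s) fun i _ =>
      (((contDiff_apply_coord (hτ i) k).differentiable one_ne_zero x).hasFDerivAt.const_smul
        (c i))).fderiv
    rw [h1]
    refine (congrArg (fun g : E n →L[ℝ] ℝ => g (EuclideanSpace.single k 1)) h2).trans ?_
    simp
  simp only [cdiv, h, Finset.mul_sum]
  exact Finset.sum_comm

theorem locallyIntegrableOn_of_memLp {F : Type*} [NormedAddCommGroup F] {f : E n → F}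
    (hf : MemLp f 2 (volume.restrict (elt b))) : LocallyIntegrableOn f (elt b) :=
  IntegrableOn.locallyIntegrableOn (hf.integrable one_le_two)

/-- The fundamental lemma of the calculus of variations on the open simplex. It makes the arbitrary
choices in `weakGrad` and `weakDiv` harmless up to null sets. -/
theorem ae_eq_of_forall_test {F : Type*} [NormedAddCommGroup F] [NormedSpace ℝ F] [CompleteSpace F]
    {f g : E n → F} (hf : MemLp f 2 (volume.restrict (elt b)))
    (hg : MemLp g 2 (volume.restrict (elt b)))
    (h : ∀ φ, IsTestFunction (elt b) φ → ∫ x in elt b, φ x • f x = ∫ x in elt b, φ x • g x) :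
    f =ᵐ[volume.restrict (elt b)] g := by
  have h1 := (isOpen_elt b).ae_eq_zero_of_integral_contDiff_smul_eq_zero
    (locallyIntegrableOn_of_memLp (hf.sub hg)) (μ := volume) fun φ h1 h2 h3 => by
      have hφ : IsTestFunction (elt b) φ := ⟨h1, h2, h3⟩
      have hφL := memLp_elt b hφ.1.continuous
      have hi1 : Integrable (fun x => φ x • f x) (volume.restrict (elt b)) :=
        memLp_one_iff_integrable.1 (hf.smul hφL)
      have hi2 : Integrable (fun x => φ x • g x) (volume.restrict (elt b)) :=
        memLp_one_iff_integrable.1 (hg.smul hφL)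
      rw [← hφ.integral_eq fun x hx => by rw [image_eq_zero_of_notMem_tsupport hx, zero_smul]]
      simp only [Pi.sub_apply, smul_sub]
      rw [integral_sub hi1 hi2, h φ hφ, sub_self]
  rw [EventuallyEq, ae_restrict_iff' (isOpen_elt b).measurableSet]
  filter_upwards [h1] with x hx hxT
  exact sub_eq_zero.1 (hx hxT)

theorem HasWeakDiv.unique {τ : E n → E n} {d d' : E n → ℝ}
    (hd : MemLp d 2 (volume.restrict (elt b))) (hd' : MemLp d' 2 (volume.restrict (elt b)))
    (h : HasWeakDiv (elt b) τ d) (h' : HasWeakDiv (elt b) τ d') :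
    d =ᵐ[volume.restrict (elt b)] d' :=
  ae_eq_of_forall_test hd hd' fun φ hφ => by
    have := (h φ hφ).symm.trans (h' φ hφ)
    simpa [mul_comm] using this

theorem HasWeakGrad.unique {v : E n → ℝ} {g g' : E n → E n}
    (hg : MemLp g 2 (volume.restrict (elt b))) (hg' : MemLp g' 2 (volume.restrict (elt b)))
    (h : HasWeakGrad (elt b) v g) (h' : HasWeakGrad (elt b) v g') :
    g =ᵐ[volume.restrict (elt b)] g' :=
  ae_eq_of_forall_test hg hg' fun φ hφ => neg_injective ((h φ hφ).symm.trans (h' φ hφ))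

theorem MemHdiv.weakDiv_spec {τ : E n → E n} (h : MemHdiv (elt b) τ) :
    MemLp (weakDiv (elt b) τ) 2 (volume.restrict (elt b)) ∧
      HasWeakDiv (elt b) τ (weakDiv (elt b) τ) := by
  rw [weakDiv, dif_pos h.2]
  exact h.2.choose_spec

theorem MemH1.weakGrad_spec {v : E n → ℝ} (h : MemH1 (elt b) v) :
    MemLp (weakGrad (elt b) v) 2 (volume.restrict (elt b)) ∧
      HasWeakGrad (elt b) v (weakGrad (elt b) v) := by
  rw [weakGrad, dif_pos h.2]
  exact h.2.choose_spec

theorem HasWeakDiv.weakDiv_ae_eq {τ : E n → E n} {d : E n → ℝ}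
    (hd : MemLp d 2 (volume.restrict (elt b))) (h : HasWeakDiv (elt b) τ d) :
    weakDiv (elt b) τ =ᵐ[volume.restrict (elt b)] d := by
  have h1 : ∃ d, MemLp d 2 (volume.restrict (elt b)) ∧ HasWeakDiv (elt b) τ d := ⟨d, hd, h⟩
  rw [weakDiv, dif_pos h1]
  exact h1.choose_spec.2.unique h1.choose_spec.1 hd h

theorem HasWeakGrad.weakGrad_ae_eq {v : E n → ℝ} {g : E n → E n}
    (hg : MemLp g 2 (volume.restrict (elt b))) (h : HasWeakGrad (elt b) v g) :
    weakGrad (elt b) v =ᵐ[volume.restrict (elt b)] g := by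
  have h1 : ∃ g, MemLp g 2 (volume.restrict (elt b)) ∧ HasWeakGrad (elt b) v g := ⟨g, hg, h⟩
  rw [weakGrad, dif_pos h1]
  exact h1.choose_spec.2.unique h1.choose_spec.1 hg h

theorem memH1_of_contDiff {f : E n → ℝ} (hf : ContDiff ℝ 1 f) : MemH1 (elt b) f :=
  ⟨memLp_elt b hf.continuous, gradient f, memLp_elt b (continuous_gradient hf),
    hasWeakGrad_gradient hf⟩

theorem weakGrad_of_contDiff {f : E n → ℝ} (hf : ContDiff ℝ 1 f) :
    weakGrad (elt b) f =ᵐ[volume.restrict (elt b)] gradient f :=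
  (hasWeakGrad_gradient hf).weakGrad_ae_eq (memLp_elt b (continuous_gradient hf))

theorem memHdiv_of_contDiff {τ : E n → E n} (hτ : ContDiff ℝ 1 τ) : MemHdiv (elt b) τ :=
  ⟨memLp_elt b hτ.continuous, cdiv τ, memLp_elt b (continuous_cdiv hτ), hasWeakDiv_cdiv hτ⟩

theorem weakDiv_of_contDiff {τ : E n → E n} (hτ : ContDiff ℝ 1 τ) :
    weakDiv (elt b) τ =ᵐ[volume.restrict (elt b)] cdiv τ :=
  (hasWeakDiv_cdiv hτ).weakDiv_ae_eq (memLp_elt b (continuous_cdiv hτ))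

theorem HasWeakDiv.sub {τ τ' : E n → E n} {d d' : E n → ℝ}
    (hτ : MemLp τ 2 (volume.restrict (elt b))) (hτ' : MemLp τ' 2 (volume.restrict (elt b)))
    (hd : MemLp d 2 (volume.restrict (elt b))) (hd' : MemLp d' 2 (volume.restrict (elt b)))
    (h : HasWeakDiv (elt b) τ d) (h' : HasWeakDiv (elt b) τ' d') :
    HasWeakDiv (elt b) (τ - τ') (d - d') := by
  intro φ hφ
  have hφL := memLp_elt b hφ.1.continuous
  have hφG := memLp_elt b (continuous_gradient hφ.contDiff_one)
  simp only [Pi.sub_apply, inner_sub_left, sub_mul]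
  rw [integral_sub (integrable_inner hτ hφG) (integrable_inner hτ' hφG),
    integral_sub (integrable_mul hd hφL) (integrable_mul hd' hφL), h φ hφ, h' φ hφ]
  ring

theorem MemHdiv.sub {τ τ' : E n → E n} (h : MemHdiv (elt b) τ) (h' : MemHdiv (elt b) τ') :
    MemHdiv (elt b) (τ - τ') :=
  ⟨h.1.sub h'.1, _, h.weakDiv_spec.1.sub h'.weakDiv_spec.1,
    h.weakDiv_spec.2.sub h.1 h'.1 h.weakDiv_spec.1 h'.weakDiv_spec.1 h'.weakDiv_spec.2⟩

theorem weakDiv_sub {τ τ' : E n → E n} (h : MemHdiv (elt b) τ) (h' : MemHdiv (elt b) τ') :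
    weakDiv (elt b) (τ - τ') =ᵐ[volume.restrict (elt b)]
      weakDiv (elt b) τ - weakDiv (elt b) τ' :=
  (h.weakDiv_spec.2.sub h.1 h'.1 h.weakDiv_spec.1 h'.weakDiv_spec.1
    h'.weakDiv_spec.2).weakDiv_ae_eq (h.weakDiv_spec.1.sub h'.weakDiv_spec.1)

end weak

/-! ### Functions with vanishing trace -/

section trace

variable [NeZero n] (b : Simplex n)

-- In `x - b i = ∑ j, λ_j (b j - b i)` the term `j = i` drops out, and the remaining weights sum to
-- `1 - λ_i`. The factor `1 - λ_i` is kept because the main term of the strip estimate carries it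
-- too.
omit [NeZero n] in
theorem norm_sub_vertex_le {x : E n} (hx : x ∈ closedElt b) (i : Fin (n + 1)) :
    ‖x - b i‖ ≤ (1 - b.coord i x) * diam b := by
  have h0 := mem_closedElt.1 hx
  have h1 : x - b i = ∑ j, b.coord j x • (b j - b i) := by
    simp only [smul_sub, Finset.sum_sub_distrib, ← Finset.sum_smul, sum_coord, one_smul]
    rw [b.linear_combination_coord_eq_self]
  have h2 : ∀ j, ‖b.coord j x • (b j - b i)‖ ≤
      (b.coord j x - if j = i then b.coord j x else 0) * diam b := by
    intro j
    by_cases hj : j = i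
    · simp [hj]
    · rw [norm_smul, Real.norm_of_nonneg (h0 j), if_neg hj, sub_zero]
      exact mul_le_mul_of_nonneg_left (dist_le_diam b (vertex_mem b j) (vertex_mem b i)) (h0 j)
  calc ‖x - b i‖ ≤ ∑ j, (b.coord j x - if j = i then b.coord j x else 0) * diam b := by
        rw [h1]; exact norm_sum_le_of_le _ fun j _ => h2 j
    _ = _ := by
        rw [← Finset.sum_mul, Finset.sum_sub_distrib, sum_coord]
        simp

theorem integral_face_le_surface {f : E n → ℝ} (hf : Continuous f) (h0 : ∀ x, 0 ≤ f x)
    (i : Fin (n + 1)) :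
    ∫ x in face b i, f x ∂(Measure.euclideanHausdorffMeasure (n - 1)) ≤
      ∫ x, f x ∂(surface (elt b)) := by
  rw [integral_surface b hf]
  exact Finset.single_le_sum (f := fun i => ∫ x in face b i, f x
    ∂(Measure.euclideanHausdorffMeasure (n - 1)))
    (fun j _ => integral_nonneg h0) (Finset.mem_univ i)

omit [NeZero n] in
theorem measurableSet_coord_lt (i : Fin (n + 1)) (δ : ℝ) :
    MeasurableSet {x : E n | b.coord i x < δ} :=
  (isOpen_lt (continuous_coord b i) continuous_const).measurableSet

/-- The `L²` norm on a strip of width `ε` along a face is controlled by the boundary values and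
`ε` times the gradient. -/
theorem integral_strip_le {ε : ℝ} (hε : 0 < ε) (hε' : ε ≤ 1 / 6) {ψ : E n → ℝ}
    (hψ : ContDiff ℝ 1 ψ) (i : Fin (n + 1)) :
    ∫ x in elt b ∩ {x | b.coord i x < 3 * ε}, ψ x ^ 2 ≤
      4 * Real.exp 3 * (diam b + 2 * diam b ^ 2) * (ε * ∫ x, ψ x ^ 2 ∂(surface (elt b)) +
        ε ^ 2 * ∫ x in elt b, ‖gradient ψ x‖ ^ 2) := by
  set h := diam b
  have hh : 0 < h := diam_pos b
  -- The weight is `1` on the face, and its derivative in the direction `x - b i` is `g (1 - λ) /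
  -- ε`. In the divergence identity for `g ψ²` this yields a positive volume term of size `ψ² / ε`
  -- on the strip.
  let g : E n → ℝ := fun x => Real.exp (-(b.coord i x) / ε)
  let f : E n → ℝ := fun x => g x * ψ x ^ 2
  have hg : ContDiff ℝ 1 g := ((contDiff_coord b i).neg.div_const ε).exp
  have hf : ContDiff ℝ 1 f := hg.mul (hψ.pow 2)
  have hcψ := hψ.continuous
  have hcg := continuous_gradient hψ
  have hfd : ∀ x, fderiv ℝ f x (x - b i) = g x * ((1 - b.coord i x) / ε) * ψ x ^ 2 +
      2 * g x * ψ x * fderiv ℝ ψ x (x - b i) := by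
    intro x
    have h1 : HasFDerivAt g (g x • (ε⁻¹ • -innerSL ℝ (baryGrad b i))) x := by
      have := ((hasFDerivAt_coord b i x).neg.const_smul ε⁻¹).exp
      have e : g = fun x => Real.exp (ε⁻¹ • -(b.coord i x)) := by
        ext y; simp [g, div_eq_inv_mul]
      rw [e]; exact this
    have h2 := ((hψ.differentiable one_ne_zero x).hasFDerivAt.pow 2)
    have h3 := (h1.mul h2).fderiv
    have h4 : f = g * fun x => ψ x ^ 2 := rfl
    rw [h4, h3]
    have h6 := coord_sub b i x (b i)
    rw [b.coord_apply_eq] at h6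
    simp only [add_apply, smul_apply,
      neg_apply, innerSL_apply_apply, h6, smul_eq_mul,
      nsmul_eq_mul]
    field_simp
    push_cast
    ring
  have key : ∀ x ∈ elt b, ({x | b.coord i x < 3 * ε}).indicator
      (fun x => Real.exp (-3) / (4 * ε) * ψ x ^ 2) x ≤
      (n * f x + fderiv ℝ f x (x - b i)) + 2 * h ^ 2 * ε * ‖gradient ψ x‖ ^ 2 := by
    intro x hx
    have hl0 := mem_elt.1 hx i
    have hl1 := coord_le_one (elt_subset b hx) i
    have hgpos : 0 < g x := Real.exp_pos _
    have hg1 : g x ≤ 1 := Real.exp_le_one_iff.2 (by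
      rw [neg_div]; exact neg_nonpos.2 (by positivity))
    set a := |ψ x| with ha
    set c := ‖gradient ψ x‖ with hc
    have hsq : ψ x ^ 2 = a ^ 2 := (sq_abs _).symm
    have hn : (0 : ℝ) ≤ n * f x := by
      have : 0 ≤ f x := mul_nonneg hgpos.le (sq_nonneg _)
      positivity
    have hd : |fderiv ℝ ψ x (x - b i)| ≤ c * ((1 - b.coord i x) * h) := by
      rw [← inner_gradient]
      exact (abs_real_inner_le_norm _ _).trans (mul_le_mul_of_nonneg_left
        (norm_sub_vertex_le b (elt_subset b hx) i) (norm_nonneg _))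
    have hd2 : -(2 * g x * (a * (c * ((1 - b.coord i x) * h)))) ≤
        2 * g x * ψ x * fderiv ℝ ψ x (x - b i) := by
      have h1 : |ψ x * fderiv ℝ ψ x (x - b i)| ≤ a * (c * ((1 - b.coord i x) * h)) := by
        rw [abs_mul]
        exact mul_le_mul_of_nonneg_left hd (abs_nonneg _)
      have h2 := (abs_le.1 h1).1
      nlinarith
    have hlow : (1 - b.coord i x) * (g x / ε) * (a ^ 2 / 2) -
        (1 - b.coord i x) * g x * (2 * h ^ 2 * ε * c ^ 2) ≤ n * f x + fderiv ℝ f x (x - b i) := by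
      rw [hfd x, hsq]
      -- Young's inequality with weights such that the mixed term uses up exactly half of the main
      -- term `(1 - λ) g a² / ε`.
      have hyoung : 2 * (a * (c * h)) ≤ a ^ 2 / (2 * ε) + 2 * h ^ 2 * ε * c ^ 2 := by
        have h1 : 0 ≤ (a - 2 * ε * h * c) ^ 2 / (2 * ε) := by positivity
        have h2 : (a - 2 * ε * h * c) ^ 2 / (2 * ε) =
          a ^ 2 / (2 * ε) + 2 * h ^ 2 * ε * c ^ 2 - 2 * (a * (c * h)) := by field_simp; ring
        linarith
      have h3 := mul_le_mul_of_nonneg_left hyoung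
        (mul_nonneg (sub_nonneg.2 hl1) hgpos.le)
      have h4 : (1 - b.coord i x) * g x * (a ^ 2 / (2 * ε) + 2 * h ^ 2 * ε * c ^ 2) =
        g x * ((1 - b.coord i x) / ε) * a ^ 2 - (1 - b.coord i x) * (g x / ε) * (a ^ 2 / 2) +
          (1 - b.coord i x) * g x * (2 * h ^ 2 * ε * c ^ 2) := by field_simp; ring
      nlinarith
    have hup : (1 - b.coord i x) * g x * (2 * h ^ 2 * ε * c ^ 2) ≤ 2 * h ^ 2 * ε * c ^ 2 := by
      have h1 : (1 - b.coord i x) * g x ≤ 1 := by nlinarith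
      exact mul_le_of_le_one_left (by positivity) h1
    refine le_trans ?_ (show (1 - b.coord i x) * (g x / ε) * (a ^ 2 / 2) ≤ _ by linarith)
    by_cases hs : b.coord i x < 3 * ε
    · rw [Set.indicator_of_mem (show x ∈ {x | b.coord i x < 3 * ε} from hs), hsq]
      have h1 : Real.exp (-3) ≤ g x := Real.exp_le_exp.2 (by
        rw [neg_div, neg_le_neg_iff, div_le_iff₀ hε]; exact hs.le)
      -- Here `ε ≤ 1 / 6` enters: on the strip `λ < 3 ε ≤ 1 / 2`.
      have h2 : 1 / 2 ≤ 1 - b.coord i x := by linarith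
      calc Real.exp (-3) / (4 * ε) * a ^ 2 = 1 / 2 * (Real.exp (-3) / ε) * (a ^ 2 / 2) := by
            field_simp; ring
        _ ≤ _ := by gcongr
    · rw [Set.indicator_of_notMem (show x ∉ {x | b.coord i x < 3 * ε} from hs)]
      have := sub_nonneg.2 hl1
      positivity
  have hint1 : Integrable (fun x => n * f x + fderiv ℝ f x (x - b i)) (volume.restrict (elt b)) := by
    have hc1 := hf.continuous
    have hc2 := hf.continuous_fderiv one_ne_zero
    exact integrable_of_continuous b (by fun_prop)
  have hint2 : Integrable (fun x => 2 * h ^ 2 * ε * ‖gradient ψ x‖ ^ 2)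
      (volume.restrict (elt b)) := integrable_of_continuous b (by fun_prop)
  have hm := measurableSet_coord_lt b i (3 * ε)
  have hint3 : Integrable (({x | b.coord i x < 3 * ε}).indicator
      (fun x => Real.exp (-3) / (4 * ε) * ψ x ^ 2)) (volume.restrict (elt b)) :=
    (integrable_of_continuous b (by fun_prop)).indicator hm
  have hI := setIntegral_mono_on hint3 (hint1.add hint2) (isOpen_elt b).measurableSet key
  rw [setIntegral_indicator hm, integral_const_mul] at hI
  have hI2 : ∫ x in elt b, ((fun x => n * f x + fderiv ℝ f x (x - b i)) +
      (fun x => 2 * h ^ 2 * ε * ‖gradient ψ x‖ ^ 2) : E n → ℝ) x =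
      ‖heightVec b i‖ * (∫ x in face b i, f x ∂(Measure.euclideanHausdorffMeasure (n - 1))) +
      2 * h ^ 2 * ε * ∫ x in elt b, ‖gradient ψ x‖ ^ 2 := by
    rw [integral_add' hint1 hint2, integral_div_cone b i hf, integral_const_mul]
  rw [hI2] at hI
  have hF : ∫ x in face b i, f x ∂(Measure.euclideanHausdorffMeasure (n - 1)) =
      ∫ x in face b i, ψ x ^ 2 ∂(Measure.euclideanHausdorffMeasure (n - 1)) := by
    refine setIntegral_congr_fun (isCompact_face b i).measurableSet fun x hx => ?_
    simp [f, g, (mem_face.1 hx).2]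
  have hS := integral_face_le_surface b (f := fun x => ψ x ^ 2) (hcψ.pow 2)
    (fun _ => sq_nonneg _) i
  rw [hF] at hI
  have hheight : ‖heightVec b i‖ ≤ h := by
    rw [norm_heightVec, inv_le_iff_one_le_mul₀ (norm_pos_iff.2 (baryGrad_ne_zero b i)), mul_comm]
    exact one_le_baryGrad_mul_diam b i
  set S := ∫ x, ψ x ^ 2 ∂(surface (elt b))
  set Gr := ∫ x in elt b, ‖gradient ψ x‖ ^ 2
  have hS0 : 0 ≤ S := integral_nonneg fun _ => sq_nonneg _
  have hG0 : 0 ≤ Gr := integral_nonneg fun _ => sq_nonneg _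
  have hF0 : 0 ≤ ∫ x in face b i, ψ x ^ 2 ∂(Measure.euclideanHausdorffMeasure (n - 1)) :=
    integral_nonneg fun _ => sq_nonneg _
  set I := ∫ x in elt b ∩ {x | b.coord i x < 3 * ε}, ψ x ^ 2
  have h1 : Real.exp (-3) / (4 * ε) * I ≤ h * S + 2 * h ^ 2 * ε * Gr := by
    refine hI.trans ?_
    gcongr
  have h2 : I = 4 * ε * Real.exp 3 * (Real.exp (-3) / (4 * ε) * I) := by
    rw [Real.exp_neg]; field_simp
  rw [h2]
  calc 4 * ε * Real.exp 3 * (Real.exp (-3) / (4 * ε) * I)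
      ≤ 4 * ε * Real.exp 3 * (h * S + 2 * h ^ 2 * ε * Gr) := by gcongr
    _ = 4 * Real.exp 3 * (h * (ε * S) + 2 * h ^ 2 * (ε ^ 2 * Gr)) := by ring
    _ ≤ 4 * Real.exp 3 * ((h + 2 * h ^ 2) * (ε * S) + (h + 2 * h ^ 2) * (ε ^ 2 * Gr)) := by
        gcongr
        · nlinarith
        · linarith
    _ = _ := by ring

/-! ### Cutoff functions -/

/-- The derivative is continuous, hence bounded on `[0, 1]`, and the function is constant on either
side of this interval. -/
theorem exists_bound_deriv_smoothTransition : ∃ L, 0 ≤ L ∧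
    ∀ x, |deriv Real.smoothTransition x| ≤ L := by
  have hc : Continuous (deriv Real.smoothTransition) :=
    (Real.smoothTransition.contDiff (n := 1)).continuous_deriv le_rfl
  obtain ⟨C, hC⟩ := isCompact_Icc (a := (0 : ℝ)) (b := 1).exists_bound_of_continuousOn
    hc.continuousOn
  refine ⟨max C 0, le_max_right _ _, fun x => ?_⟩
  rcases lt_or_ge x 0 with h | h
  · have : Real.smoothTransition =ᶠ[𝓝 x] fun _ => 0 := by
      filter_upwards [Iio_mem_nhds h] with y hy
        using Real.smoothTransition.zero_of_nonpos (le_of_lt hy)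
    rw [this.deriv_eq]; simp
  rcases le_or_gt x 1 with h1 | h1
  · exact (hC x ⟨h, h1⟩).trans (le_max_left _ _)
  · have : Real.smoothTransition =ᶠ[𝓝 x] fun _ => 1 := by
      filter_upwards [Ioi_mem_nhds h1] with y hy
        using Real.smoothTransition.one_of_one_le (le_of_lt hy)
    rw [this.deriv_eq]; simp

/-- A cutoff function: `1` at distance of order `ε` from the boundary and compactly supported. -/
def cutoff {n : ℕ} (b : Simplex n) (ε : ℝ) (x : E n) : ℝ :=
  ∏ i, Real.smoothTransition (b.coord i x / ε - 1)

/-- The strip along the boundary on which `cutoff b ε` is not constant. -/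
def strip {n : ℕ} (b : Simplex n) (ε : ℝ) : Set (E n) := elt b ∩ ⋃ i, {x | b.coord i x < 3 * ε}

omit [NeZero n] in
theorem measurableSet_strip (ε : ℝ) : MeasurableSet (strip b ε) :=
  (isOpen_elt b).measurableSet.inter (MeasurableSet.iUnion fun i => measurableSet_coord_lt b i _)

omit [NeZero n] in
theorem contDiff_cutoff (ε : ℝ) : ContDiff ℝ ∞ (cutoff b ε) :=
  contDiff_prod fun i _ => Real.smoothTransition.contDiff.comp
    (((contDiff_coord b i).div_const ε).sub contDiff_const)

omit [NeZero n] in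
theorem cutoff_nonneg (ε : ℝ) (x : E n) : 0 ≤ cutoff b ε x :=
  Finset.prod_nonneg fun _ _ => Real.smoothTransition.nonneg _

omit [NeZero n] in
theorem cutoff_le_one (ε : ℝ) (x : E n) : cutoff b ε x ≤ 1 :=
  Finset.prod_le_one (fun _ _ => Real.smoothTransition.nonneg _)
    fun _ _ => Real.smoothTransition.le_one _

omit [NeZero n] in
theorem isTestFunction_cutoff_mul {ε : ℝ} (hε : 0 < ε) {ψ : E n → ℝ} (hψ : ContDiff ℝ ∞ ψ) :
    IsTestFunction (elt b) fun x => cutoff b ε x * ψ x := by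
  have hcl : IsClosed {x : E n | ∀ i, ε ≤ b.coord i x} := by
    simp only [Set.ofPred_forall]
    exact isClosed_iInter fun i => isClosed_le continuous_const (continuous_coord b i)
  have hsub : tsupport (fun x => cutoff b ε x * ψ x) ⊆ {x : E n | ∀ i, ε ≤ b.coord i x} := by
    refine closure_minimal (fun x hx i => ?_) hcl
    by_contra hlt
    refine hx ?_
    have h0 : cutoff b ε x = 0 := Finset.prod_eq_zero (Finset.mem_univ i)
      (Real.smoothTransition.zero_of_nonpos (by
        rw [sub_nonpos, div_le_one hε]; exact (not_le.1 hlt).le))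
    simp only [h0, zero_mul]
  have hT : {x : E n | ∀ i, ε ≤ b.coord i x} ⊆ elt b := fun x hx =>
    mem_elt.2 fun i => hε.trans_le (hx i)
  refine ⟨(contDiff_cutoff b ε).mul hψ, ?_, hsub.trans hT⟩
  exact (isCompact_closedElt b).of_isClosed_subset (isClosed_tsupport _)
    (hsub.trans (hT.trans (elt_subset b)))

omit [NeZero n] in
theorem cutoff_eq_one {ε : ℝ} (hε : 0 < ε) {x : E n} (hx : ∀ i, 3 * ε ≤ b.coord i x) :
    cutoff b ε x = 1 :=
  Finset.prod_eq_one fun i _ => Real.smoothTransition.one_of_one_le (by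
    have : 3 ≤ b.coord i x / ε := by rw [le_div_iff₀ hε]; exact hx i
    linarith)

omit [NeZero n] in
theorem hasFDerivAt_cutoff (ε : ℝ) (x : E n) : HasFDerivAt (cutoff b ε)
    (∑ i, (∏ j ∈ Finset.univ.erase i, Real.smoothTransition (b.coord j x / ε - 1)) •
      (deriv Real.smoothTransition (b.coord i x / ε - 1) • (ε⁻¹ • innerSL ℝ (baryGrad b i)))) x := by
  refine HasFDerivAt.finsetProd (u := Finset.univ) fun i _ => ?_
  have h1 : HasFDerivAt (fun x => b.coord i x / ε - 1) (ε⁻¹ • innerSL ℝ (baryGrad b i)) x := by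
    have := ((hasFDerivAt_coord b i x).const_smul ε⁻¹).sub_const 1
    have e : (fun x => b.coord i x / ε - 1) = fun x => ε⁻¹ • b.coord i x - 1 := by
      ext y; simp [div_eq_inv_mul]
    rw [e]; exact this
  exact ((Real.smoothTransition.contDiff (n := 1)).differentiable one_ne_zero _).hasDerivAt
    |>.comp_hasFDerivAt x h1

omit [NeZero n] in
theorem norm_fderiv_cutoff_le {ε L : ℝ} (hε : 0 < ε)
    (hL : ∀ x, |deriv Real.smoothTransition x| ≤ L) (x : E n) :
    ‖fderiv ℝ (cutoff b ε) x‖ ≤ L * (∑ i, ‖baryGrad b i‖) / ε := by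
  rw [(hasFDerivAt_cutoff b ε x).fderiv]
  refine (norm_sum_le _ _).trans ?_
  rw [mul_div_assoc, Finset.sum_div, Finset.mul_sum]
  refine Finset.sum_le_sum fun i _ => ?_
  rw [norm_smul, norm_smul, norm_smul, innerSL_apply_norm, Real.norm_eq_abs, abs_of_nonneg
    (Finset.prod_nonneg fun _ _ => Real.smoothTransition.nonneg _), norm_inv,
    Real.norm_of_nonneg hε.le, Real.norm_eq_abs]
  have h1 : ∏ j ∈ Finset.univ.erase i, Real.smoothTransition (b.coord j x / ε - 1) ≤ 1 :=
    Finset.prod_le_one (fun _ _ => Real.smoothTransition.nonneg _)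
      fun _ _ => Real.smoothTransition.le_one _
  refine (mul_le_of_le_one_left (by positivity) h1).trans ?_
  rw [div_eq_inv_mul ‖baryGrad b i‖]
  exact mul_le_mul_of_nonneg_right (hL _) (by positivity)

omit [NeZero n] in
theorem fderiv_cutoff_eq_zero {ε : ℝ} (hε : 0 < ε) {x : E n} (hx : ∀ i, 3 * ε ≤ b.coord i x) :
    fderiv ℝ (cutoff b ε) x = 0 := by
  rw [(hasFDerivAt_cutoff b ε x).fderiv]
  refine Finset.sum_eq_zero fun i _ => ?_
  -- Each factor of the cutoff is `1` from `λ = 2 ε` on. The strip extends to `3 ε`, so that off it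
  -- the factor is constant in a neighbourhood and its derivative vanishes.
  have h3 : 3 ≤ b.coord i x / ε := by rw [le_div_iff₀ hε]; exact hx i
  have : Real.smoothTransition =ᶠ[𝓝 (b.coord i x / ε - 1)] fun _ => 1 := by
    filter_upwards [Ioi_mem_nhds (show 1 < b.coord i x / ε - 1 by linarith)] with y hy
      using Real.smoothTransition.one_of_one_le (le_of_lt hy)
  rw [this.deriv_eq]; simp

end trace

/-! ### Green's formula by truncation; the pairing as a functional of the trace -/

section traceZero

variable [NeZero n] (b : Simplex n)

theorem restrict_strip_le {n : ℕ} (b : Simplex n) (ε : ℝ) :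
    (volume.restrict (strip b ε) : Measure (E n)) ≤ volume.restrict (elt b) :=
  Measure.restrict_mono Set.inter_subset_left le_rfl

theorem lnorm_mono_measure {α F : Type*} [MeasurableSpace α] {μ ν : Measure α}
    [NormedAddCommGroup F] {f : α → F} (h : ν ≤ μ) (hf : MemLp f 2 μ) :
    lnorm ν f ≤ lnorm μ f :=
  ENNReal.toReal_mono hf.2.ne (eLpNorm_mono_measure f h)

/-- The strips decrease to the empty set, since at a point of the open simplex the least barycentric
coordinate is positive. The widths `1 / (m + 6)` obey the restriction `ε ≤ 1 / 6` of the strip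
estimate. -/
theorem tendsto_lnorm_strip {n : ℕ} {F : Type*} [NormedAddCommGroup F] (b : Simplex n)
    {f : E n → F} (hf : MemLp f 2 (volume.restrict (elt b))) :
    Tendsto (fun m : ℕ => lnorm (volume.restrict (strip b (1 / (m + 6)))) f) atTop (𝓝 0) := by
  have hanti : Antitone fun m : ℕ => strip b (1 / ((m : ℝ) + 6)) := by
    intro m k hmk x hx
    refine ⟨hx.1, ?_⟩
    obtain ⟨i, hi⟩ := Set.mem_iUnion.1 hx.2
    have hmk' : (m : ℝ) ≤ k := by exact_mod_cast hmk
    have : 1 / ((k : ℝ) + 6) ≤ 1 / ((m : ℝ) + 6) := by gcongr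
    have hi : b.coord i x < 3 * (1 / ((k : ℝ) + 6)) := hi
    exact Set.mem_iUnion.2 ⟨i, show b.coord i x < _ by linarith⟩
  have hempty : ⋂ m : ℕ, strip b (1 / ((m : ℝ) + 6)) = ∅ := by
    rw [Set.eq_empty_iff_forall_notMem]
    intro x hx
    rw [Set.mem_iInter] at hx
    have hpos := mem_elt.1 (hx 0).1
    obtain ⟨i0, -, hi0⟩ := Finset.exists_min_image Finset.univ (fun i => b.coord i x)
      Finset.univ_nonempty
    obtain ⟨m, hm⟩ := exists_nat_one_div_lt (show 0 < b.coord i0 x / 3 from by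
      have := hpos i0; positivity)
    obtain ⟨i, hi⟩ := Set.mem_iUnion.1 (hx m).2
    have hi : b.coord i x < 3 * (1 / ((m : ℝ) + 6)) := hi
    have h1 : 1 / ((m : ℝ) + 6) ≤ 1 / ((m : ℝ) + 1) := by gcongr; norm_num
    linarith [hi0 i (Finset.mem_univ i)]
  have h := tendsto_setIntegral_of_antitone (μ := volume) (f := fun x => ‖f x‖ ^ 2)
    (fun m : ℕ => measurableSet_strip b (1 / ((m : ℝ) + 6))) hanti
    ⟨0, (by
      have : Integrable (fun x => ‖f x‖ ^ 2) (volume.restrict (elt b)) := hf.integrable_norm_pow (by norm_num)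
      exact this.mono_measure (restrict_strip_le b _))⟩
  rw [hempty] at h
  simp only [setIntegral_empty] at h
  have h2 : ∀ m : ℕ, lnorm (volume.restrict (strip b (1 / ((m : ℝ) + 6)))) f =
      Real.sqrt (∫ x in strip b (1 / ((m : ℝ) + 6)), ‖f x‖ ^ 2) := fun m => by
    rw [← lnorm_sq (hf.mono_measure (restrict_strip_le b _)), Real.sqrt_sq (lnorm_nonneg _)]
  simp only [h2]
  have h3 := (Real.continuous_sqrt.tendsto 0).comp h
  rwa [Real.sqrt_zero] at h3

theorem lnorm_strip_sq_le {ε : ℝ} (hε : 0 < ε) (hε' : ε ≤ 1 / 6) {ψ : E n → ℝ}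
    (hψ : ContDiff ℝ 1 ψ) :
    lnorm (volume.restrict (strip b ε)) ψ ^ 2 ≤
      (n + 1) * (4 * Real.exp 3 * (diam b + 2 * diam b ^ 2)) *
      (ε * lnorm (surface (elt b)) ψ ^ 2 +
        ε ^ 2 * lnorm (volume.restrict (elt b)) (gradient ψ) ^ 2) := by
  have hL := memLp_elt b hψ.continuous
  rw [lnorm_sq (hL.mono_measure (restrict_strip_le b ε)), lnorm_sq (memLp_surface b hψ.continuous),
    lnorm_sq (memLp_elt b (continuous_gradient hψ))]
  simp only [Real.norm_eq_abs, sq_abs]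
  have hsq : Integrable (fun x => ψ x ^ 2) (volume.restrict (elt b)) :=
    integrable_of_continuous b (hψ.continuous.pow 2)
  have h1 : (volume.restrict (strip b ε) : Measure (E n)) ≤
      ∑ i, volume.restrict (elt b ∩ {x | b.coord i x < 3 * ε}) := by
    rw [strip, Set.inter_iUnion, ← Measure.sum_fintype]
    exact Measure.restrict_iUnion_le
  have hi : ∀ i ∈ (Finset.univ : Finset (Fin (n + 1))), Integrable (fun x => ψ x ^ 2)
      (volume.restrict (elt b ∩ {x | b.coord i x < 3 * ε})) := fun i _ =>
    hsq.mono_measure (Measure.restrict_mono Set.inter_subset_left le_rfl)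
  refine (integral_mono_measure h1 (Eventually.of_forall fun _ => sq_nonneg _)
    (integrable_finsetSum_measure.2 hi)).trans ?_
  rw [integral_finsetSum_measure hi]
  refine (Finset.sum_le_sum fun i _ => integral_strip_le b hε hε' hψ i).trans (le_of_eq ?_)
  simp
  ring

/-- The weak divergence tested with `cutoff b ε * ψ` contributes nothing, so only `(1 - cutoff b ε)
ψ` remains, and the integrand vanishes off the strip. The last term comes from `ψ ∇(cutoff b ε)` and
is the only one with a factor `1 / ε`. -/
theorem abs_green_le {n : ℕ} (b : Simplex n) {ε L : ℝ} (hε : 0 < ε)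
    (hL : ∀ x, |deriv Real.smoothTransition x| ≤ L)
    {τ : E n → E n} {d : E n → ℝ} (hτ : MemLp τ 2 (volume.restrict (elt b)))
    (hd : MemLp d 2 (volume.restrict (elt b))) (hw : HasWeakDiv (elt b) τ d)
    {ψ : E n → ℝ} (hψ : ContDiff ℝ ∞ ψ) :
    |(∫ x in elt b, d x * ψ x) + ∫ x in elt b, inner ℝ (τ x) (gradient ψ x)| ≤
      lnorm (volume.restrict (strip b ε)) d * lnorm (volume.restrict (elt b)) ψ +
      lnorm (volume.restrict (strip b ε)) τ * lnorm (volume.restrict (elt b)) (gradient ψ) +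
      L * (∑ i, ‖baryGrad b i‖) / ε * (lnorm (volume.restrict (strip b ε)) τ *
        lnorm (volume.restrict (strip b ε)) ψ) := by
  have hψ1 : ContDiff ℝ 1 ψ := hψ.of_le (by exact_mod_cast le_top)
  set φ : E n → ℝ := fun x => cutoff b ε x * ψ x with hφdef
  have hφ : IsTestFunction (elt b) φ := isTestFunction_cutoff_mul b hε hψ
  have hψL := memLp_elt b hψ1.continuous
  have hψG := memLp_elt b (continuous_gradient hψ1)
  have hφL := memLp_elt b hφ.1.continuous
  have hφG := memLp_elt b (continuous_gradient hφ.contDiff_one)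
  set k : E n → ℝ := fun x => (d x * ψ x + inner ℝ (τ x) (gradient ψ x)) -
    (d x * φ x + inner ℝ (τ x) (gradient φ x)) with hk
  have hB : (∫ x in elt b, d x * ψ x) + ∫ x in elt b, inner ℝ (τ x) (gradient ψ x) =
      ∫ x in elt b, k x := by
    have i1 := integrable_mul hd hψL
    have i2 := integrable_inner hτ hψG
    have i3 := integrable_mul hd hφL
    have i4 := integrable_inner hτ hφG
    have i12 : Integrable (fun x => d x * ψ x + inner ℝ (τ x) (gradient ψ x))
      (volume.restrict (elt b)) := i1.add i2
    have i34 : Integrable (fun x => d x * φ x + inner ℝ (τ x) (gradient φ x))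
      (volume.restrict (elt b)) := i3.add i4
    rw [integral_sub i12 i34, integral_add i1 i2, integral_add i3 i4, hw φ hφ]
    ring
  have hgrad : ∀ x, inner ℝ (τ x) (gradient φ x) =
      cutoff b ε x * inner ℝ (τ x) (gradient ψ x) + ψ x * fderiv ℝ (cutoff b ε) x (τ x) := by
    intro x
    have h1 := (((hasFDerivAt_cutoff b ε x).differentiableAt.hasFDerivAt).mul
      (hψ1.differentiable one_ne_zero x).hasFDerivAt).fderiv
    have h2 : φ = cutoff b ε * ψ := rfl
    rw [inner_gradient', inner_gradient', h2, h1]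
    simp
  have hzero : ∀ x ∈ elt b \ strip b ε, k x = 0 := by
    intro x hx
    have hx2 : ∀ i, 3 * ε ≤ b.coord i x := fun i => by
      by_contra hlt
      exact hx.2 ⟨hx.1, Set.mem_iUnion.2 ⟨i, not_le.1 hlt⟩⟩
    have hφx : φ x = cutoff b ε x * ψ x := rfl
    simp only [hk]
    rw [hgrad, hφx, cutoff_eq_one b hε hx2, fderiv_cutoff_eq_zero b hε hx2]
    simp
  set c := L * (∑ i, ‖baryGrad b i‖) / ε with hc
  have hbound : ∀ x, ‖k x‖ ≤ ‖d x‖ * ‖ψ x‖ + ‖τ x‖ * ‖gradient ψ x‖ + c * (‖τ x‖ * ‖ψ x‖) := by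
    intro x
    have h0 := cutoff_nonneg b ε x
    have h1 := cutoff_le_one b ε x
    have hkx : k x = (1 - cutoff b ε x) * (d x * ψ x) +
        (1 - cutoff b ε x) * inner ℝ (τ x) (gradient ψ x) -
        ψ x * fderiv ℝ (cutoff b ε) x (τ x) := by
      have hφx : φ x = cutoff b ε x * ψ x := rfl
      simp only [hk]
      rw [hgrad, hφx]; ring
    rw [hkx]
    have hc0 : |1 - cutoff b ε x| ≤ 1 := by rw [abs_le]; constructor <;> linarith
    refine (norm_sub_le _ _).trans (add_le_add ((norm_add_le _ _).trans (add_le_add ?_ ?_)) ?_)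
    · rw [norm_mul, norm_mul]
      exact mul_le_of_le_one_left (by positivity) hc0
    · rw [norm_mul]
      exact (mul_le_of_le_one_left (norm_nonneg _) hc0).trans (norm_inner_le_norm _ _)
    · rw [norm_mul]
      have := ((fderiv ℝ (cutoff b ε) x).le_opNorm (τ x)).trans
        (mul_le_mul_of_nonneg_right (norm_fderiv_cutoff_le b hε hL x) (norm_nonneg _))
      calc ‖ψ x‖ * ‖fderiv ℝ (cutoff b ε) x (τ x)‖ ≤ ‖ψ x‖ * (c * ‖τ x‖) := by gcongr
        _ = _ := by ring
  have hle := restrict_strip_le b ε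
  rw [hB, setIntegral_eq_of_subset_of_forall_sdiff_eq_zero (isOpen_elt b).measurableSet
    (Set.inter_subset_left : strip b ε ⊆ elt b) hzero]
  have j1 := integrable_norm_mul_norm (hd.mono_measure hle) (hψL.mono_measure hle)
  have j2 := integrable_norm_mul_norm (hτ.mono_measure hle) (hψG.mono_measure hle)
  have j3 := integrable_norm_mul_norm (hτ.mono_measure hle) (hψL.mono_measure hle)
  refine (norm_integral_le_of_norm_le ((j1.add j2).add (j3.const_mul c))
    (Eventually.of_forall hbound)).trans ?_
  have hL0 : 0 ≤ L := (abs_nonneg _).trans (hL 0)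
  have hc0 : 0 ≤ c := by positivity
  rw [integral_add' (j1.add j2) (j3.const_mul c), integral_add' j1 j2, integral_const_mul]
  refine add_le_add (add_le_add ?_ ?_) (mul_le_mul_of_nonneg_left ?_ hc0)
  · exact (integral_norm_mul_norm_le (hd.mono_measure hle) (hψL.mono_measure hle)).trans
      (mul_le_mul_of_nonneg_left (lnorm_mono_measure hle hψL) (lnorm_nonneg _))
  · exact (integral_norm_mul_norm_le (hτ.mono_measure hle) (hψG.mono_measure hle)).trans
      (mul_le_mul_of_nonneg_left (lnorm_mono_measure hle hψG) (lnorm_nonneg _))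
  · exact integral_norm_mul_norm_le (hτ.mono_measure hle) (hψL.mono_measure hle)

/-- Green's formula without boundary terms for sequences that are bounded in `H¹(T)` and whose
boundary values tend to zero. -/
theorem tendsto_green_zero {τ : E n → E n} {d : E n → ℝ}
    (hτ : MemLp τ 2 (volume.restrict (elt b))) (hd : MemLp d 2 (volume.restrict (elt b)))
    (hw : HasWeakDiv (elt b) τ d) {ψ : ℕ → E n → ℝ} (hψ : ∀ k, ContDiff ℝ ∞ (ψ k)) {M : ℝ}
    (h1 : ∀ᶠ k in atTop, lnorm (volume.restrict (elt b)) (ψ k) ≤ M)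
    (h2 : ∀ᶠ k in atTop, lnorm (volume.restrict (elt b)) (gradient (ψ k)) ≤ M)
    (h3 : Tendsto (fun k => lnorm (surface (elt b)) (ψ k)) atTop (𝓝 0)) :
    Tendsto (fun k => (∫ x in elt b, d x * ψ k x) +
      ∫ x in elt b, inner ℝ (τ x) (gradient (ψ k) x)) atTop (𝓝 0) := by
  obtain ⟨L, hL0, hL⟩ := exists_bound_deriv_smoothTransition
  set C := (n + 1) * (4 * Real.exp 3 * (diam b + 2 * diam b ^ 2)) with hC
  have hdiam := diam_pos b
  have hC0 : 0 ≤ C := by positivity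
  set L' := L * ∑ i, ‖baryGrad b i‖ with hL'
  have hL'0 : 0 ≤ L' := by positivity
  set Q := Real.sqrt (C * (1 + M ^ 2)) with hQ
  have hω : Tendsto (fun m : ℕ => (lnorm (volume.restrict (strip b (1 / (m + 6)))) d +
      lnorm (volume.restrict (strip b (1 / (m + 6)))) τ) * (2 * M + L' * Q)) atTop (𝓝 0) := by
    simpa using ((tendsto_lnorm_strip b hd).add (tendsto_lnorm_strip b hτ)).mul_const
      (2 * M + L' * Q)
  rw [Metric.tendsto_nhds]
  intro δ hδ
  -- The width `ε` is fixed first, from the tails of `τ` and `d`. Only then is `k` taken so large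
  -- that the squared boundary norm is below `ε`.
  obtain ⟨m, hm⟩ := (hω.eventually (gt_mem_nhds hδ)).exists
  set ε : ℝ := 1 / (m + 6) with hε
  have hεpos : 0 < ε := by positivity
  have hε6 : ε ≤ 1 / 6 := by rw [hε]; gcongr; linarith [(Nat.cast_nonneg m : (0 : ℝ) ≤ m)]
  have h3' : ∀ᶠ k in atTop, lnorm (surface (elt b)) (ψ k) ^ 2 < ε := by
    have := h3.pow 2
    rw [zero_pow two_ne_zero] at this
    exact this.eventually (gt_mem_nhds hεpos)
  filter_upwards [h1, h2, h3'] with k hk1 hk2 hk3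
  rw [Real.dist_0_eq_abs]
  refine lt_of_le_of_lt ?_ hm
  refine (abs_green_le b hεpos hL hτ hd hw (hψ k)).trans ?_
  have hM : 0 ≤ M := (lnorm_nonneg _).trans hk1
  -- A strip norm of order `ε` cancels the `1 / ε` from the gradient of the cutoff.
  have hstrip : lnorm (volume.restrict (strip b ε)) (ψ k) ≤ ε * Q := by
    have h := lnorm_strip_sq_le b hεpos hε6 ((hψ k).of_le (by exact_mod_cast le_top))
    have hg2 : lnorm (volume.restrict (elt b)) (gradient (ψ k)) ^ 2 ≤ M ^ 2 :=
      pow_le_pow_left₀ (lnorm_nonneg _) hk2 2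
    have h4 : lnorm (volume.restrict (strip b ε)) (ψ k) ^ 2 ≤ (ε * Q) ^ 2 := by
      rw [mul_pow, hQ, Real.sq_sqrt (by positivity)]
      refine h.trans ?_
      rw [← hC]
      calc C * (ε * lnorm (surface (elt b)) (ψ k) ^ 2 +
            ε ^ 2 * lnorm (volume.restrict (elt b)) (gradient (ψ k)) ^ 2)
          ≤ C * (ε * ε + ε ^ 2 * M ^ 2) := by gcongr
        _ = _ := by ring
    exact le_of_sq_le_sq h4 (by positivity)
  set A := lnorm (volume.restrict (strip b ε)) d
  set B := lnorm (volume.restrict (strip b ε)) τ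
  have hA0 : 0 ≤ A := lnorm_nonneg _
  have hB0 : 0 ≤ B := lnorm_nonneg _
  rw [← hL']
  calc A * lnorm (volume.restrict (elt b)) (ψ k) +
        B * lnorm (volume.restrict (elt b)) (gradient (ψ k)) +
        L' / ε * (B * lnorm (volume.restrict (strip b ε)) (ψ k))
      ≤ A * M + B * M + L' / ε * (B * (ε * Q)) := by gcongr
    _ = A * M + B * (M + L' * Q) := by field_simp; ring
    _ ≤ (A + B) * (2 * M + L' * Q) := by
        have : 0 ≤ L' * Q := by positivity
        nlinarith [mul_nonneg hA0 this, mul_nonneg hA0 hM, mul_nonneg hB0 hM]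

/-- The duality pairing with `τ` only depends on the trace. -/
theorem pairing_eq_of_hasTrace {τ : E n → E n} (hτ : MemHdiv (elt b) τ) {v u f : E n → ℝ}
    (hv : MemH1 (elt b) v) (hvu : HasTrace (elt b) v u) (hf : ContDiff ℝ ∞ f)
    (hfu : ∀ x ∈ frontier (elt b), f x = u x) :
    pairing (elt b) τ v = pairing (elt b) τ f := by
  obtain ⟨φ, hφ, hφv, hφg, hφu⟩ := hvu
  have hf1 : ContDiff ℝ 1 f := hf.of_le (by exact_mod_cast le_top)
  have hφ1 : ∀ k, ContDiff ℝ 1 (φ k) := fun k => (hφ k).of_le (by exact_mod_cast le_top)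
  set μ : Measure (E n) := volume.restrict (elt b) with hμ
  obtain ⟨hd, hw⟩ := hτ.weakDiv_spec
  set d := weakDiv (elt b) τ
  obtain ⟨hg, -⟩ := hv.weakGrad_spec
  have hfL : MemLp f 2 μ := memLp_elt b hf1.continuous
  have hfG : MemLp (gradient f) 2 μ := memLp_elt b (continuous_gradient hf1)
  have hφL : ∀ k, MemLp (φ k) 2 μ := fun k => memLp_elt b (hφ1 k).continuous
  have hφG : ∀ k, MemLp (gradient (φ k)) 2 μ := fun k => memLp_elt b (continuous_gradient (hφ1 k))
  have t1 : Tendsto (fun k => lnorm μ (φ k - v)) atTop (𝓝 0) := by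
    have h := (ENNReal.tendsto_toReal ENNReal.zero_ne_top).comp hφv
    rwa [ENNReal.toReal_zero] at h
  have t2 : Tendsto (fun k => lnorm μ (gradient (φ k) - weakGrad (elt b) v)) atTop (𝓝 0) := by
    have h := (ENNReal.tendsto_toReal ENNReal.zero_ne_top).comp hφg
    rwa [ENNReal.toReal_zero] at h
  let ψ : ℕ → E n → ℝ := fun k x => φ k x - f x
  have hψ : ∀ k, ContDiff ℝ ∞ (ψ k) := fun k => (hφ k).sub hf
  have hψg : ∀ k x, gradient (ψ k) x = gradient (φ k) x - gradient f x := by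
    intro k x
    refine ext_inner_left ℝ fun w => ?_
    rw [inner_sub_right]
    simp only [inner_gradient']
    have := ((hφ1 k).differentiable one_ne_zero x).hasFDerivAt.sub
      (hf1.differentiable one_ne_zero x).hasFDerivAt
    have e : ψ k = φ k - f := rfl
    rw [e, this.fderiv]; rfl
  have t3 : Tendsto (fun k => lnorm (surface (elt b)) (ψ k)) atTop (𝓝 0) := by
    have h := (ENNReal.tendsto_toReal ENNReal.zero_ne_top).comp hφu
    rw [ENNReal.toReal_zero] at h
    refine h.congr fun k => lnorm_congr (f := φ k - u) (g := ψ k) ?_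
    rw [surface]
    exact ae_restrict_of_forall_mem (isCompact_frontier_elt b).measurableSet fun x hx => by
      simp [ψ, hfu x hx]
  set M := lnorm μ v + 1 + lnorm μ f + (lnorm μ (weakGrad (elt b) v) + 1 + lnorm μ (gradient f))
    with hM
  have nn1 := lnorm_nonneg (μ := μ) v
  have nn2 := lnorm_nonneg (μ := μ) f
  have nn3 := lnorm_nonneg (μ := μ) (weakGrad (elt b) v)
  have nn4 := lnorm_nonneg (μ := μ) (gradient f)
  have b1 : ∀ᶠ k in atTop, lnorm μ (ψ k) ≤ M := by
    filter_upwards [t1.eventually (gt_mem_nhds one_pos)] with k hk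
    have h1 := lnorm_sub_le (hφL k) hfL
    have h2 := lnorm_add_le ((hφL k).sub hv.1) hv.1
    simp only [Pi.sub_apply, sub_add_cancel] at h2
    have h3 : lnorm μ (ψ k) ≤ lnorm μ (φ k) + lnorm μ f := h1
    have h4 : lnorm μ (φ k) ≤ lnorm μ (φ k - v) + lnorm μ v := h2
    linarith
  have b2 : ∀ᶠ k in atTop, lnorm μ (gradient (ψ k)) ≤ M := by
    filter_upwards [t2.eventually (gt_mem_nhds one_pos)] with k hk
    have h1 := lnorm_sub_le (hφG k) hfG
    have h2 := lnorm_add_le ((hφG k).sub hg) hg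
    simp only [Pi.sub_apply, sub_add_cancel] at h2
    have h3 : lnorm μ (gradient (ψ k)) ≤ lnorm μ (gradient (φ k)) + lnorm μ (gradient f) := by
      have e : gradient (ψ k) = fun x => gradient (φ k) x - gradient f x := funext (hψg k)
      rw [e]; exact h1
    have h4 : lnorm μ (gradient (φ k)) ≤ lnorm μ (gradient (φ k) - weakGrad (elt b) v) +
      lnorm μ (weakGrad (elt b) v) := h2
    linarith
  -- The differences `ψ k = φ k - f` are bounded in `H¹(T)` with boundary values tending to zero, so
  -- their Green functional tends to zero. By convergence of `φ k` in `H¹(T)` it also tends to the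
  -- difference of the two pairings.
  have key := tendsto_green_zero b hτ.1 hd hw hψ b1 b2 t3
  have hlim : Tendsto (fun k => (∫ x in elt b, d x * ψ k x) +
      ∫ x in elt b, inner ℝ (τ x) (gradient (ψ k) x)) atTop
      (𝓝 (pairing (elt b) τ v - pairing (elt b) τ f)) := by
    rw [tendsto_iff_norm_sub_tendsto_zero]
    have hz : Tendsto (fun k => lnorm μ d * lnorm μ (φ k - v) +
        lnorm μ τ * lnorm μ (gradient (φ k) - weakGrad (elt b) v)) atTop (𝓝 0) := by
      simpa using (t1.const_mul (lnorm μ d)).add (t2.const_mul (lnorm μ τ))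
    refine squeeze_zero (fun _ => norm_nonneg _) (fun k => ?_) hz
    have e1 : ∫ x in elt b, d x * ψ k x = (∫ x in elt b, d x * φ k x) - ∫ x in elt b, d x * f x := by
      rw [← integral_sub (integrable_mul hd (hφL k)) (integrable_mul hd hfL)]
      simp only [ψ, mul_sub]
    have e2 : ∫ x in elt b, inner ℝ (τ x) (gradient (ψ k) x) =
        (∫ x in elt b, inner ℝ (τ x) (gradient (φ k) x)) -
          ∫ x in elt b, inner ℝ (τ x) (gradient f x) := by
      rw [← integral_sub (integrable_inner hτ.1 (hφG k)) (integrable_inner hτ.1 hfG)]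
      simp only [hψg, inner_sub_right]
    have e3 : ∫ x in elt b, d x * (φ k - v) x =
        (∫ x in elt b, d x * φ k x) - ∫ x in elt b, d x * v x := by
      rw [← integral_sub (integrable_mul hd (hφL k)) (integrable_mul hd hv.1)]
      simp only [Pi.sub_apply, mul_sub]
    have e4 : ∫ x in elt b, inner ℝ (τ x) ((gradient (φ k) - weakGrad (elt b) v) x) =
        (∫ x in elt b, inner ℝ (τ x) (gradient (φ k) x)) -
          ∫ x in elt b, inner ℝ (τ x) (weakGrad (elt b) v x) := by
      rw [← integral_sub (integrable_inner hτ.1 (hφG k)) (integrable_inner hτ.1 hg)]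
      simp only [Pi.sub_apply, inner_sub_right]
    have e5 : ∫ x in elt b, inner ℝ (τ x) (weakGrad (elt b) f x) =
        ∫ x in elt b, inner ℝ (τ x) (gradient f x) := by
      refine integral_congr_ae ?_
      filter_upwards [weakGrad_of_contDiff (b := b) hf1] with x hx
      rw [hx]
    have e6 : ((∫ x in elt b, d x * ψ k x) + ∫ x in elt b, inner ℝ (τ x) (gradient (ψ k) x)) -
        (pairing (elt b) τ v - pairing (elt b) τ f) =
        (∫ x in elt b, d x * (φ k - v) x) +
          ∫ x in elt b, inner ℝ (τ x) ((gradient (φ k) - weakGrad (elt b) v) x) := by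
      rw [pairing, pairing, e1, e2, e3, e4, e5]
      ring
    rw [e6]
    refine (norm_add_le _ _).trans (add_le_add ?_ ?_)
    · exact abs_integral_mul_le hd ((hφL k).sub hv.1)
    · exact abs_integral_inner_le hτ.1 ((hφG k).sub hg)
  have := tendsto_nhds_unique hlim key
  linarith

omit [NeZero n] in
theorem hasTrace_of_contDiff {f u : E n → ℝ} (hf : ContDiff ℝ ∞ f)
    (hfu : ∀ x ∈ frontier (elt b), f x = u x) : HasTrace (elt b) f u := by
  have hf1 : ContDiff ℝ 1 f := hf.of_le (by exact_mod_cast le_top)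
  refine ⟨fun _ => f, fun _ => hf, ?_, ?_, ?_⟩
  · simp
  · have h : eLpNorm (gradient f - weakGrad (elt b) f) 2 (volume.restrict (elt b)) = 0 := by
      rw [eLpNorm_congr_ae (g := 0), eLpNorm_zero]
      filter_upwards [weakGrad_of_contDiff (b := b) hf1] with x hx
      simp [hx]
    simp [h]
  · have h : eLpNorm (f - u) 2 (surface (elt b)) = 0 := by
      rw [eLpNorm_congr_ae (g := 0), eLpNorm_zero]
      rw [surface]
      exact ae_restrict_of_forall_mem (isCompact_frontier_elt b).measurableSet fun x hx => by
        simp [hfu x hx]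
    simp [h]

/-- The pairing with a smooth function that vanishes on the boundary is zero. -/
theorem pairing_eq_zero {τ : E n → E n} (hτ : MemHdiv (elt b) τ) {v : E n → ℝ}
    (hv : ContDiff ℝ ∞ v) (h0 : ∀ x ∈ frontier (elt b), v x = 0) : pairing (elt b) τ v = 0 := by
  rw [pairing_eq_of_hasTrace b hτ (memH1_of_contDiff (hv.of_le (by exact_mod_cast le_top)))
    (hasTrace_of_contDiff b hv (u := 0) h0) (contDiff_const (c := (0 : ℝ))) (fun _ _ => rfl)]
  have h1 := weakGrad_of_contDiff (b := b) (contDiff_const (c := (0 : ℝ)))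
  have h2 : ∫ x in elt b, inner ℝ (τ x) (weakGrad (elt b) (fun _ => (0 : ℝ)) x) = 0 := by
    rw [integral_congr_ae (g := fun _ => (0 : ℝ)), integral_zero]
    filter_upwards [h1] with x hx
    rw [hx]; simp [gradient]
  simp [pairing, h2]

end traceZero

/-! ### Weighted inner products and dual bases -/

section forms

/-- The bilinear form `∫ v w ρ dμ` on a space of functions. -/
def prodForm (μ : Measure (E n)) (ρ : E n → ℝ) (V : Submodule ℝ (E n → ℝ))
    (hV : ∀ v ∈ V, ∀ w ∈ V, Integrable (fun x => v x * (w x * ρ x)) μ) :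
    LinearMap.BilinForm ℝ V :=
  LinearMap.mk₂ ℝ (fun v w => ∫ x, (v : E n → ℝ) x * ((w : E n → ℝ) x * ρ x) ∂μ)
    (fun v v' w => by
      rw [← integral_add (hV v v.2 w w.2) (hV v' v'.2 w w.2)]
      simp [add_mul])
    (fun c v w => by
      rw [smul_eq_mul, ← integral_const_mul]
      simp [mul_assoc])
    (fun v w w' => by
      rw [← integral_add (hV v v.2 w w.2) (hV v v.2 w' w'.2)]
      simp [add_mul, mul_add])
    (fun c v w => by
      rw [smul_eq_mul, ← integral_const_mul]
      congr 1; ext x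
      simp only [Submodule.coe_smul, Pi.smul_apply, smul_eq_mul]
      ring)

theorem prodForm_apply {μ : Measure (E n)} {ρ : E n → ℝ} {V : Submodule ℝ (E n → ℝ)}
    {hV : ∀ v ∈ V, ∀ w ∈ V, Integrable (fun x => v x * (w x * ρ x)) μ} (v w : V) :
    prodForm μ ρ V hV v w = ∫ x, (v : E n → ℝ) x * ((w : E n → ℝ) x * ρ x) ∂μ := rfl

theorem isBasisOf_coe {ι : Type*} {V : Submodule ℝ (E n → ℝ)} (g : Module.Basis ι ℝ V) :
    IsBasisOf (fun j => (g j : E n → ℝ)) V := by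
  refine ⟨g.linearIndependent.map' V.subtype V.ker_subtype, ?_⟩
  have h : Set.range (fun j => (g j : E n → ℝ)) = V.subtype '' Set.range g := by
    rw [← Set.range_comp]; rfl
  rw [h, Submodule.span_image, g.span_eq, Submodule.map_top, Submodule.range_subtype]

theorem exists_isBasisOf (V : Submodule ℝ (E n → ℝ)) [FiniteDimensional ℝ V] :
    ∃ f : Fin (Module.finrank ℝ V) → E n → ℝ, IsBasisOf f V :=
  ⟨_, isBasisOf_coe (Module.finBasis ℝ V)⟩

theorem integrable_mul_elt (b : Simplex n) {v w : E n → ℝ} (hv : Continuous v)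
    (hw : Continuous w) : Integrable (fun x => v x * w x) (volume.restrict (elt b)) :=
  integrable_of_continuous b (hv.mul hw)

/-- Dual bases with respect to a definite weighted inner product. -/
theorem IsBasisOf.exists_dual {K : ℕ} {V : Submodule ℝ (E n → ℝ)} {f : Fin K → E n → ℝ}
    (hf : IsBasisOf f V) {μ : Measure (E n)} {ρ : E n → ℝ}
    (hV : ∀ v ∈ V, ∀ w ∈ V, Integrable (fun x => v x * (w x * ρ x)) μ)
    (hdef : ∀ v ∈ V, ∫ x, v x * (v x * ρ x) ∂μ = 0 → v = 0) {c : ℝ} (hc : c ≠ 0) :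
    ∃ g : Fin K → E n → ℝ, IsBasisOf g V ∧
      ∀ j k, ∫ x, g j x * (f k x * ρ x) ∂μ = if j = k then c else 0 := by
  obtain ⟨hli, rfl⟩ := hf
  let B := Module.Basis.span hli
  have hB : ∀ j, (B j : E n → ℝ) = f j := fun j => congrArg Subtype.val (Module.Basis.span_apply hli j)
  let A := prodForm μ ρ _ hV
  have hA : A.Nondegenerate := by
    constructor
    · intro v hv
      exact Subtype.ext (hdef v v.2 (hv v))
    · intro v hv
      exact Subtype.ext (hdef v v.2 (hv v))
  let G := (A.dualBasis hA B).isUnitSMul (w := fun _ => c) fun _ => hc.isUnit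
  refine ⟨fun j => G j, isBasisOf_coe G, fun j k => ?_⟩
  have h1 : A (G j) (B k) = if j = k then c else 0 := by
    rw [Module.Basis.isUnitSMul_apply, map_smul, LinearMap.smul_apply,
      LinearMap.BilinForm.apply_dualBasis_left]
    simp [eq_comm]
  rw [prodForm_apply] at h1
  rw [← h1]
  simp only [hB]

end forms

/-! ### Existence of the primal and dual bases; frames of tangents and gradients -/

section bases

variable [NeZero n] (b : Simplex n) (p : ℕ)

instance finiteDimensional_tildeSpace {n : ℕ} (b : Simplex n) (q : ℕ) :
    FiniteDimensional ℝ (tildeSpace b q) :=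
  Submodule.finiteDimensional_of_le (S₂ := polySpace n q) fun _ hv => hv.1

instance finiteDimensional_bubbleSpace {n : ℕ} (b : Simplex n) (q : ℕ) :
    FiniteDimensional ℝ (bubbleSpace b q) :=
  Submodule.finiteDimensional_of_le (S₂ := polySpace n q) fun _ hv => hv.1

theorem exists_primalBases {n : ℕ} (b : Simplex n) (p : ℕ) : Nonempty (PrimalBases b p) := by
  obtain ⟨f, hf⟩ := exists_isBasisOf (tildeSpace b (p + 1))
  obtain ⟨g, hg⟩ := exists_isBasisOf (polySpace n p)
  exact ⟨⟨_, _, f, g, hf, hg⟩⟩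

/-- Functions of `P̃^q(T)` are determined by their boundary values. -/
theorem tildeSpace_eq_zero {q : ℕ} {v : E n → ℝ} (hv : v ∈ tildeSpace b q)
    (h : ∫ x, v x ^ 2 ∂(surface (elt b)) = 0) : v = 0 := by
  have hb : v ∈ bubbleSpace b q := ⟨hv.1, eq_zero_on_frontier b (continuous_of_mem hv.1) h⟩
  have h2 := hv.2 v hb
  refine eq_zero_of_integral_mul_sq (b := b) (ρ := fun _ => 1) hv.1 continuous_const
    (fun _ _ => one_pos) ?_
  simpa [sq] using h2

/-- Here `w` is the `L²(T)`-projection of `v` onto the bubbles, written with a basis of the bubble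
space and its `L²(T)`-dual basis. Boundary moments thereby need checking on `P̃^q(T)` only. -/
theorem exists_tildeSpace_add_bubbleSpace {n : ℕ} (b : Simplex n) {q : ℕ} {v : E n → ℝ}
    (hv : v ∈ polySpace n q) :
    ∃ w ∈ bubbleSpace b q, (fun x => v x - w x) ∈ tildeSpace b q := by
  obtain ⟨f, hf⟩ := exists_isBasisOf (bubbleSpace b q)
  have hcont : ∀ w ∈ bubbleSpace b q, Continuous w := fun w hw => continuous_of_mem hw.1
  obtain ⟨g, hg, hgf⟩ := hf.exists_dual (μ := volume.restrict (elt b)) (ρ := fun _ => 1)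
    (fun v hv w hw => integrable_of_continuous b
      ((hcont v hv).mul ((hcont w hw).mul continuous_const)))
    (fun v hv h => eq_zero_of_integral_mul_sq (b := b) (ρ := fun _ => 1) hv.1 continuous_const
      (fun _ _ => one_pos) (by simpa [sq] using h)) one_ne_zero
  have hgm : ∀ j, g j ∈ bubbleSpace b q := fun j => hg.2 ▸ Submodule.subset_span ⟨j, rfl⟩
  have hfm : ∀ j, f j ∈ bubbleSpace b q := fun j => hf.2 ▸ Submodule.subset_span ⟨j, rfl⟩
  have hcv := continuous_of_mem hv
  set w : E n → ℝ := ∑ j, (∫ x in elt b, v x * f j x) • g j with hw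
  have hwm : w ∈ bubbleSpace b q := Submodule.sum_mem _ fun j _ => Submodule.smul_mem _ _ (hgm j)
  refine ⟨w, hwm, (polySpace n q).sub_mem hv hwm.1, fun u hu => ?_⟩
  have hcw := hcont w hwm
  rw [← hf.2] at hu
  induction hu using Submodule.span_induction with
  | mem u hu =>
    obtain ⟨k, rfl⟩ := hu
    have hcf := hcont _ (hfm k)
    simp only [sub_mul]
    rw [integral_sub (integrable_mul_elt b hcv hcf) (integrable_mul_elt b hcw hcf), sub_eq_zero]
    have h1 : ∀ x, w x * f k x = ∑ j, (∫ y in elt b, v y * f j y) * (g j x * (f k x * 1)) := by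
      intro x
      rw [hw, Finset.sum_apply, Finset.sum_mul]
      exact Finset.sum_congr rfl fun j _ => by simp [mul_assoc]
    simp only [h1]
    rw [integral_finsetSum _ fun j _ => (integrable_mul_elt b (hcont _ (hgm j))
      (show Continuous fun x => f k x * 1 from hcf.mul continuous_const)).const_mul _]
    simp only [integral_const_mul, hgf]
    simp
  | zero => simp
  | add u u' hu hu' h h' =>
    rw [hf.2] at hu hu'
    have hcvw : Continuous fun x => v x - w x := hcv.sub hcw
    have i1 := integrable_mul_elt b hcvw (hcont u hu)
    have i2 := integrable_mul_elt b hcvw (hcont u' hu')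
    simp only [Pi.add_apply, mul_add]
    rw [integral_add i1 i2, h, h', add_zero]
  | smul c u hu h =>
    simp only [Pi.smul_apply, smul_eq_mul, mul_left_comm _ c]
    rw [integral_const_mul, h, mul_zero]

theorem edgeFun_pos {n : ℕ} {b : Simplex n} {z : Fin (n + 1)} (e : Edge z) {x : E n}
    (hx : x ∈ elt b) : 0 < edgeFun b z e x :=
  mul_pos (mem_elt.1 hx z) (mem_elt.1 hx e.1)

theorem contDiff_edgeFun {n : ℕ} (b : Simplex n) (z : Fin (n + 1)) (e : Edge z)
    {k : WithTop ℕ∞} : ContDiff ℝ k (edgeFun b z e) :=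
  (contDiff_coord b z).mul (contDiff_coord b e.1)

theorem inner_baryGrad_tangent {n : ℕ} (b : Simplex n) {z : Fin (n + 1)} (e e' : Edge z) :
    inner ℝ (baryGrad b e.1) (tangent b z e') = if e = e' then (1 : ℝ) else 0 := by
  rw [tangent, coord_sub, b.coord_apply, b.coord_apply_ne e.2, sub_zero]
  simp [Subtype.ext_iff]

/-- The surface product is definite on `P̃^{p+1}(T)`, the product weighted by `η_E` is definite on
`P^p(T)`, and the gradients `∇η_{z'}` are dual to the tangents at `z_*`. -/
theorem exists_dualBases {p : ℕ} (B : PrimalBases b p) (z : Fin (n + 1)) :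
    Nonempty (DualBases B z) := by
  obtain ⟨nu, hnu, hnud⟩ := B.nuT_basis.exists_dual (μ := surface (elt b)) (ρ := fun _ => 1)
    (fun v hv w hw => integrable_surface b
      ((continuous_of_mem hv.1).mul ((continuous_of_mem hw.1).mul continuous_const)))
    (fun v hv h => tildeSpace_eq_zero b hv (by simpa [sq] using h)) (bdryArea_pos b).ne'
  have hchi : ∀ e : Edge z, ∃ g : Fin B.K → E n → ℝ, IsBasisOf g (polySpace n p) ∧
      ∀ j k, ∫ x in elt b, g j x * (B.chiT k x * edgeFun b z e x) =
        if j = k then vol b else 0 := fun e =>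
    B.chiT_basis.exists_dual (fun v hv w hw => integrable_of_continuous b
      ((continuous_of_mem hv).mul ((continuous_of_mem hw).mul
        (contDiff_edgeFun b z e (k := 1)).continuous)))
      (fun v hv h => eq_zero_of_integral_mul_sq (b := b) (ρ := edgeFun b z e) hv
        (contDiff_edgeFun b z e (k := 1)).continuous (fun x hx => edgeFun_pos e hx) (by
          rw [← h]; congr 1; ext x; ring)) (vol_pos b).ne'
  choose chi hchi1 hchi2 using hchi
  exact ⟨⟨nu, fun e => baryGrad b e.1, chi, hnu, fun j k => by simpa using hnud j k,
    inner_baryGrad_tangent b, hchi1, hchi2⟩⟩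

/-- The numbers `⟨∇η_i, v⟩ = η_i(v) - η_i(0)` sum to zero, so `v = ∑ ⟨∇η_i, v⟩ b i` does not change
when `b z` is subtracted from every vertex; the term of `z` itself then disappears. -/
theorem sum_inner_baryGrad_smul {n : ℕ} (b : Simplex n) (z : Fin (n + 1)) (v : E n) :
    ∑ e : Edge z, inner ℝ (baryGrad b e.1) v • tangent b z e = v := by
  have h1 := b.linear_combination_coord_eq_self v
  have h2 := b.linear_combination_coord_eq_self 0
  have h3 : ∑ i, inner ℝ (baryGrad b i) v • (b i - b z) = v := by
    have h4 : ∀ i, inner ℝ (baryGrad b i) v = b.coord i v - b.coord i 0 := fun i => by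
      rw [← coord_sub, sub_zero]
    simp only [h4, smul_sub, sub_smul, Finset.sum_sub_distrib, h1, h2, ← Finset.sum_smul, sum_coord]
    simp
  rw [← h3, h3]
  conv_rhs => rw [← h3]
  have h5 := Fintype.sum_subtype_add_sum_subtype (fun i => i ≠ z)
    (fun i => inner ℝ (baryGrad b i) v • (b i - b z))
  rw [← h5]
  have h6 : ∑ i : {i // ¬ i ≠ z}, inner ℝ (baryGrad b i.1) v • (b i.1 - b z) = 0 :=
    Finset.sum_eq_zero fun i _ => by rw [not_not.1 i.2]; simp
  rw [h6, add_zero]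
  rfl

theorem eq_of_inner_tangent {n : ℕ} (b : Simplex n) (z : Fin (n + 1)) {v w : E n}
    (h : ∀ e : Edge z, inner ℝ v (tangent b z e) = inner ℝ w (tangent b z e)) : v = w := by
  refine ext_inner_right ℝ fun u => ?_
  rw [← sum_inner_baryGrad_smul b z u, inner_sum, inner_sum]
  exact Finset.sum_congr rfl fun e _ => by rw [inner_smul_right, inner_smul_right, h e]

/-- The tangents at one vertex span, so the dual vectors are unique. Whatever the choice of dual
bases, `σ_E` is a barycentric gradient and inherits its bounds. -/
theorem DualBases.sigma_eq {n : ℕ} {b : Simplex n} {p : ℕ} {B : PrimalBases b p}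
    {z : Fin (n + 1)} (D : DualBases B z) (e : Edge z) : D.sigma e = baryGrad b e.1 :=
  eq_of_inner_tangent b z fun e' => by rw [D.sigma_dual, inner_baryGrad_tangent]

theorem sum_inner_tangent_smul {n : ℕ} (b : Simplex n) (z : Fin (n + 1)) (v : E n) :
    ∑ e : Edge z, inner ℝ v (tangent b z e) • baryGrad b e.1 = v :=
  eq_of_inner_tangent b z fun e' => by
    rw [sum_inner]
    simp [inner_smul_left, inner_baryGrad_tangent]

end bases

/-! ### Polynomial vector fields -/

section vecPoly

variable {q r : ℕ}

theorem contDiff_of_mem_vecPoly {σ : E n → E n} (h : σ ∈ vecPoly n q) {k : WithTop ℕ∞} :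
    ContDiff ℝ k σ :=
  contDiff_euclidean.2 fun i => contDiff_of_mem (h i)

theorem smul_mem_vecPoly {v : E n → ℝ} {σ : E n → E n} (hv : v ∈ polySpace n q)
    (hσ : σ ∈ vecPoly n r) : (fun x => v x • σ x) ∈ vecPoly n (q + r) :=
  fun i => mul_mem_polySpace hv (hσ i)

theorem const_mem_vecPoly (t : E n) : (fun _ => t) ∈ vecPoly n q :=
  fun i => const_mem_polySpace (t i)

theorem sub_const_mem_vecPoly (p : E n) : (fun x => x - p) ∈ vecPoly n 1 :=
  fun i => (polySpace n 1).sub_mem (apply_mem_polySpace i) (const_mem_polySpace (p i))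

theorem cdiv_mem_polySpace {σ : E n → E n} (hσ : σ ∈ vecPoly n q) :
    cdiv σ ∈ polySpace n (q - 1) := by
  have : cdiv σ = ∑ k, fun x => fderiv ℝ (fun y => σ y k) x (EuclideanSpace.single k 1) := by
    ext x; simp [cdiv]
  rw [this]
  exact Submodule.sum_mem _ fun k _ => fderiv_mem_polySpace (hσ k) _

theorem gradient_apply (f : E n → ℝ) (x : E n) (k : Fin n) :
    gradient f x k = fderiv ℝ f x (EuclideanSpace.single k 1) := by
  rw [← inner_gradient, EuclideanSpace.inner_single_right]
  simp

theorem gradient_mem_vecPoly {v : E n → ℝ} (hv : v ∈ polySpace n q) :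
    gradient v ∈ vecPoly n (q - 1) := fun k => by
  simp only [gradient_apply]
  exact fderiv_mem_polySpace hv _

theorem inner_const_mem_polySpace {σ : E n → E n} (hσ : σ ∈ vecPoly n q) (t : E n) :
    (fun x => inner ℝ (σ x) t) ∈ polySpace n q := by
  have : (fun x => inner ℝ (σ x) t) = ∑ k, t k • fun x => σ x k := by
    ext x; simp [PiLp.inner_apply]
  rw [this]
  exact Submodule.sum_mem _ fun k _ => Submodule.smul_mem _ _ (hσ k)

end vecPoly

/-! ### The normal trace pairing for smooth functions -/

section pairing

variable [NeZero n] (b : Simplex n)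

theorem pairing_of_contDiff {n : ℕ} (b : Simplex n) (τ : E n → E n) {v : E n → ℝ}
    (hv : ContDiff ℝ 1 v) :
    pairing (elt b) τ v = (∫ x in elt b, weakDiv (elt b) τ x * v x) +
      ∫ x in elt b, inner ℝ (τ x) (gradient v x) := by
  rw [pairing]
  congr 1
  refine integral_congr_ae ?_
  filter_upwards [weakGrad_of_contDiff (b := b) hv] with x hx
  rw [hx]

theorem pairing_add {n : ℕ} (b : Simplex n) {τ : E n → E n} (hτ : MemHdiv (elt b) τ)
    {v w : E n → ℝ} (hv : ContDiff ℝ 1 v) (hw : ContDiff ℝ 1 w) :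
    pairing (elt b) τ (fun x => v x + w x) = pairing (elt b) τ v + pairing (elt b) τ w := by
  have hd := hτ.weakDiv_spec.1
  rw [pairing_of_contDiff b τ hv, pairing_of_contDiff b τ hw, pairing_of_contDiff b τ (hv.add hw)]
  have h1 : ∀ x, gradient (fun x => v x + w x) x = gradient v x + gradient w x := fun x => by
    refine ext_inner_left ℝ fun u => ?_
    have := ((hv.differentiable one_ne_zero x).hasFDerivAt.add
      (hw.differentiable one_ne_zero x).hasFDerivAt).fderiv
    have e : (fun x => v x + w x) = v + w := rfl
    rw [inner_add_right, inner_gradient', inner_gradient', inner_gradient', e, this]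
    rfl
  simp only [h1, inner_add_right, mul_add]
  rw [integral_add (integrable_mul hd (memLp_elt b hv.continuous))
    (integrable_mul hd (memLp_elt b hw.continuous)),
    integral_add (integrable_inner hτ.1 (memLp_elt b (continuous_gradient hv)))
    (integrable_inner hτ.1 (memLp_elt b (continuous_gradient hw)))]
  ring

theorem pairing_smul {n : ℕ} (b : Simplex n) (τ : E n → E n) (c : ℝ)
    {v : E n → ℝ} (hv : ContDiff ℝ 1 v) :
    pairing (elt b) τ (fun x => c * v x) = c * pairing (elt b) τ v := by
  rw [pairing_of_contDiff b τ hv, pairing_of_contDiff b τ (contDiff_const.mul hv)]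
  have h1 : ∀ x, gradient (fun x => c * v x) x = c • gradient v x := fun x => by
    refine ext_inner_left ℝ fun u => ?_
    rw [inner_smul_right, inner_gradient', inner_gradient',
      fderiv_const_mul (hv.differentiable one_ne_zero x)]
    rfl
  simp only [h1, inner_smul_right, mul_left_comm _ c]
  rw [integral_const_mul, integral_const_mul, mul_add]

theorem pairing_sub {n : ℕ} (b : Simplex n) {τ τ' : E n → E n} (hτ : MemHdiv (elt b) τ)
    (hτ' : MemHdiv (elt b) τ') {v : E n → ℝ} (hv : ContDiff ℝ 1 v) :
    pairing (elt b) (τ - τ') v = pairing (elt b) τ v - pairing (elt b) τ' v := by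
  have hv1 := memLp_elt b hv.continuous
  have hv2 := memLp_elt b (continuous_gradient hv)
  rw [pairing_of_contDiff b _ hv, pairing_of_contDiff b _ hv, pairing_of_contDiff b _ hv]
  have h1 : ∫ x in elt b, weakDiv (elt b) (τ - τ') x * v x =
      ∫ x in elt b, (weakDiv (elt b) τ x * v x - weakDiv (elt b) τ' x * v x) := by
    refine integral_congr_ae ?_
    filter_upwards [weakDiv_sub hτ hτ'] with x hx
    rw [hx, Pi.sub_apply, sub_mul]
  rw [h1, integral_sub (integrable_mul hτ.weakDiv_spec.1 hv1)
    (integrable_mul hτ'.weakDiv_spec.1 hv1)]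
  simp only [Pi.sub_apply, inner_sub_left]
  rw [integral_sub (integrable_inner hτ.1 hv2) (integrable_inner hτ'.1 hv2)]
  ring

theorem pairing_smooth {n : ℕ} (b : Simplex n) {τ : E n → E n} (hτ : ContDiff ℝ 1 τ)
    {v : E n → ℝ} (hv : ContDiff ℝ 1 v) :
    pairing (elt b) τ v = ∫ x in elt b, (cdiv τ x * v x + fderiv ℝ v x (τ x)) := by
  have hcv := hv.continuous_fderiv one_ne_zero
  have hcτ := hτ.continuous
  rw [pairing_of_contDiff b _ hv, integral_add (integrable_mul_elt b (continuous_cdiv hτ)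
    hv.continuous) (integrable_of_continuous b (by fun_prop))]
  congr 1
  · refine integral_congr_ae ?_
    filter_upwards [weakDiv_of_contDiff (b := b) hτ] with x hx
    rw [hx]
  · simp only [inner_gradient']

theorem smul_psiBdry (w : E n → ℝ) :
    (fun x => w x • psiBdry b x) = fun x => ∑ i, ‖baryGrad b i‖ • (w x • (x - b i)) := by
  ext1 x
  simp only [psiBdry, psiFace_eq, Finset.smul_sum, smul_comm (w x)]

theorem fderiv_mul_apply {n : ℕ} {v w : E n → ℝ} (hv : ContDiff ℝ 1 v) (hw : ContDiff ℝ 1 w) (x t : E n) :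
    fderiv ℝ (fun x => w x * v x) x t = w x * fderiv ℝ v x t + v x * fderiv ℝ w x t := by
  have := ((hw.differentiable one_ne_zero x).hasFDerivAt.mul
    (hv.differentiable one_ne_zero x).hasFDerivAt).fderiv
  have e : (fun x => w x * v x) = w * v := rfl
  rw [e, this]
  rfl

/-- The normal trace of `w ψ_{∂T}` is `w`. -/
theorem pairing_smul_psiBdry {w v : E n → ℝ} (hw : ContDiff ℝ 1 w) (hv : ContDiff ℝ 1 v) :
    pairing (elt b) (fun x => w x • psiBdry b x) v = ∫ x, w x * v x ∂(surface (elt b)) := by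
  have hτ : ∀ i, ContDiff ℝ 1 fun x => w x • (x - b i) := fun i =>
    hw.smul (contDiff_id.sub contDiff_const)
  have hs : ContDiff ℝ 1 (fun x => ∑ i, ‖baryGrad b i‖ • (w x • (x - b i))) :=
    ContDiff.sum fun i _ => (hτ i).const_smul ‖baryGrad b i‖
  have hwv : ContDiff ℝ 1 fun x => w x * v x := hw.mul hv
  have hcwv := hwv.continuous_fderiv one_ne_zero
  have hcw := hw.continuous
  have hcv := hv.continuous
  rw [smul_psiBdry, pairing_smooth b hs hv, integral_surface_eq b hwv]
  -- The product rule turns the integrand into `div (w v ψ_{∂T})`, which is the volume form of the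
  -- surface integral of `w v`.
  have h1 : ∀ x, cdiv (fun x => ∑ i, ‖baryGrad b i‖ • (w x • (x - b i))) x * v x +
      fderiv ℝ v x (∑ i, ‖baryGrad b i‖ • (w x • (x - b i))) =
      ∑ i, ‖baryGrad b i‖ * (n * (w x * v x) + fderiv ℝ (fun x => w x * v x) x (x - b i)) := by
    intro x
    rw [cdiv_sum _ _ hτ, Finset.sum_mul, map_sum, ← Finset.sum_add_distrib]
    refine Finset.sum_congr rfl fun i _ => ?_
    rw [cdiv_smul_sub hw, fderiv_mul_apply hv hw, map_smul, map_smul]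
    simp only [smul_eq_mul]
    ring
  simp only [h1]
  rw [integral_finsetSum _ fun i _ => Integrable.const_mul
    (integrable_of_continuous b (by fun_prop)) _]
  simp only [integral_const_mul]

/-- The normal trace of the fields `η_E w t_E` vanishes. -/
theorem pairing_edge (z : Fin (n + 1)) (e : Edge z) {w v : E n → ℝ} (hw : ContDiff ℝ 1 w)
    (hv : ContDiff ℝ 1 v) :
    pairing (elt b) (fun x => (edgeFun b z e x * w x) • tangent b z e) v = 0 := by
  have hf : ContDiff ℝ 1 fun x => edgeFun b z e x * w x := (contDiff_edgeFun b z e).mul hw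
  have hF : ContDiff ℝ 1 fun x => (edgeFun b z e x * w x) * v x := hf.mul hv
  have hcF := hF.continuous
  have hcF' := hF.continuous_fderiv one_ne_zero
  have hs : ContDiff ℝ 1 fun x => (edgeFun b z e x * w x) • tangent b z e := hf.smul contDiff_const
  rw [pairing_smooth b hs hv]
  -- Writing `t_E = (x - z_*) - (x - z')` makes the integrand a difference of two cone divergences.
  -- These integrate to the faces opposite to `z_*` and `z'`, where `η_E` is zero.
  have h1 : ∀ x, cdiv (fun x => (edgeFun b z e x * w x) • tangent b z e) x * v x +
      fderiv ℝ v x ((edgeFun b z e x * w x) • tangent b z e) =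
      (n * ((edgeFun b z e x * w x) * v x) +
        fderiv ℝ (fun x => (edgeFun b z e x * w x) * v x) x (x - b z)) -
      (n * ((edgeFun b z e x * w x) * v x) +
        fderiv ℝ (fun x => (edgeFun b z e x * w x) * v x) x (x - b e.1)) := by
    intro x
    have h2 : fderiv ℝ (fun x => (edgeFun b z e x * w x) * v x) x (x - b z) -
        fderiv ℝ (fun x => (edgeFun b z e x * w x) * v x) x (x - b e.1) =
        fderiv ℝ (fun x => (edgeFun b z e x * w x) * v x) x (tangent b z e) := by
      rw [← map_sub]; congr 1; rw [tangent]; abel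
    rw [cdiv_smul_const hf, map_smul, add_sub_add_left_eq_sub, h2, fderiv_mul_apply hv hf,
      smul_eq_mul]
    ring
  simp only [h1]
  rw [integral_sub (integrable_of_continuous b (by fun_prop))
    (integrable_of_continuous b (by fun_prop)), integral_div_cone b z hF,
    integral_div_cone b e.1 hF]
  have h3 : ∀ i, (∀ x ∈ face b i, edgeFun b z e x = 0) → ∫ x in face b i,
      (edgeFun b z e x * w x) * v x ∂(Measure.euclideanHausdorffMeasure (n - 1)) = 0 := by
    intro i hi
    rw [setIntegral_congr_fun (g := fun _ => (0 : ℝ)) (isCompact_face b i).measurableSet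
      fun x hx => by simp [hi x hx]]
    simp
  rw [h3 z fun x hx => by simp [edgeFun, (mem_face.1 hx).2],
    h3 e.1 fun x hx => by simp [edgeFun, (mem_face.1 hx).2]]
  simp

end pairing

/-! ### Algebraic properties of the operators -/

section algebraic

variable [NeZero n] {b : Simplex n} {p : ℕ} {B : PrimalBases b p} {z : Fin (n + 1)}

theorem PrimalBases.nuT_mem {n : ℕ} {b : Simplex n} {p : ℕ} (B : PrimalBases b p) (j : Fin B.J) :
    B.nuT j ∈ tildeSpace b (p + 1) := B.nuT_basis.2 ▸ Submodule.subset_span ⟨j, rfl⟩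

theorem PrimalBases.chiT_mem {n : ℕ} {b : Simplex n} {p : ℕ} (B : PrimalBases b p) (j : Fin B.K) :
    B.chiT j ∈ polySpace n p := B.chiT_basis.2 ▸ Submodule.subset_span ⟨j, rfl⟩

theorem DualBases.nu_mem {n : ℕ} {b : Simplex n} {p : ℕ} {B : PrimalBases b p} {z : Fin (n + 1)}
    (D : DualBases B z) (j : Fin B.J) :
    D.nu j ∈ tildeSpace b (p + 1) := D.nu_basis.2 ▸ Submodule.subset_span ⟨j, rfl⟩

theorem DualBases.chi_mem {n : ℕ} {b : Simplex n} {p : ℕ} {B : PrimalBases b p} {z : Fin (n + 1)}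
    (D : DualBases B z) (e : Edge z) (j : Fin B.K) :
    D.chi e j ∈ polySpace n p := (D.chi_basis e).2 ▸ Submodule.subset_span ⟨j, rfl⟩

theorem PrimalBases.psi_mem (B : PrimalBases b p) (j : Fin B.J) : B.psi j ∈ vecPoly n (p + 2) := by
  have h : B.psi j = fun x => B.nuT j x • psiBdry b x := rfl
  rw [h, smul_psiBdry]
  have h2 : (fun x => ∑ i, ‖baryGrad b i‖ • (B.nuT j x • (x - b i))) =
      ∑ i, ‖baryGrad b i‖ • fun x => B.nuT j x • (x - b i) := by
    ext1 x; simp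
  rw [h2]
  exact Submodule.sum_mem _ fun i _ => Submodule.smul_mem _ _
    (smul_mem_vecPoly (q := p + 1) (r := 1) (B.nuT_mem j).1 (sub_const_mem_vecPoly _))

theorem edgeFun_mem {n : ℕ} (b : Simplex n) (z : Fin (n + 1)) (e : Edge z) :
    edgeFun b z e ∈ polySpace n 2 := by
  have h : (fun x => b.coord z x * b.coord e.1 x) ∈ polySpace n (1 + 1) :=
    mul_mem_polySpace (affine_mem_polySpace (b.coord z)) (affine_mem_polySpace (b.coord e.1))
  exact h

theorem PrimalBases.eta_mem {n : ℕ} {b : Simplex n} {p : ℕ} (B : PrimalBases b p) (z : Fin (n + 1))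
    (e : Edge z) (j : Fin B.K) : B.eta z e j ∈ vecPoly n (p + 2) := by
  have h := smul_mem_vecPoly (mul_mem_polySpace (edgeFun_mem b z e) (B.chiT_mem j))
    (const_mem_vecPoly (q := 0) (tangent b z e))
  rw [add_zero, add_comm] at h
  exact h

theorem PrimalBases.V_le (B : PrimalBases b p) (z : Fin (n + 1)) : B.V z ≤ vecPoly n (p + 2) := by
  refine sup_le (Submodule.span_le.2 ?_) (Submodule.span_le.2 ?_)
  · rintro _ ⟨j, rfl⟩; exact B.psi_mem j
  · rintro _ ⟨⟨e, j⟩, rfl⟩; exact B.eta_mem z e j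

/-- The boundary values `w ∈ P̃^{p+1}(T)` of the normal component of `Π̃ τ`. -/
def DualBases.bdryPart {n : ℕ} {b : Simplex n} {p : ℕ} {B : PrimalBases b p} {z : Fin (n + 1)}
    (D : DualBases B z) (τ : E n → E n) (x : E n) : ℝ :=
  ∑ j, (pairing (elt b) τ (D.nu j) / bdryArea b) * B.nuT j x

theorem DualBases.bdryPart_mem {n : ℕ} {b : Simplex n} {p : ℕ} {B : PrimalBases b p}
    {z : Fin (n + 1)} (D : DualBases B z) (τ : E n → E n) :
    D.bdryPart τ ∈ tildeSpace b (p + 1) := by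
  have : D.bdryPart τ = ∑ j, (pairing (elt b) τ (D.nu j) / bdryArea b) • B.nuT j := by
    ext x; simp [DualBases.bdryPart]
  rw [this]
  exact Submodule.sum_mem _ fun j _ => Submodule.smul_mem _ _ (B.nuT_mem j)

theorem PrimalBases.pairing_psi (B : PrimalBases b p) (j : Fin B.J) {v : E n → ℝ}
    (hv : ContDiff ℝ 1 v) :
    pairing (elt b) (B.psi j) v = ∫ x, B.nuT j x * v x ∂(surface (elt b)) :=
  pairing_smul_psiBdry b (contDiff_of_mem (B.nuT_mem j).1) hv

/-- By duality every denominator `⟨ψ_{∂T,j}·n, ν_j⟩` equals `|∂T|`, so the boundary part is one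
scalar polynomial times `ψ_{∂T}`. -/
theorem DualBases.fortinTilde_eq (D : DualBases B z) (τ : E n → E n) :
    D.fortinTilde τ = fun x => D.bdryPart τ x • psiBdry b x := by
  ext1 x
  rw [DualBases.fortinTilde, DualBases.bdryPart, Finset.sum_smul]
  refine Finset.sum_congr rfl fun j _ => ?_
  have h := D.nu_dual j j
  rw [if_pos rfl] at h
  rw [B.pairing_psi j (contDiff_of_mem (D.nu_mem j).1)]
  simp only [mul_comm (B.nuT j _)]
  rw [h, PrimalBases.psi, smul_smul]

theorem DualBases.fortinTilde_mem {n : ℕ} {b : Simplex n} {p : ℕ} {B : PrimalBases b p}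
    {z : Fin (n + 1)} (D : DualBases B z) (τ : E n → E n) :
    D.fortinTilde τ ∈ Submodule.span ℝ (Set.range B.psi) := by
  have : D.fortinTilde τ = ∑ j, (pairing (elt b) τ (D.nu j) /
      pairing (elt b) (B.psi j) (D.nu j)) • B.psi j := by
    ext1 x; simp [DualBases.fortinTilde]
  rw [this]
  exact Submodule.sum_mem _ fun j _ => Submodule.smul_mem _ _ (Submodule.subset_span ⟨j, rfl⟩)

theorem DualBases.fortinTilde_mem_V {n : ℕ} {b : Simplex n} {p : ℕ} {B : PrimalBases b p}
    {z : Fin (n + 1)} (D : DualBases B z) (τ : E n → E n) :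
    D.fortinTilde τ ∈ B.V z := Submodule.mem_sup_left (D.fortinTilde_mem τ)

theorem memHdiv_of_mem_V {σ : E n → E n} (h : σ ∈ B.V z) : MemHdiv (elt b) σ :=
  memHdiv_of_contDiff (contDiff_of_mem_vecPoly (B.V_le z h))

/-- `Π̃ τ` reproduces the normal trace pairing on `P̃^{p+1}(T)`. -/
theorem DualBases.integral_bdryPart_mul (D : DualBases B z) {τ : E n → E n}
    (hτ : MemHdiv (elt b) τ) {v : E n → ℝ} (hv : v ∈ tildeSpace b (p + 1)) :
    ∫ x, D.bdryPart τ x * v x ∂(surface (elt b)) = pairing (elt b) τ v := by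
  have hA := bdryArea_pos b
  have hcw := continuous_of_mem (D.bdryPart_mem τ).1
  have hvc : ∀ {v}, v ∈ tildeSpace b (p + 1) → ContDiff ℝ 1 v := fun hv => contDiff_of_mem hv.1
  rw [← D.nu_basis.2] at hv
  induction hv using Submodule.span_induction with
  | mem u hu =>
    obtain ⟨k, rfl⟩ := hu
    have hck := (hvc (D.nu_mem k)).continuous
    have h1 : ∀ x, D.bdryPart τ x * D.nu k x =
        ∑ j, (pairing (elt b) τ (D.nu j) / bdryArea b) * (D.nu k x * B.nuT j x) := by
      intro x
      rw [DualBases.bdryPart, Finset.sum_mul]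
      exact Finset.sum_congr rfl fun j _ => by ring
    have hij : ∀ j, Integrable (fun x => D.nu k x * B.nuT j x) (surface (elt b)) := fun j =>
      integrable_surface b (hck.mul (hvc (B.nuT_mem j)).continuous)
    simp only [h1]
    rw [integral_finsetSum _ fun j _ => (hij j).const_mul _]
    simp only [integral_const_mul, D.nu_dual]
    simp only [mul_ite, mul_zero, Finset.sum_ite_eq, Finset.mem_univ, if_true]
    field_simp
  | zero =>
    have : pairing (elt b) τ (fun _ => 0 * 0) = _ :=
      pairing_smul b τ 0 (contDiff_const (c := (0 : ℝ)))
    simp only [zero_mul] at this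
    simp only [Pi.zero_apply, mul_zero, integral_zero]
    exact this.symm
  | add u u' hu hu' h h' =>
    rw [D.nu_basis.2] at hu hu'
    have := pairing_add b hτ (hvc hu) (hvc hu')
    refine Eq.trans ?_ this.symm
    rw [← h, ← h']
    simp only [Pi.add_apply, mul_add]
    exact integral_add (integrable_surface b (hcw.mul (hvc hu).continuous))
      (integrable_surface b (hcw.mul (hvc hu').continuous))
  | smul c u hu h =>
    rw [D.nu_basis.2] at hu
    refine Eq.trans ?_ (pairing_smul b τ c (hvc hu)).symm
    rw [← h]
    simp only [Pi.smul_apply, smul_eq_mul, mul_left_comm _ c]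
    rw [integral_const_mul]

/-- On `P̃^{p+1}(T)` the moments agree by construction of `bdryPart`; on bubbles the pairing
vanishes for every field in `H(div; T)`. The two spaces together give all of `P^{p+1}(T)`. -/
theorem DualBases.pairing_fortinTilde (D : DualBases B z) {τ : E n → E n}
    (hτ : MemHdiv (elt b) τ) {v : E n → ℝ} (hv : v ∈ polySpace n (p + 1)) :
    pairing (elt b) (τ - D.fortinTilde τ) v = 0 := by
  have hF := memHdiv_of_mem_V (D.fortinTilde_mem_V τ)
  obtain ⟨w, hw, hvw⟩ := exists_tildeSpace_add_bubbleSpace b hv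
  have h1 : pairing (elt b) (τ - D.fortinTilde τ) (fun x => v x - w x) = 0 := by
    have hc : ContDiff ℝ 1 fun x => v x - w x := contDiff_of_mem hvw.1
    rw [pairing_sub b hτ hF hc, ← D.integral_bdryPart_mul hτ hvw, D.fortinTilde_eq,
      pairing_smul_psiBdry b (contDiff_of_mem (D.bdryPart_mem τ).1) hc, sub_self]
  have h2 := pairing_eq_zero b (hτ.sub hF) (contDiff_of_mem hw.1) hw.2
  have h3 := pairing_add b (hτ.sub hF) (contDiff_of_mem hvw.1) (contDiff_of_mem hw.1)
  rw [h1, h2, add_zero] at h3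
  simpa using h3

/-- The coefficient function of the second correction along the edge `e`. -/
def DualBases.edgePart {n : ℕ} {b : Simplex n} {p : ℕ} {B : PrimalBases b p} {z : Fin (n + 1)}
    (D : DualBases B z) (e : Edge z) (ρ : E n → E n) (x : E n) : ℝ :=
  ∑ j, ((∫ y in elt b, inner ℝ (D.sig e j y) (ρ y)) / vol b) * B.chiT j x

theorem DualBases.edgePart_mem {n : ℕ} {b : Simplex n} {p : ℕ} {B : PrimalBases b p}
    {z : Fin (n + 1)} (D : DualBases B z) (e : Edge z) (ρ : E n → E n) :
    D.edgePart e ρ ∈ polySpace n p := by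
  have : D.edgePart e ρ =
      ∑ j, ((∫ y in elt b, inner ℝ (D.sig e j y) (ρ y)) / vol b) • B.chiT j := by
    ext x; simp [DualBases.edgePart]
  rw [this]
  exact Submodule.sum_mem _ fun j _ => Submodule.smul_mem _ _ (B.chiT_mem j)

/-- Duality of `σ_E` and `t_E` separates the edges, and duality of `χ_{E,j}` and `χ̃_k η_E`
separates the indices. The linear system for the second correction is therefore diagonal. -/
theorem DualBases.inner_sig_eta {n : ℕ} {b : Simplex n} {p : ℕ} {B : PrimalBases b p}
    {z : Fin (n + 1)} (D : DualBases B z) (e e' : Edge z) (j k : Fin B.K) :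
    ∫ x in elt b, inner ℝ (D.sig e j x) (B.eta z e' k x) =
      if e = e' ∧ j = k then vol b else 0 := by
  have h1 : ∀ x, inner ℝ (D.sig e j x) (B.eta z e' k x) =
      (if e = e' then (1 : ℝ) else 0) * (D.chi e j x * (B.chiT k x * edgeFun b z e' x)) := by
    intro x
    rw [DualBases.sig, PrimalBases.eta, inner_smul_left, inner_smul_right, D.sigma_dual]
    simp only [conj_trivial]
    ring
  simp only [h1]
  rw [integral_const_mul]
  by_cases h : e = e'
  · subst h
    rw [D.chi_dual]
    simp
  · simp [h]

theorem DualBases.fortin_eq {n : ℕ} {b : Simplex n} {p : ℕ} {B : PrimalBases b p}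
    {z : Fin (n + 1)} (D : DualBases B z) (τ : E n → E n) :
    D.fortin τ = fun x => D.fortinTilde τ x + ∑ e : Edge z,
      (edgeFun b z e x * D.edgePart e (τ - D.fortinTilde τ) x) • tangent b z e := by
  ext1 x
  rw [DualBases.fortin]
  congr 1
  refine Finset.sum_congr rfl fun e _ => ?_
  rw [DualBases.edgePart, Finset.mul_sum, Finset.sum_smul]
  refine Finset.sum_congr rfl fun j _ => ?_
  rw [D.inner_sig_eta, if_pos ⟨rfl, rfl⟩, PrimalBases.eta, smul_smul]
  congr 1
  simp only [Pi.sub_apply]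
  ring

theorem DualBases.fortin_mem_V {n : ℕ} {b : Simplex n} {p : ℕ} {B : PrimalBases b p}
    {z : Fin (n + 1)} (D : DualBases B z) (τ : E n → E n) (h : D.fortinTilde τ ∈ B.V z) :
    D.fortin τ ∈ B.V z := by
  have h1 : D.fortin τ = D.fortinTilde τ + ∑ e : Edge z, ∑ j,
      ((∫ y in elt b, inner ℝ (D.sig e j y) (τ y - D.fortinTilde τ y)) /
      ∫ y in elt b, inner ℝ (D.sig e j y) (B.eta z e j y)) • B.eta z e j := by
    ext1 x; simp [DualBases.fortin, Finset.sum_apply]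
  rw [h1]
  refine Submodule.add_mem _ h (Submodule.mem_sup_right (Submodule.sum_mem _ fun e _ =>
    Submodule.sum_mem _ fun j _ => Submodule.smul_mem _ _ (Submodule.subset_span ⟨(e, j), rfl⟩)))

theorem DualBases.pairing_fortin (D : DualBases B z) {τ : E n → E n}
    (hτ : MemHdiv (elt b) τ) {v : E n → ℝ} (hv : v ∈ polySpace n (p + 1)) :
    pairing (elt b) (τ - D.fortin τ) v = 0 := by
  have hT := D.fortinTilde_mem_V τ
  have hF := memHdiv_of_mem_V hT
  have hv1 : ContDiff ℝ 1 v := contDiff_of_mem hv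
  -- The edge corrections are added one at a time; each has zero normal trace, so the pairing stays
  -- zero.
  have key : ∀ S : Finset (Edge z), ∃ σ : E n → E n, MemHdiv (elt b) σ ∧
      (σ = fun x => D.fortinTilde τ x + ∑ e ∈ S,
        (edgeFun b z e x * D.edgePart e (τ - D.fortinTilde τ) x) • tangent b z e) ∧
      pairing (elt b) (τ - σ) v = 0 := by
    classical
    intro S
    induction S using Finset.induction_on with
    | empty =>
      refine ⟨D.fortinTilde τ, hF, by simp, D.pairing_fortinTilde hτ hv⟩
    | insert e S he ih =>
      obtain ⟨σ, hσ, hσe, h0⟩ := ih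
      have hq : ContDiff ℝ 1 (D.edgePart e (τ - D.fortinTilde τ)) :=
        contDiff_of_mem (D.edgePart_mem e _)
      set σ' : E n → E n := fun x =>
        (edgeFun b z e x * D.edgePart e (τ - D.fortinTilde τ) x) • tangent b z e with hσ'
      have hσ'1 : ContDiff ℝ 1 σ' := ((contDiff_edgeFun b z e).mul hq).smul contDiff_const
      have hm : MemHdiv (elt b) σ' := memHdiv_of_contDiff hσ'1
      have hneg : MemHdiv (elt b) (-σ') := memHdiv_of_contDiff hσ'1.neg
      refine ⟨σ - (-σ'), hσ.sub hneg, ?_, ?_⟩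
      · ext1 x
        rw [Finset.sum_insert he]
        simp only [Pi.sub_apply, Pi.neg_apply, hσe, sub_neg_eq_add]
        rw [add_assoc, add_comm (∑ e ∈ S, _)]
      · have h2 : τ - (σ - -σ') = (τ - σ) - σ' := by abel
        rw [h2, pairing_sub b (hτ.sub hσ) hm hv1, h0, pairing_edge b z e hq hv1, sub_zero]
  obtain ⟨σ, -, hσe, h0⟩ := key Finset.univ
  rw [D.fortin_eq, ← hσe]
  exact h0

theorem DualBases.integral_sig_fortin (D : DualBases B z) {τ : E n → E n}
    (hτ : MemHdiv (elt b) τ) (e : Edge z) (j : Fin B.K) :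
    ∫ x in elt b, inner ℝ (D.sig e j x) (τ x - D.fortin τ x) = 0 := by
  have hF := memHdiv_of_mem_V (D.fortinTilde_mem_V τ)
  have hsig : Continuous (D.sig e j) :=
    (continuous_of_mem (D.chi_mem e j)).smul continuous_const
  have hsigL := memLp_elt b hsig
  have hη : ∀ e' k, MemLp (B.eta z e' k) 2 (volume.restrict (elt b)) := fun e' k =>
    memLp_elt b (contDiff_of_mem_vecPoly (B.eta_mem z e' k) (k := 1)).continuous
  have h1 : ∀ x, inner ℝ (D.sig e j x) (τ x - D.fortin τ x) =
      inner ℝ (D.sig e j x) (τ x - D.fortinTilde τ x) - ∑ e' : Edge z, ∑ k,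
        ((∫ y in elt b, inner ℝ (D.sig e' k y) (τ y - D.fortinTilde τ y)) / vol b) *
          inner ℝ (D.sig e j x) (B.eta z e' k x) := by
    intro x
    rw [DualBases.fortin, ← sub_sub, inner_sub_right _ (τ x - _), inner_sum]
    congr 1
    refine Finset.sum_congr rfl fun e' _ => ?_
    rw [inner_sum]
    refine Finset.sum_congr rfl fun k _ => ?_
    rw [D.inner_sig_eta, if_pos ⟨rfl, rfl⟩, inner_smul_right]
  simp only [h1]
  have hi : ∀ e' k, Integrable (fun x =>
      ((∫ y in elt b, inner ℝ (D.sig e' k y) (τ y - D.fortinTilde τ y)) / vol b) *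
          inner ℝ (D.sig e j x) (B.eta z e' k x)) (volume.restrict (elt b)) := fun e' k =>
    (integrable_inner hsigL (hη e' k)).const_mul _
  have hρ : MemLp (fun x => τ x - D.fortinTilde τ x) 2 (volume.restrict (elt b)) :=
    hτ.1.sub hF.1
  rw [integral_sub (integrable_inner hsigL hρ)
    (integrable_finsetSum _ fun e' _ => integrable_finsetSum _ fun k _ => hi e' k),
    integral_finsetSum _ fun e' _ => integrable_finsetSum _ fun k _ => hi e' k]
  have h2 : ∀ e' : Edge z, ∫ x in elt b, ∑ k,
      ((∫ y in elt b, inner ℝ (D.sig e' k y) (τ y - D.fortinTilde τ y)) / vol b) *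
          inner ℝ (D.sig e j x) (B.eta z e' k x) =
      if e = e' then ∫ y in elt b, inner ℝ (D.sig e' j y) (τ y - D.fortinTilde τ y) else 0 := by
    intro e'
    rw [integral_finsetSum _ fun k _ => hi e' k]
    simp only [integral_const_mul, D.inner_sig_eta]
    have := (vol_pos b).ne'
    by_cases h : e = e' <;> simp [h, this]
  simp only [h2]
  simp

/-- A field decomposes as `σ = ∑ (σ · t_E) σ_E` with coefficients in `P^p(T)`, and each coefficient
is a combination of the `χ_{E,j}`, for which orthogonality is already known. -/
theorem DualBases.integral_inner_fortin (D : DualBases B z) {τ : E n → E n}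
    (hτ : MemHdiv (elt b) τ) {σ : E n → E n} (hσ : σ ∈ vecPoly n p) :
    ∫ x in elt b, inner ℝ (σ x) (τ x - D.fortin τ x) = 0 := by
  have hF := memHdiv_of_mem_V (D.fortin_mem_V τ (D.fortinTilde_mem_V τ))
  have hρ : MemLp (fun x => τ x - D.fortin τ x) 2 (volume.restrict (elt b)) := hτ.1.sub hF.1
  have hint : ∀ (e : Edge z) {v : E n → ℝ}, v ∈ polySpace n p →
      Integrable (fun x => v x * inner ℝ (D.sigma e) (τ x - D.fortin τ x))
        (volume.restrict (elt b)) := fun e v hv =>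
    integrable_mul (memLp_elt b (continuous_of_mem hv)) (hρ.const_inner (D.sigma e))
  have h1 : ∀ (e : Edge z) {v : E n → ℝ}, v ∈ polySpace n p →
      ∫ x in elt b, v x * inner ℝ (D.sigma e) (τ x - D.fortin τ x) = 0 := by
    intro e v hv
    rw [← (D.chi_basis e).2] at hv
    induction hv using Submodule.span_induction with
    | mem u hu =>
      obtain ⟨j, rfl⟩ := hu
      rw [← D.integral_sig_fortin hτ e j]
      simp only [DualBases.sig, inner_smul_left, conj_trivial]
    | zero => simp
    | add u u' hu hu' h h' =>
      rw [(D.chi_basis e).2] at hu hu'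
      simp only [Pi.add_apply, add_mul]
      rw [integral_add (hint e hu) (hint e hu'), h, h', add_zero]
    | smul c u hu h =>
      simp only [Pi.smul_apply, smul_eq_mul, mul_assoc]
      rw [integral_const_mul, h, mul_zero]
  have h2 : ∀ x, inner ℝ (σ x) (τ x - D.fortin τ x) = ∑ e : Edge z,
      inner ℝ (σ x) (tangent b z e) * inner ℝ (D.sigma e) (τ x - D.fortin τ x) := by
    intro x
    conv_lhs => rw [← sum_inner_tangent_smul b z (σ x), sum_inner]
    refine Finset.sum_congr rfl fun e _ => ?_
    rw [inner_smul_left, D.sigma_eq, conj_trivial]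
  simp only [h2]
  rw [integral_finsetSum _ fun e _ => hint e (inner_const_mem_polySpace hσ _)]
  exact Finset.sum_eq_zero fun e _ => h1 e (inner_const_mem_polySpace hσ _)

/-- A polynomial extension of `u` provides one admissible lift and the value zero. Any other lift
with the same trace gives the same value by `pairing_eq_of_hasTrace`. -/
theorem DualBases.pairingEq_fortin (D : DualBases B z) {τ : E n → E n} (hτ : MemHdiv (elt b) τ)
    {u : E n → ℝ} (hu : IsContFacePoly b (p + 1) u) :
    PairingEq (elt b) (τ - D.fortin τ) u 0 := by
  have hF := memHdiv_of_mem_V (D.fortin_mem_V τ (D.fortinTilde_mem_V τ))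
  obtain ⟨f, hf, hfu⟩ := hu.exists_extension (Nat.le_add_left 1 p)
  refine ⟨⟨f, memH1_of_contDiff (contDiff_of_mem hf),
    hasTrace_of_contDiff b (contDiff_of_mem hf) hfu⟩, fun v hv hvu => ?_⟩
  rw [pairing_eq_of_hasTrace b (hτ.sub hF) hv hvu (contDiff_of_mem hf) hfu]
  exact D.pairing_fortin hτ hf

/-- Green's formula against `u ∈ P^{p+1}(T)`: the boundary pairing vanishes, and so does the
gradient term, because `∇u` has degree at most `p`. -/
theorem DualBases.isL2Proj_fortin (D : DualBases B z) {τ : E n → E n} (hτ : MemHdiv (elt b) τ) :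
    IsL2Proj b (p + 1) (weakDiv (elt b) τ) (cdiv (D.fortin τ)) ∧
      weakDiv (elt b) (D.fortin τ) =ᵐ[volume.restrict (elt b)] cdiv (D.fortin τ) := by
  have hV := D.fortin_mem_V τ (D.fortinTilde_mem_V τ)
  have hF := memHdiv_of_mem_V hV
  have hvp := B.V_le z hV
  have hae := weakDiv_of_contDiff (b := b) (contDiff_of_mem_vecPoly hvp)
  have hq : cdiv (D.fortin τ) ∈ polySpace n (p + 2 - 1) := cdiv_mem_polySpace hvp
  rw [show p + 2 - 1 = p + 1 from rfl] at hq
  refine ⟨⟨hq, fun u hu => ?_⟩, hae⟩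
  have hu1 : ContDiff ℝ 1 u := contDiff_of_mem hu
  have h1 := D.pairing_fortin hτ hu
  have hg : gradient u ∈ vecPoly n (p + 1 - 1) := gradient_mem_vecPoly hu
  rw [Nat.add_sub_cancel] at hg
  have h2 := D.integral_inner_fortin hτ hg
  rw [pairing_of_contDiff b _ hu1] at h1
  have h3 : ∫ x in elt b, inner ℝ ((τ - D.fortin τ) x) (gradient u x) = 0 := by
    rw [← h2]
    exact integral_congr_ae (.of_forall fun x => real_inner_comm _ _)
  rw [h3, add_zero] at h1
  rw [← h1]
  refine integral_congr_ae ?_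
  filter_upwards [hae, weakDiv_sub hτ hF] with x hx hx2
  rw [hx2, Pi.sub_apply, hx]

end algebraic

/-! ### Comparison of quadratic forms in finite dimensions -/

/-- The quotient of the two forms is continuous on the unit sphere of a coordinate space, hence
bounded there, and it is invariant under scaling. -/
theorem exists_forall_le_mul {V : Type*} [AddCommGroup V] [Module ℝ V] [FiniteDimensional ℝ V]
    (A B : LinearMap.BilinForm ℝ V) (hA : ∀ v, v ≠ 0 → 0 < A v v) :
    ∃ C, 0 ≤ C ∧ ∀ v, B v v ≤ C * A v v := by
  let e := (Module.finBasis ℝ V).equivFun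
  have hcont : ∀ Q : LinearMap.BilinForm ℝ V, Continuous fun x => Q (e.symm x) (e.symm x) := by
    intro Q
    let L : (Fin (Module.finrank ℝ V) → ℝ) →ₗ[ℝ] (Fin (Module.finrank ℝ V) → ℝ) →L[ℝ] ℝ :=
      LinearMap.toContinuousLinearMap.toLinearMap ∘ₗ
        (Q.compl₁₂ e.symm.toLinearMap e.symm.toLinearMap)
    exact L.continuous_of_finiteDimensional.clm_apply continuous_id
  have hpos : ∀ x, x ≠ 0 → 0 < A (e.symm x) (e.symm x) := fun x hx =>
    hA _ ((map_ne_zero_iff _ e.symm.injective).2 hx)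
  obtain ⟨C, hC⟩ := (isCompact_sphere (0 : Fin (Module.finrank ℝ V) → ℝ) 1).exists_bound_of_continuousOn
    (f := fun x => B (e.symm x) (e.symm x) / A (e.symm x) (e.symm x))
    ((hcont B).continuousOn.div (hcont A).continuousOn fun x hx =>
      (hpos x (ne_zero_of_mem_unit_sphere ⟨x, hx⟩)).ne')
  refine ⟨max C 0, le_max_right _ _, fun v => ?_⟩
  by_cases hv : v = 0
  · simp [hv]
  have hx : e v ≠ 0 := (map_ne_zero_iff _ e.injective).2 hv
  have hx' : 0 < ‖e v‖ := norm_pos_iff.2 hx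
  have h1 := (le_abs_self _).trans (hC (‖e v‖⁻¹ • e v) (by simp [norm_smul, hx'.ne']))
  have h2 : ∀ Q : LinearMap.BilinForm ℝ V, Q (e.symm (‖e v‖⁻¹ • e v)) (e.symm (‖e v‖⁻¹ • e v)) =
      ‖e v‖⁻¹ ^ 2 * Q v v := fun Q => by
    rw [map_smul, e.symm_apply_apply, map_smul, map_smul, LinearMap.smul_apply, smul_eq_mul,
      smul_eq_mul]
    ring
  have hAv := hA v hv
  simp only [h2] at h1
  rw [mul_div_mul_left _ _ (pow_ne_zero 2 (inv_ne_zero hx'.ne')), div_le_iff₀ hAv] at h1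
  exact h1.trans (mul_le_mul_of_nonneg_right (le_max_left _ _) hAv.le)

/-! ### Affine equivalence of simplices -/

section refMap

variable (b b' : Simplex n)

/-- The linear part of the affine map between two simplices. -/
def refLin : E n ≃L[ℝ] E n :=
  ((b.basisOf 0).equiv (b'.basisOf 0) (Equiv.refl _)).toContinuousLinearEquiv

/-- The affine map that maps the vertices of `b` to those of `b'`. -/
def refMap : E n →ᵃ[ℝ] E n where
  toFun x := refLin b b' (x - b 0) + b' 0
  linear := (refLin b b').toLinearMap
  map_vadd' x v := by
    simp only [vadd_eq_add, add_sub_assoc, map_add]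
    rw [add_assoc]; rfl

theorem refMap_apply (x : E n) : refMap b b' x = refLin b b' (x - b 0) + b' 0 := rfl

theorem refMap_vertex (i : Fin (n + 1)) : refMap b b' (b i) = b' i := by
  rw [refMap_apply]
  by_cases h : i = 0
  · subst h; simp
  · have h1 := b.basisOf_apply 0 ⟨i, h⟩
    have h2 := b'.basisOf_apply 0 ⟨i, h⟩
    have h3 : refLin b b' (b i - b 0) = b' i - b' 0 := by
      have := (b.basisOf 0).equiv_apply ⟨i, h⟩ (b'.basisOf 0) (Equiv.refl _)
      rw [h1, Equiv.refl_apply, h2] at this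
      exact this
    rw [h3, sub_add_cancel]

theorem refMap_sub (x : E n) (i : Fin (n + 1)) :
    refMap b b' x - b' i = refLin b b' (x - b i) := by
  rw [← refMap_vertex b b' i, refMap_apply, refMap_apply, add_sub_add_right_eq_sub, ← map_sub,
    sub_sub_sub_cancel_right]

theorem refLin_vertex_sub (i j : Fin (n + 1)) : refLin b b' (b i - b j) = b' i - b' j := by
  rw [← refMap_sub, refMap_vertex]

theorem coord_refMap (i : Fin (n + 1)) (x : E n) : b'.coord i (refMap b b' x) = b.coord i x := by
  have h : (b'.coord i).comp (refMap b b') = b.coord i := by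
    refine AffineMap.ext_on b.tot ?_
    rintro _ ⟨j, rfl⟩
    rw [AffineMap.comp_apply, refMap_vertex, b.coord_apply, b'.coord_apply]
  exact congrArg (fun f : E n →ᵃ[ℝ] ℝ => f x) h

theorem refMap_refMap (x : E n) : refMap b' b (refMap b b' x) = x :=
  b.ext_elem fun i => by rw [coord_refMap, coord_refMap]

theorem refMap_mem_elt {x : E n} : refMap b b' x ∈ elt b' ↔ x ∈ elt b := by
  simp only [mem_elt, coord_refMap]

theorem refMap_mem_frontier {x : E n} (hx : x ∈ frontier (elt b)) :
    refMap b b' x ∈ frontier (elt b') := by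
  simp only [frontier_elt, Set.mem_iUnion, mem_face, mem_closedElt, coord_refMap] at hx ⊢
  exact hx

theorem hasFDerivAt_refMap (x : E n) :
    HasFDerivAt (refMap b b') (refLin b b' : E n →L[ℝ] E n) x :=
  ((refLin b b').hasFDerivAt.comp x ((hasFDerivAt_id x).sub_const (b 0))).add_const (b' 0)

theorem fderiv_comp_refMap {w : E n → ℝ} (hw : ContDiff ℝ 1 w) (x t : E n) :
    fderiv ℝ (fun y => w (refMap b b' y)) x t = fderiv ℝ w (refMap b b' x) (refLin b b' t) := by
  have := ((hw.differentiable one_ne_zero (refMap b b' x)).hasFDerivAt.comp x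
    (hasFDerivAt_refMap b b' x)).fderiv
  have e : (fun y => w (refMap b b' y)) = w ∘ refMap b b' := rfl
  rw [e, this]
  rfl

/-- The Jacobian of an affine map is constant. The factor `c` is the same for all integrands, so it
cancels in every comparison of volume integrals. -/
theorem exists_integral_refMap : ∃ c : ℝ, 0 < c ∧ ∀ f : E n → ℝ,
    ∫ x in elt b', f x = c * ∫ x in elt b, f (refMap b b' x) := by
  refine ⟨|(refLin b b' : E n →L[ℝ] E n).det|, abs_pos.2 ?_, fun f => ?_⟩
  · exact (refLin b b').toLinearEquiv.isUnit_det'.ne_zero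
  · have himg : refMap b b' '' elt b = elt b' := by
      ext y
      refine ⟨?_, fun hy => ⟨refMap b' b y, (refMap_mem_elt b' b).2 hy, refMap_refMap b' b y⟩⟩
      rintro ⟨x, hx, rfl⟩
      exact (refMap_mem_elt b b').2 hx
    have hinj : Function.Injective (refMap b b') :=
      Function.LeftInverse.injective (refMap_refMap b b')
    rw [← himg, integral_image_eq_integral_abs_det_fderiv_smul volume (isOpen_elt b).measurableSet
      (fun x _ => (hasFDerivAt_refMap b b' x).hasFDerivWithinAt) hinj.injOn]
    simp only [smul_eq_mul]
    rw [integral_const_mul]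

/-- The affine map carries boundary to boundary, hence bubbles to bubbles, and changes the `L²`
product by a constant factor only; so orthogonality is preserved. -/
theorem comp_refMap_mem_tildeSpace {q : ℕ} {w : E n → ℝ} (hw : w ∈ tildeSpace b' q) :
    (fun x => w (refMap b b' x)) ∈ tildeSpace b q := by
  refine ⟨comp_affine_mem_polySpace hw.1 _, fun u hu => ?_⟩
  obtain ⟨c, hc, h⟩ := exists_integral_refMap b b'
  have h1 : (fun x => u (refMap b' b x)) ∈ bubbleSpace b' q :=
    ⟨comp_affine_mem_polySpace hu.1 _, fun x hx => hu.2 _ (refMap_mem_frontier b' b hx)⟩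
  have h2 := hw.2 _ h1
  rw [h] at h2
  simpa [refMap_refMap, hc.ne'] using h2

end refMap

/-! ### Scaled estimates -/

section estimates

/-- The mass form on a space of polynomials, with a continuous weight. -/
theorem exists_integral_sq_le {V : Submodule ℝ (E n → ℝ)} {q : ℕ} (hV : V ≤ polySpace n q)
    (b : Simplex n) (B : LinearMap.BilinForm ℝ V) {ρ : E n → ℝ} (hρ : Continuous ρ)
    (hpos : ∀ x ∈ elt b, 0 < ρ x) :
    ∃ C, 0 ≤ C ∧ ∀ v : V, B v v ≤ C * ∫ x in elt b, ρ x * (v : E n → ℝ) x ^ 2 := by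
  have : FiniteDimensional ℝ V := Submodule.finiteDimensional_of_le hV
  have hc : ∀ v ∈ V, Continuous v := fun v hv => continuous_of_mem (hV hv)
  let A := prodForm (volume.restrict (elt b)) ρ V fun v hv w hw =>
    integrable_of_continuous b ((hc v hv).mul ((hc w hw).mul hρ))
  have hA : ∀ v, A v v = ∫ x in elt b, ρ x * (v : E n → ℝ) x ^ 2 := fun v => by
    rw [prodForm_apply]
    congr 1; ext x; ring
  obtain ⟨C, hC, h⟩ := exists_forall_le_mul A B fun v hv => by
    rw [hA]
    refine lt_of_le_of_ne (setIntegral_nonneg (isOpen_elt b).measurableSet fun x hx =>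
      mul_nonneg (hpos x hx).le (sq_nonneg _)) fun h0 => hv (Subtype.ext ?_)
    exact eq_zero_of_integral_mul_sq (hV v.2) hρ hpos h0.symm
  exact ⟨C, hC, fun v => (h v).trans_eq (by rw [hA])⟩

theorem exists_sum_le {ι : Type*} [Finite ι] {P : ι → ℝ → Prop}
    (hP : ∀ i, ∃ C, 0 ≤ C ∧ P i C) (hmono : ∀ i C C', C ≤ C' → P i C → P i C') :
    ∃ C, 0 ≤ C ∧ ∀ i, P i C := by
  have := Fintype.ofFinite ι
  choose C hC h using hP
  exact ⟨∑ i, C i, Finset.sum_nonneg fun i _ => hC i, fun i => hmono i _ _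
    (Finset.single_le_sum (fun j _ => hC j) (Finset.mem_univ i)) (h i)⟩

variable (n) in
/-- Equivalence of weighted norms with the weight `η_E`, uniformly in the simplex. -/
theorem exists_integral_sq_le_edgeFun (q : ℕ) : ∃ C, 0 ≤ C ∧ ∀ (b : Simplex n) (z : Fin (n + 1))
    (e : Edge z), ∀ v ∈ polySpace n q,
      ∫ x in elt b, v x ^ 2 ≤ C * ∫ x in elt b, edgeFun b z e x * v x ^ 2 := by
  by_cases hne : Nonempty (Simplex n)
  swap
  · exact ⟨0, le_rfl, fun b => (hne ⟨b⟩).elim⟩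
  -- Any simplex may serve as the reference. The constant is found on `b₀` by compactness and
  -- carried over by `refMap`, which keeps barycentric coordinates and hence the edge functions.
  obtain ⟨b₀⟩ := hne
  have h := exists_sum_le (ι := Σ z : Fin (n + 1), Edge z)
    (P := fun i C => ∀ v ∈ polySpace n q,
      ∫ x in elt b₀, v x ^ 2 ≤ C * ∫ x in elt b₀, edgeFun b₀ i.1 i.2 x * v x ^ 2) ?_ ?_
  · obtain ⟨C, hC, h⟩ := h
    refine ⟨C, hC, fun b z e v hv => ?_⟩
    obtain ⟨c, hc, hint⟩ := exists_integral_refMap b₀ b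
    have h1 := h ⟨z, e⟩ _ (comp_affine_mem_polySpace hv (refMap b₀ b))
    rw [hint, hint, mul_left_comm]
    refine mul_le_mul_of_nonneg_left ?_ hc.le
    simpa only [edgeFun, coord_refMap] using h1
  · rintro ⟨z, e⟩
    have hc : ∀ v ∈ polySpace n q, Continuous v := fun v hv => continuous_of_mem hv
    obtain ⟨C, hC, h⟩ := exists_integral_sq_le (V := polySpace n q) le_rfl b₀
      (prodForm (volume.restrict (elt b₀)) (fun _ => 1) _ fun v hv w hw =>
        integrable_of_continuous b₀ ((hc v hv).mul ((hc w hw).mul continuous_const)))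
      (contDiff_edgeFun b₀ z e (k := 1)).continuous (fun x => edgeFun_pos e)
    refine ⟨C, hC, fun v hv => ?_⟩
    have := h ⟨v, hv⟩
    rw [prodForm_apply] at this
    simpa [sq] using this
  · rintro ⟨z, e⟩ C C' hCC h v hv
    refine (h v hv).trans (mul_le_mul_of_nonneg_right hCC ?_)
    exact setIntegral_nonneg (isOpen_elt b₀).measurableSet fun x hx =>
      mul_nonneg (edgeFun_pos e hx).le (sq_nonneg _)

/-- The directional derivative as an endomorphism of `P^q`. -/
def derivEnd (q : ℕ) (t : E n) : polySpace n q →ₗ[ℝ] polySpace n q where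
  toFun v := ⟨fun x => fderiv ℝ v x t,
    polySpace_mono (Nat.sub_le q 1) (fderiv_mem_polySpace v.2 t)⟩
  map_add' v w := by
    ext x
    have hd : ∀ u : polySpace n q, DifferentiableAt ℝ (u : E n → ℝ) x := fun u =>
      (contDiff_of_mem u.2 (k := 1)).differentiable one_ne_zero x
    simp [fderiv_add (hd v) (hd w)]
  map_smul' c v := by
    ext x
    simp [fderiv_const_smul ((contDiff_of_mem v.2 (k := 1)).differentiable one_ne_zero x)]

variable (n) in
/-- Inverse estimate for derivatives in the directions of the edges. -/
theorem exists_integral_fderiv_sq_le (q : ℕ) : ∃ C, 0 ≤ C ∧ ∀ (b : Simplex n)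
    (i j : Fin (n + 1)), ∀ v ∈ polySpace n q,
      ∫ x in elt b, (fderiv ℝ v x (b i - b j)) ^ 2 ≤ C * ∫ x in elt b, v x ^ 2 := by
  by_cases hne : Nonempty (Simplex n)
  swap
  · exact ⟨0, le_rfl, fun b => (hne ⟨b⟩).elim⟩
  obtain ⟨b₀⟩ := hne
  have h := exists_sum_le (ι := Fin (n + 1) × Fin (n + 1))
    (P := fun i C => ∀ v ∈ polySpace n q,
      ∫ x in elt b₀, (fderiv ℝ v x (b₀ i.1 - b₀ i.2)) ^ 2 ≤ C * ∫ x in elt b₀, v x ^ 2) ?_ ?_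
  · obtain ⟨C, hC, h⟩ := h
    refine ⟨C, hC, fun b i j v hv => ?_⟩
    obtain ⟨c, hc, hint⟩ := exists_integral_refMap b₀ b
    have h1 := h (i, j) _ (comp_affine_mem_polySpace hv (refMap b₀ b))
    rw [hint, hint, mul_left_comm]
    refine mul_le_mul_of_nonneg_left ?_ hc.le
    -- Edge vectors are mapped to edge vectors, so derivatives along edges transfer without any
    -- factor that depends on the simplex.
    simpa only [fderiv_comp_refMap b₀ b (contDiff_of_mem hv), refLin_vertex_sub] using h1
  · rintro ⟨i, j⟩
    have hc : ∀ v ∈ polySpace n q, Continuous v := fun v hv => continuous_of_mem hv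
    let A := prodForm (volume.restrict (elt b₀)) (fun _ => 1) (polySpace n q) fun v hv w hw =>
        integrable_of_continuous b₀ ((hc v hv).mul ((hc w hw).mul continuous_const))
    obtain ⟨C, hC, h⟩ := exists_integral_sq_le (V := polySpace n q) le_rfl b₀
      (A.compl₁₂ (derivEnd q (b₀ i - b₀ j)) (derivEnd q (b₀ i - b₀ j)))
      (ρ := fun _ => 1) continuous_const (fun x _ => one_pos)
    refine ⟨C, hC, fun v hv => ?_⟩
    have := h ⟨v, hv⟩
    rw [LinearMap.compl₁₂_apply, prodForm_apply] at this
    simpa [sq, derivEnd] using this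
  · rintro ⟨i, j⟩ C C' hCC h v hv
    exact (h v hv).trans (mul_le_mul_of_nonneg_right hCC (integral_nonneg fun x => sq_nonneg _))

variable (n) in
/-- Functions in `P̃^q(T)` are controlled by their boundary values. -/
theorem exists_integral_sq_le_surface [NeZero n] (q : ℕ) : ∃ C, 0 ≤ C ∧ ∀ (b : Simplex n),
    ∀ v ∈ tildeSpace b q,
      ∫ x in elt b, v x ^ 2 ≤ C * diam b * ∫ x, v x ^ 2 ∂(surface (elt b)) := by
  by_cases hne : Nonempty (Simplex n)
  swap
  · exact ⟨0, le_rfl, fun b => (hne ⟨b⟩).elim⟩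
  obtain ⟨b₀⟩ := hne
  have hc : ∀ v ∈ tildeSpace b₀ q, Continuous v := fun v hv => continuous_of_mem hv.1
  obtain ⟨C, hC, h⟩ := exists_forall_le_mul
    (prodForm (surface (elt b₀)) (fun _ => 1) (tildeSpace b₀ q) fun v hv w hw =>
      integrable_surface b₀ ((hc v hv).mul ((hc w hw).mul continuous_const)))
    (prodForm (volume.restrict (elt b₀)) (fun _ => 1) (tildeSpace b₀ q) fun v hv w hw =>
      integrable_of_continuous b₀ ((hc v hv).mul ((hc w hw).mul continuous_const))) (by
      intro v hv
      rw [prodForm_apply]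
      refine lt_of_le_of_ne (integral_nonneg fun x => by
        simpa using mul_self_nonneg _) fun h0 => hv (Subtype.ext ?_)
      exact tildeSpace_eq_zero b₀ v.2 (by simpa [sq] using h0.symm))
  simp only [prodForm_apply, mul_one, ← sq, Subtype.forall] at h
  let G := ∑ i, ‖baryGrad b₀ i‖
  refine ⟨C * G, by positivity, fun b v hv => ?_⟩
  obtain ⟨c, hcpos, hint⟩ := exists_integral_refMap b₀ b
  have hv0 := comp_refMap_mem_tildeSpace b₀ b hv
  have hv1 : ContDiff ℝ 1 v := contDiff_of_mem hv.1
  have hv2 : ContDiff ℝ 1 fun x => v x ^ 2 := hv1.pow 2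
  have hv3 : ContDiff ℝ 1 fun x => v (refMap b₀ b x) ^ 2 :=
    (contDiff_of_mem hv0.1 (k := 1)).pow 2
  have h1 := h _ hv0
  -- The squared surface norm is `∑ i, ‖∇η_i‖ * I i`, with nonnegative volume integrals `I i` that
  -- scale by `c` alone. It remains to compare the weights: they are at most `G` on `b₀`, and `1 ≤
  -- ‖∇η_i‖ h_T` on `b`.
  let I : Simplex n → (E n → ℝ) → Fin (n + 1) → ℝ := fun b f i =>
    ∫ x in elt b, (n * f x + fderiv ℝ f x (x - b i))
  have hI : ∀ i, I b (fun x => v x ^ 2) i = c * I b₀ (fun x => v (refMap b₀ b x) ^ 2) i := by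
    intro i
    simp only [I]
    rw [hint]
    congr 2
    ext x
    rw [fderiv_comp_refMap b₀ b hv2, refMap_sub]
  have hI0 : ∀ i, 0 ≤ I b (fun x => v x ^ 2) i := by
    intro i
    simp only [I]
    rw [integral_div_cone b i hv2]
    exact mul_nonneg (norm_nonneg _) (integral_nonneg fun x => sq_nonneg _)
  have hI1 : ∀ i, 0 ≤ I b₀ (fun x => v (refMap b₀ b x) ^ 2) i := by
    intro i
    simp only [I]
    rw [integral_div_cone b₀ i hv3]
    exact mul_nonneg (norm_nonneg _) (integral_nonneg fun x => sq_nonneg _)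
  rw [integral_surface_eq b₀ hv3] at h1
  rw [integral_surface_eq b hv2, hint]
  calc c * ∫ x in elt b₀, v (refMap b₀ b x) ^ 2
      ≤ c * (C * ∑ i, ‖baryGrad b₀ i‖ * I b₀ (fun x => v (refMap b₀ b x) ^ 2) i) :=
        mul_le_mul_of_nonneg_left h1 hcpos.le
    _ ≤ c * (C * ∑ i, G * I b₀ (fun x => v (refMap b₀ b x) ^ 2) i) := by
        gcongr with i
        · exact hI1 i
        · exact Finset.single_le_sum (f := fun i => ‖baryGrad b₀ i‖) (fun j _ => norm_nonneg _)
            (Finset.mem_univ i)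
    _ = C * G * ∑ i, I b (fun x => v x ^ 2) i := by
        simp only [hI, ← Finset.mul_sum]
        ring
    _ ≤ C * G * ∑ i, (‖baryGrad b i‖ * diam b) * I b (fun x => v x ^ 2) i := by
        gcongr with i
        exact le_mul_of_one_le_left (hI0 i) (one_le_baryGrad_mul_diam b i)
    _ = C * G * diam b * ∑ i, ‖baryGrad b i‖ * I b (fun x => v x ^ 2) i := by
        rw [mul_assoc (C * G), Finset.mul_sum (a := diam b)]
        congr 1
        exact Finset.sum_congr rfl fun i _ => by ring

end estimates

/-! ### Norm bounds -/

theorem lnorm_sum_le {α F ι : Type*} [MeasurableSpace α] [NormedAddCommGroup F] {μ : Measure α}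
    (s : Finset ι) {f : ι → α → F} (hf : ∀ i, MemLp (f i) 2 μ) :
    lnorm μ (fun x => ∑ i ∈ s, f i x) ≤ ∑ i ∈ s, lnorm μ (f i) := by
  classical
  induction s using Finset.induction_on with
  | empty => simp [lnorm]
  | insert i s hi ih =>
    simp only [Finset.sum_insert hi]
    exact (lnorm_add_le (hf i) (memLp_finsetSum s fun j _ => hf j)).trans (by gcongr)

theorem le_of_sq_le_mul {a k : ℝ} (ha : 0 ≤ a) (hk : 0 ≤ k) (h : a ^ 2 ≤ k * a) : a ≤ k := by
  rcases ha.eq_or_lt with h0 | h0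
  · exact h0 ▸ hk
  · exact le_of_mul_le_mul_right (by rwa [sq] at h) h0

theorem lnorm_sq_real (b : Simplex n) {v : E n → ℝ} (hv : Continuous v) :
    lnorm (volume.restrict (elt b)) v ^ 2 = ∫ x in elt b, v x ^ 2 := by
  rw [lnorm_sq (memLp_elt b hv)]
  simp

theorem IsL2Proj.l2norm_le {b : Simplex n} {q : ℕ} {v w : E n → ℝ} (h : IsL2Proj b q v w)
    (hv : MemLp v 2 (volume.restrict (elt b))) : l2norm (elt b) w ≤ l2norm (elt b) v := by
  have hc := continuous_of_mem h.1
  have hw := memLp_elt b hc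
  have h1 := h.2 w h.1
  simp only [sub_mul] at h1
  rw [integral_sub (integrable_mul hv hw) (integrable_mul hw hw), sub_eq_zero] at h1
  refine le_of_sq_le_mul (lnorm_nonneg w) (lnorm_nonneg v) ?_
  have h2 := lnorm_sq_real b hc
  simp only [sq (w _)] at h2
  rw [← h1] at h2
  exact h2.trans_le ((le_abs_self _).trans (abs_integral_mul_le hv hw))

variable (n) in
/-- Inverse estimate for the gradient. -/
theorem exists_diam_mul_gradient_le (q : ℕ) : ∃ C, 0 ≤ C ∧ ∀ (b : Simplex n) (γ : ℝ),
    (∀ i, diam b * ‖baryGrad b i‖ ≤ γ) → ∀ v ∈ polySpace n q,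
      diam b * l2norm (elt b) (gradient v) ≤ C * γ * l2norm (elt b) v := by
  obtain ⟨C, hC, h⟩ := exists_integral_fderiv_sq_le n q
  refine ⟨Fintype.card (Edge (0 : Fin (n + 1))) * √C, by positivity, fun b γ hγ v hv => ?_⟩
  let μ := volume.restrict (elt b)
  have hv1 : ContDiff ℝ 1 v := contDiff_of_mem hv
  have hd : ∀ t, Continuous fun x => fderiv ℝ v x t := fun t =>
    (hv1.continuous_fderiv one_ne_zero).clm_apply continuous_const
  -- The gradient is expanded into edge derivatives times barycentric gradients; the diameter is
  -- then absorbed by `h_T ‖∇η‖ ≤ γ`.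
  have h1 : gradient v = fun x => ∑ e : Edge (0 : Fin (n + 1)),
      fderiv ℝ v x (tangent b 0 e) • baryGrad b e.1 := by
    ext1 x
    conv_lhs => rw [← sum_inner_tangent_smul b 0 (gradient v x)]
    simp only [inner_gradient]
  have h2 : ∀ t, MemLp (fun x => fderiv ℝ v x t) 2 μ := fun t => memLp_elt b (hd t)
  have h3 : ∀ e : Edge (0 : Fin (n + 1)), lnorm μ (fun x => fderiv ℝ v x (tangent b 0 e)) ≤
      √C * lnorm μ v := fun e => by
    refine abs_le_of_sq_le_sq' ?_ (by have := lnorm_nonneg (μ := μ) v; positivity) |>.2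
    rw [mul_pow, Real.sq_sqrt hC, lnorm_sq_real b (hd _), lnorm_sq_real b hv1.continuous]
    exact h b _ _ v hv
  have h4 : ∀ e : Edge (0 : Fin (n + 1)),
      lnorm μ (fun x => fderiv ℝ v x (tangent b 0 e) • baryGrad b e.1) ≤
        ‖baryGrad b e.1‖ * lnorm μ (fun x => fderiv ℝ v x (tangent b 0 e)) := fun e =>
    lnorm_le_of_norm_le (norm_nonneg _) (h2 _)
      (Eventually.of_forall fun x => by rw [norm_smul, mul_comm])
  have hdiam : 0 ≤ diam b := Metric.diam_nonneg
  have hN := lnorm_nonneg (μ := μ) v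
  calc diam b * l2norm (elt b) (gradient v)
      ≤ diam b * ∑ e : Edge (0 : Fin (n + 1)),
          lnorm μ (fun x => fderiv ℝ v x (tangent b 0 e) • baryGrad b e.1) := by
        rw [h1]
        exact mul_le_mul_of_nonneg_left (lnorm_sum_le _ fun e => memLp_elt b (by
          have := hd (tangent b 0 e); fun_prop)) hdiam
    _ ≤ diam b * ∑ e : Edge (0 : Fin (n + 1)), ‖baryGrad b e.1‖ * (√C * lnorm μ v) := by
        gcongr with e
        exact (h4 e).trans (by gcongr; exact h3 e)
    _ = ∑ e : Edge (0 : Fin (n + 1)), (diam b * ‖baryGrad b e.1‖) * (√C * lnorm μ v) := by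
        rw [Finset.mul_sum]
        simp only [mul_assoc]
    _ ≤ ∑ e : Edge (0 : Fin (n + 1)), γ * (√C * lnorm μ v) := by
        gcongr with e
        exact hγ e.1
    _ = _ := by
        rw [Finset.sum_const, Finset.card_univ, nsmul_eq_mul]
        change _ = _ * lnorm μ v
        ring

theorem norm_psiBdry_le [NeZero n] {b : Simplex n} {γ : ℝ}
    (hγ : ∀ i, diam b * ‖baryGrad b i‖ ≤ γ) {x : E n} (hx : x ∈ elt b) :
    ‖psiBdry b x‖ ≤ (n + 1) * γ := by
  have hdiam : 0 ≤ diam b := Metric.diam_nonneg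
  have h1 : ∀ i, ‖psiFace b i x‖ ≤ γ := fun i => by
    rw [psiFace_eq, norm_smul, norm_norm]
    refine le_trans ?_ (hγ i)
    rw [mul_comm]
    refine mul_le_mul_of_nonneg_right ((norm_sub_vertex_le b (elt_subset b hx) i).trans ?_)
      (norm_nonneg _)
    exact mul_le_of_le_one_left hdiam (by linarith [mem_elt.1 hx i])
  refine (norm_sum_le _ _).trans ((Finset.sum_le_sum fun i _ => h1 i).trans_eq ?_)
  simp

/-! ### Stability of the two corrections and of the full operator -/

section bounds

variable [NeZero n]

-- With `w` as its own test function the squared surface norm is `⟨τ·n, w⟩ = (div τ, w) + (τ, ∇w)`.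
-- The factor `h_T` gained by passing from `∂T` to `T` compensates the inverse estimate for `∇w`,
-- and one power of `‖w‖` cancels.
variable (n) in
theorem exists_bdryPart_le (p : ℕ) : ∃ C, 0 ≤ C ∧ ∀ (b : Simplex n) (γ : ℝ), 0 ≤ γ →
    (∀ i, diam b * ‖baryGrad b i‖ ≤ γ) → ∀ (B : PrimalBases b p) (z : Fin (n + 1))
    (D : DualBases B z) (τ : E n → E n), MemHdiv (elt b) τ →
      l2norm (elt b) (D.bdryPart τ) ≤ C * (1 + γ) *
        (l2norm (elt b) τ + diam b * l2norm (elt b) (weakDiv (elt b) τ)) := by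
  obtain ⟨C₁, hC₁, h₁⟩ := exists_integral_sq_le_surface n (p + 1)
  obtain ⟨C₂, hC₂, h₂⟩ := exists_diam_mul_gradient_le n (p + 1)
  refine ⟨C₁ * (1 + C₂), by positivity, fun b γ hγ0 hγ B z D τ hτ => ?_⟩
  let μ := volume.restrict (elt b)
  set w := D.bdryPart τ with hw
  have hwm := D.bdryPart_mem τ
  have hw1 : ContDiff ℝ 1 w := contDiff_of_mem hwm.1
  have hdiam : 0 ≤ diam b := Metric.diam_nonneg
  have hX : 0 ≤ l2norm (elt b) τ := lnorm_nonneg τ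
  have hY : 0 ≤ l2norm (elt b) (weakDiv (elt b) τ) := lnorm_nonneg _
  have hW : 0 ≤ l2norm (elt b) w := lnorm_nonneg w
  have key : ∫ x, w x ^ 2 ∂(surface (elt b)) ≤
      l2norm (elt b) (weakDiv (elt b) τ) * l2norm (elt b) w +
        l2norm (elt b) τ * l2norm (elt b) (gradient w) := by
    have h := D.integral_bdryPart_mul hτ hwm
    rw [pairing_of_contDiff b τ hw1] at h
    simp only [sq]
    rw [h]
    exact add_le_add ((le_abs_self _).trans (abs_integral_mul_le hτ.weakDiv_spec.1
      (memLp_elt b hw1.continuous))) ((le_abs_self _).trans (abs_integral_inner_le hτ.1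
      (memLp_elt b (continuous_gradient hw1))))
  refine le_of_sq_le_mul hW (by positivity) ?_
  have h3 := h₂ b γ hγ w hwm.1
  calc l2norm (elt b) w ^ 2 = ∫ x in elt b, w x ^ 2 := lnorm_sq_real b hw1.continuous
    _ ≤ C₁ * diam b * ∫ x, w x ^ 2 ∂(surface (elt b)) := h₁ b w hwm
    _ ≤ C₁ * diam b * (l2norm (elt b) (weakDiv (elt b) τ) * l2norm (elt b) w +
        l2norm (elt b) τ * l2norm (elt b) (gradient w)) := by gcongr
    _ = C₁ * (diam b * l2norm (elt b) (weakDiv (elt b) τ) * l2norm (elt b) w +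
        l2norm (elt b) τ * (diam b * l2norm (elt b) (gradient w))) := by ring
    _ ≤ C₁ * (diam b * l2norm (elt b) (weakDiv (elt b) τ) * l2norm (elt b) w +
        l2norm (elt b) τ * (C₂ * γ * l2norm (elt b) w)) := by gcongr
    _ ≤ _ := by
        have e : C₁ * (1 + C₂) * (1 + γ) * (l2norm (elt b) τ +
            diam b * l2norm (elt b) (weakDiv (elt b) τ)) * l2norm (elt b) w =
            C₁ * (diam b * l2norm (elt b) (weakDiv (elt b) τ) * l2norm (elt b) w +
              l2norm (elt b) τ * (C₂ * γ * l2norm (elt b) w)) +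
            C₁ * l2norm (elt b) w * (l2norm (elt b) τ * (1 + γ + C₂) +
              diam b * l2norm (elt b) (weakDiv (elt b) τ) * (γ + C₂ + C₂ * γ)) := by ring
        rw [e]
        exact le_add_of_nonneg_right (by positivity)

variable (n) in
theorem exists_fortinTilde_le (p : ℕ) (γ : ℝ) (hγ0 : 0 ≤ γ) : ∃ C, 0 ≤ C ∧ ∀ (b : Simplex n),
    (∀ i, diam b * ‖baryGrad b i‖ ≤ γ) → ∀ (B : PrimalBases b p) (z : Fin (n + 1))
    (D : DualBases B z) (τ : E n → E n), MemHdiv (elt b) τ →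
      l2norm (elt b) (D.fortinTilde τ) ≤ C *
        (l2norm (elt b) τ + diam b * l2norm (elt b) (weakDiv (elt b) τ)) := by
  obtain ⟨C, hC, h⟩ := exists_bdryPart_le n p
  refine ⟨(n + 1) * γ * (C * (1 + γ)), by positivity, fun b hγ B z D τ hτ => ?_⟩
  have h1 : l2norm (elt b) (D.fortinTilde τ) ≤ (n + 1) * γ * l2norm (elt b) (D.bdryPart τ) := by
    refine lnorm_le_of_norm_le (by positivity)
      (memLp_elt b (continuous_of_mem (D.bdryPart_mem τ).1)) ?_
    refine ae_restrict_of_forall_mem (isOpen_elt b).measurableSet fun x hx => ?_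
    rw [D.fortinTilde_eq, norm_smul, mul_comm]
    exact mul_le_mul_of_nonneg_right (norm_psiBdry_le hγ hx) (norm_nonneg _)
  refine h1.trans ?_
  rw [mul_assoc _ (C * _)]
  exact mul_le_mul_of_nonneg_left (h b γ hγ0 hγ B z D τ hτ) (by positivity)

/-- Orthogonality of `τ - Π τ` to `q_E ∇η_{z'}`, where `q_E` is the coefficient of the edge itself:
by duality with the tangents only that edge survives. This identity bypasses the dual bases, so the
resulting constant does not depend on them. -/
theorem DualBases.integral_edgeFun_mul_edgePart_sq {b : Simplex n} {p : ℕ} {B : PrimalBases b p}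
    {z : Fin (n + 1)} (D : DualBases B z) {τ : E n → E n} (hτ : MemHdiv (elt b) τ) (e : Edge z) :
    ∫ x in elt b, edgeFun b z e x * D.edgePart e (τ - D.fortinTilde τ) x ^ 2 =
      ∫ x in elt b, inner ℝ (D.edgePart e (τ - D.fortinTilde τ) x • baryGrad b e.1)
        (τ x - D.fortinTilde τ x) := by
  have hq := D.edgePart_mem e (τ - D.fortinTilde τ)
  have hcq := continuous_of_mem hq
  have hσ : (fun x => D.edgePart e (τ - D.fortinTilde τ) x • baryGrad b e.1) ∈ vecPoly n p := by
    have h := smul_mem_vecPoly hq (const_mem_vecPoly (q := 0) (baryGrad b e.1))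
    rw [add_zero] at h
    exact h
  have hF := memHdiv_of_mem_V (D.fortinTilde_mem_V τ)
  have hρ : MemLp (fun x => τ x - D.fortinTilde τ x) 2 (volume.restrict (elt b)) := hτ.1.sub hF.1
  have hcσ : Continuous fun x => D.edgePart e (τ - D.fortinTilde τ) x • baryGrad b e.1 := by
    fun_prop
  have hcη := (contDiff_edgeFun b z e (k := 1)).continuous
  have hcq2 : Continuous fun x => D.edgePart e (τ - D.fortinTilde τ) x ^ 2 := hcq.pow 2
  have h := D.integral_inner_fortin hτ hσ
  have h1 : ∀ x, inner ℝ (D.edgePart e (τ - D.fortinTilde τ) x • baryGrad b e.1)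
      (τ x - D.fortin τ x) = inner ℝ (D.edgePart e (τ - D.fortinTilde τ) x • baryGrad b e.1)
        (τ x - D.fortinTilde τ x) -
        edgeFun b z e x * D.edgePart e (τ - D.fortinTilde τ) x ^ 2 := by
    intro x
    rw [D.fortin_eq, ← sub_sub, inner_sub_right _ (τ x - _), inner_sum]
    congr 1
    simp only [inner_smul_left, inner_smul_right, inner_baryGrad_tangent, conj_trivial]
    simp only [mul_ite, mul_one, mul_zero, Finset.sum_ite_eq, Finset.mem_univ, if_true]
    ring
  simp only [h1] at h
  rw [integral_sub (integrable_inner (memLp_elt b hcσ) hρ)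
    (integrable_mul_elt b hcη hcq2), sub_eq_zero] at h
  exact h.symm

-- The norm of the coefficient is bounded by its norm with weight `η_E`, which the preceding
-- identity expresses through the residual.
variable (n) in
theorem exists_edgePart_le (p : ℕ) : ∃ C, 0 ≤ C ∧ ∀ (b : Simplex n) (B : PrimalBases b p)
    (z : Fin (n + 1)) (D : DualBases B z) (τ : E n → E n), MemHdiv (elt b) τ → ∀ e : Edge z,
      l2norm (elt b) (D.edgePart e (τ - D.fortinTilde τ)) ≤ C * ‖baryGrad b e.1‖ *
        l2norm (elt b) (fun x => τ x - D.fortinTilde τ x) := by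
  obtain ⟨C, hC, h⟩ := exists_integral_sq_le_edgeFun n p
  refine ⟨C, hC, fun b B z D τ hτ e => ?_⟩
  set q := D.edgePart e (τ - D.fortinTilde τ) with hqdef
  have hq : q ∈ polySpace n p := D.edgePart_mem e (τ - D.fortinTilde τ)
  have hcq := continuous_of_mem hq
  have hF := memHdiv_of_mem_V (D.fortinTilde_mem_V τ)
  have hρ : MemLp (fun x => τ x - D.fortinTilde τ x) 2 (volume.restrict (elt b)) := hτ.1.sub hF.1
  have hρ0 : 0 ≤ l2norm (elt b) (fun x => τ x - D.fortinTilde τ x) := lnorm_nonneg _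
  have hcσ : Continuous fun x => q x • baryGrad b e.1 := by fun_prop
  have h1 : l2norm (elt b) (fun x => q x • baryGrad b e.1) ≤
      ‖baryGrad b e.1‖ * l2norm (elt b) q :=
    lnorm_le_of_norm_le (norm_nonneg _) (memLp_elt b hcq)
      (Eventually.of_forall fun x => by rw [norm_smul, mul_comm])
  refine le_of_sq_le_mul (lnorm_nonneg q) (by positivity) ?_
  calc l2norm (elt b) q ^ 2 = ∫ x in elt b, q x ^ 2 := lnorm_sq_real b hcq
    _ ≤ C * ∫ x in elt b, edgeFun b z e x * q x ^ 2 := h b z e q hq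
    _ = C * ∫ x in elt b, inner ℝ (q x • baryGrad b e.1) (τ x - D.fortinTilde τ x) := by
        rw [D.integral_edgeFun_mul_edgePart_sq hτ e]
    _ ≤ C * (l2norm (elt b) (fun x => q x • baryGrad b e.1) *
          l2norm (elt b) (fun x => τ x - D.fortinTilde τ x)) := by
        gcongr
        exact (le_abs_self _).trans (abs_integral_inner_le (memLp_elt b hcσ) hρ)
    _ ≤ C * (‖baryGrad b e.1‖ * l2norm (elt b) q *
          l2norm (elt b) (fun x => τ x - D.fortinTilde τ x)) := by gcongr
    _ = _ := by ring

variable (n) in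
theorem exists_fortin_le (p : ℕ) (γ : ℝ) : ∃ C, 0 < C ∧ ∀ (b : Simplex n) (B : PrimalBases b p)
    (z : Fin (n + 1)) (D : DualBases B z), ShapeRegular γ b → ∀ τ : E n → E n,
    MemHdiv (elt b) τ → l2norm (elt b) (D.fortin τ) ≤ C *
        (l2norm (elt b) τ + diam b * l2norm (elt b) (weakDiv (elt b) τ)) := by
  obtain ⟨C₁, hC₁, h₁⟩ := exists_fortinTilde_le n p (max γ 0) (le_max_right _ _)
  obtain ⟨C₂, hC₂, h₂⟩ := exists_edgePart_le n p
  have hγ0 : 0 ≤ max γ 0 := le_max_right _ _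
  -- The summand `1` only makes the constant positive, and `max γ 0` covers negative `γ`. In each
  -- edge term `‖t_E‖ ≤ h_T` balances the factor `‖∇η‖` of the coefficient bound.
  refine ⟨C₁ + (n + 1) * (C₂ * max γ 0 * (1 + C₁)) + 1, by positivity,
    fun b B z D hreg τ hτ => ?_⟩
  have hγ : ∀ i, diam b * ‖baryGrad b i‖ ≤ max γ 0 := fun i =>
    (hreg.diam_mul_baryGrad_le i).trans (le_max_left _ _)
  have hF := memHdiv_of_mem_V (D.fortinTilde_mem_V τ)
  have hdiam : 0 ≤ diam b := Metric.diam_nonneg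
  have hX : 0 ≤ l2norm (elt b) τ := lnorm_nonneg τ
  have hY : 0 ≤ l2norm (elt b) (weakDiv (elt b) τ) := lnorm_nonneg _
  set S := l2norm (elt b) τ + diam b * l2norm (elt b) (weakDiv (elt b) τ) with hS
  have hS0 : 0 ≤ S := by positivity
  have hXS : l2norm (elt b) τ ≤ S := le_add_of_nonneg_right (by positivity)
  have hA := h₁ b hγ B z D τ hτ
  have hR : l2norm (elt b) (fun x => τ x - D.fortinTilde τ x) ≤ (1 + C₁) * S := by
    refine (lnorm_sub_le hτ.1 hF.1).trans ?_
    rw [add_mul, one_mul]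
    exact add_le_add hXS hA
  have hq : ∀ e : Edge z, Continuous fun x =>
      (edgeFun b z e x * D.edgePart e (τ - D.fortinTilde τ) x) • tangent b z e := fun e => by
    have h1 := continuous_of_mem (D.edgePart_mem e (τ - D.fortinTilde τ))
    have h2 := (contDiff_edgeFun b z e (k := 1)).continuous
    fun_prop
  have hE : ∀ e : Edge z, l2norm (elt b) (fun x =>
      (edgeFun b z e x * D.edgePart e (τ - D.fortinTilde τ) x) • tangent b z e) ≤
      C₂ * max γ 0 * (1 + C₁) * S := by
    intro e
    have h3 : l2norm (elt b) (fun x =>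
        (edgeFun b z e x * D.edgePart e (τ - D.fortinTilde τ) x) • tangent b z e) ≤
        diam b * l2norm (elt b) (D.edgePart e (τ - D.fortinTilde τ)) := by
      refine lnorm_le_of_norm_le hdiam (memLp_elt b (continuous_of_mem (D.edgePart_mem e _))) ?_
      refine ae_restrict_of_forall_mem (isOpen_elt b).measurableSet fun x hx => ?_
      have h4 : ‖tangent b z e‖ ≤ diam b := by
        rw [tangent, ← dist_eq_norm]
        exact dist_le_diam b (vertex_mem b _) (vertex_mem b _)
      have h5 : ‖edgeFun b z e x‖ ≤ 1 := by
        rw [Real.norm_of_nonneg (edgeFun_pos e hx).le]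
        exact mul_le_one₀ (coord_le_one (elt_subset b hx) _) (mem_elt.1 hx _).le
          (coord_le_one (elt_subset b hx) _)
      rw [norm_smul, norm_mul, mul_comm]
      exact mul_le_mul h4 (mul_le_of_le_one_left (norm_nonneg _) h5) (by positivity) hdiam
    calc _ ≤ _ := h3
      _ ≤ diam b * (C₂ * ‖baryGrad b e.1‖ *
          l2norm (elt b) (fun x => τ x - D.fortinTilde τ x)) := by
          gcongr
          exact h₂ b B z D τ hτ e
      _ = C₂ * (diam b * ‖baryGrad b e.1‖) *
          l2norm (elt b) (fun x => τ x - D.fortinTilde τ x) := by ring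
      _ ≤ C₂ * max γ 0 * ((1 + C₁) * S) := by
          gcongr
          · exact lnorm_nonneg _
          · exact hγ e.1
      _ = _ := by ring
  rw [D.fortin_eq]
  refine (lnorm_add_le hF.1 (memLp_finsetSum _ fun e _ => memLp_elt b (hq e))).trans ?_
  have h6 := lnorm_sum_le (μ := volume.restrict (elt b)) Finset.univ
    fun e => memLp_elt b (hq e)
  have h7 : ∑ e : Edge z, l2norm (elt b) (fun x =>
      (edgeFun b z e x * D.edgePart e (τ - D.fortinTilde τ) x) • tangent b z e) ≤
      (n + 1) * (C₂ * max γ 0 * (1 + C₁) * S) := by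
    refine (Finset.sum_le_sum fun e _ => hE e).trans ?_
    rw [Finset.sum_const, Finset.card_univ, nsmul_eq_mul]
    refine mul_le_mul_of_nonneg_right ?_ (by positivity)
    have : Fintype.card (Edge z) ≤ n + 1 := by
      simp
    exact_mod_cast this
  refine (add_le_add hA (h6.trans h7)).trans ?_
  have e : (C₁ + (n + 1) * (C₂ * max γ 0 * (1 + C₁)) + 1) * S =
    C₁ * S + (n + 1) * (C₂ * max γ 0 * (1 + C₁) * S) + S := by ring
  rw [e]
  exact le_add_of_nonneg_right hS0

variable (n) in
theorem exists_alphaNorm_fortin_le (p : ℕ) (γ K : ℝ) : ∃ C, 0 < C ∧ ∀ (b : Simplex n)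
    (B : PrimalBases b p) (z : Fin (n + 1)) (D : DualBases B z), ShapeRegular γ b →
    ∀ α : ℝ, 0 < α → diam b ≤ K * α → ∀ τ : E n → E n, MemHdiv (elt b) τ →
      alphaNorm (elt b) α (D.fortin τ) ≤ C * alphaNorm (elt b) α τ := by
  obtain ⟨C, hC, h⟩ := exists_fortin_le n p γ
  -- With `M = C (1 + |K|)` one has `P ≤ M (X + α Y)` and `Q ≤ Y`. Hence the square of the left side
  -- is at most `(2 M² + 1) (X² + α² Y²)`, and `2 M² + 1 ≤ (2 M + 1)²`.
  refine ⟨2 * (C * (1 + |K|)) + 1, by positivity, fun b B z D hreg α hα hK τ hτ => ?_⟩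
  have h1 := h b B z D hreg τ hτ
  obtain ⟨hproj, hae⟩ := D.isL2Proj_fortin hτ
  have h2 := hproj.l2norm_le hτ.weakDiv_spec.1
  have h3 : l2norm (elt b) (weakDiv (elt b) (D.fortin τ)) = l2norm (elt b) (cdiv (D.fortin τ)) :=
    lnorm_congr hae
  rw [← h3] at h2
  have hX : 0 ≤ l2norm (elt b) τ := lnorm_nonneg τ
  have hY : 0 ≤ l2norm (elt b) (weakDiv (elt b) τ) := lnorm_nonneg _
  have hY' : 0 ≤ l2norm (elt b) (weakDiv (elt b) (D.fortin τ)) := lnorm_nonneg _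
  have hP : 0 ≤ l2norm (elt b) (D.fortin τ) := lnorm_nonneg _
  rw [alphaNorm, alphaNorm]
  generalize l2norm (elt b) τ = X at *
  generalize l2norm (elt b) (weakDiv (elt b) τ) = Y at *
  generalize l2norm (elt b) (D.fortin τ) = P at *
  generalize l2norm (elt b) (weakDiv (elt b) (D.fortin τ)) = Q at *
  have h4 : P ≤ C * (1 + |K|) * (X + α * Y) := by
    refine h1.trans ?_
    rw [mul_assoc]
    refine mul_le_mul_of_nonneg_left ?_ hC.le
    have h5 : diam b * Y ≤ |K| * (α * Y) := by
      rw [← mul_assoc]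
      exact mul_le_mul_of_nonneg_right
        (hK.trans (mul_le_mul_of_nonneg_right (le_abs_self K) hα.le)) hY
    have h6 : 0 ≤ |K| * X := by positivity
    have h7 : 0 ≤ α * Y := by positivity
    linarith
  have hM : 0 ≤ C * (1 + |K|) := by positivity
  generalize C * (1 + |K|) = M at *
  have hs : (2 * M + 1) * √(X ^ 2 + α ^ 2 * Y ^ 2) =
      √((2 * M + 1) ^ 2 * (X ^ 2 + α ^ 2 * Y ^ 2)) := by
    rw [Real.sqrt_mul (sq_nonneg _), Real.sqrt_sq (by positivity)]
  rw [hs]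
  refine Real.sqrt_le_sqrt ?_
  have h8 : P ^ 2 ≤ M ^ 2 * (X + α * Y) ^ 2 := by
    rw [← mul_pow]
    exact pow_le_pow_left₀ hP h4 2
  have h9 : (X + α * Y) ^ 2 ≤ 2 * (X ^ 2 + α ^ 2 * Y ^ 2) := by
    nlinarith [sq_nonneg (X - α * Y)]
  have h10 : α ^ 2 * Q ^ 2 ≤ α ^ 2 * Y ^ 2 := by gcongr
  have h11 : M ^ 2 * (X + α * Y) ^ 2 ≤ M ^ 2 * (2 * (X ^ 2 + α ^ 2 * Y ^ 2)) := by gcongr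
  have h12 : 0 ≤ (2 * M ^ 2 + 4 * M) * (X ^ 2 + α ^ 2 * Y ^ 2) := by positivity
  have h13 : 0 ≤ X ^ 2 := sq_nonneg X
  linarith

end bounds

end FortinDiv

end

/-! ### The theorem -/

theorem theorem4p2 (n : ℕ) (hn : 1 ≤ n) (p : ℕ) :
    -- the bases used in the construction exist
    (∀ b : FortinDiv.Simplex n, Nonempty (FortinDiv.PrimalBases b p) ∧
      ∀ (B : FortinDiv.PrimalBases b p) (z : Fin (n + 1)),
        Nonempty (FortinDiv.DualBases B z)) ∧
    -- range, moment conditions, commutativity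
    (∀ (b : FortinDiv.Simplex n) (B : FortinDiv.PrimalBases b p) (z : Fin (n + 1))
      (D : FortinDiv.DualBases B z),
      B.V z ≤ FortinDiv.vecPoly n (p + 2) ∧
      ∀ τ : FortinDiv.E n → FortinDiv.E n, FortinDiv.MemHdiv (FortinDiv.elt b) τ →
        D.fortin τ ∈ B.V z ∧
        FortinDiv.MemHdiv (FortinDiv.elt b) (D.fortin τ) ∧
        (∀ u : FortinDiv.E n → ℝ, FortinDiv.IsContFacePoly b (p + 1) u →
          FortinDiv.PairingEq (FortinDiv.elt b) (τ - D.fortin τ) u 0) ∧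
        (∀ σ ∈ FortinDiv.vecPoly n p,
          ∫ x in FortinDiv.elt b, inner ℝ (σ x) (τ x - D.fortin τ x) = 0) ∧
        (∃ w : FortinDiv.E n → ℝ,
          FortinDiv.IsL2Proj b (p + 1) (FortinDiv.weakDiv (FortinDiv.elt b) τ) w ∧
          FortinDiv.weakDiv (FortinDiv.elt b) (D.fortin τ)
            =ᵐ[MeasureTheory.volume.restrict (FortinDiv.elt b)] w)) ∧
    -- boundedness, with a constant that depends only on `n`, `p` and the shape of the simplex
    (∀ γ : ℝ, ∃ C : ℝ, 0 < C ∧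
      ∀ (b : FortinDiv.Simplex n) (B : FortinDiv.PrimalBases b p) (z : Fin (n + 1))
        (D : FortinDiv.DualBases B z), FortinDiv.ShapeRegular γ b →
      ∀ τ : FortinDiv.E n → FortinDiv.E n, FortinDiv.MemHdiv (FortinDiv.elt b) τ →
        FortinDiv.l2norm (FortinDiv.elt b) (D.fortin τ) ≤
          C * (FortinDiv.l2norm (FortinDiv.elt b) τ +
            FortinDiv.diam b *
              FortinDiv.l2norm (FortinDiv.elt b) (FortinDiv.weakDiv (FortinDiv.elt b) τ))) ∧
    -- uniform boundedness in the parameter dependent norm if `h_T ≲ α`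
    (∀ γ K : ℝ, ∃ C : ℝ, 0 < C ∧
      ∀ (b : FortinDiv.Simplex n) (B : FortinDiv.PrimalBases b p) (z : Fin (n + 1))
        (D : FortinDiv.DualBases B z), FortinDiv.ShapeRegular γ b →
      ∀ α : ℝ, 0 < α → FortinDiv.diam b ≤ K * α →
      ∀ τ : FortinDiv.E n → FortinDiv.E n, FortinDiv.MemHdiv (FortinDiv.elt b) τ →
        FortinDiv.alphaNorm (FortinDiv.elt b) α (D.fortin τ) ≤
          C * FortinDiv.alphaNorm (FortinDiv.elt b) α τ) := by
  have : NeZero n := ⟨by omega⟩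
  refine ⟨fun b => ⟨FortinDiv.exists_primalBases b p, fun B z => FortinDiv.exists_dualBases b B z⟩,
    fun b B z D => ⟨B.V_le z, fun τ hτ => ?_⟩, fun γ => FortinDiv.exists_fortin_le n p γ,
    fun γ K => FortinDiv.exists_alphaNorm_fortin_le n p γ K⟩
  have hV := D.fortin_mem_V τ (D.fortinTilde_mem_V τ)
  exact ⟨hV, FortinDiv.memHdiv_of_mem_V hV, fun u hu => D.pairingEq_fortin hτ hu,
    fun σ hσ => D.integral_inner_fortin hτ hσ, _, D.isL2Proj_fortin hτ⟩
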